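/- Let $N$ be a lattice of rank $r\ge 2$, $M=\mathrm{Hom}(N,\mathbb Z)$, $N_{\mathbb R}=N\otimes\mathbb R$, let $\Delta=(n_e)_{e}$ be a finite family of non-zero vectors of $N$ with sum $0$, let $p\ge 0$, and consider the degree $\Delta\sqcup\{0^p\}$, whose $p$ additional ends $1,\dots,p$ of slope $0$ are called marked points. A rational tropical curve of this degree is a metric tree $\Gamma$ with all vertices of valency at least three and with unbounded ends labelled by $\Delta\sqcup\{0^p\}$, together with a map $h:\Gamma\to N_{\mathbb R}$ which is affine with slope in $N$ on every edge, satisfies the balancing condition at every vertex, and has the prescribed slope on each end; curves are considered up to isomorphism (isometries commuting with the maps and respecting the labels). A combinatorial type $C$ (the labelled tree without its lengths) is top-dimensional if every vertex is trivalent. For each end or marked point $z$ (with slope $n_z$, so $n_z=0$ for a marked point) let $L_z\subset N/\langle n_z\rangle$ be a sublattice with torsion-free quotient $Q_z$, such that $\sum_z \mathrm{rk}\,Q_z=|\Delta|+r+p-3$. An affine subspace $\mathcal L_z\subset N_{\mathbb R}/\langle n_z\rangle$ of slope $L_z$ is the same as a point of $Q_z\otimes\mathbb R$. For a top-dimensional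 type $C$ let $m_C^{\mathbb C,(L_z)}$ be the absolute value of the determinant, in lattice bases, of the linear map $\mathbb R^{\{\text{bounded edges}\}}\times N_{\mathbb R}\to\prod_z Q_z\otimes\mathbb R$ sending a curve (the lengths of its bounded edges and the position of one vertex) to the classes of the images $h(z)$ of its ends. A family $(\mathcal L_z)$ is generic if it is neither in the image, under this evaluation map, of a cone of the moduli space that is not top-dimensional, nor in the image of a top-dimensional cone $C$ with $m_C^{\mathbb C,(L_z)}=0$. Let $\omega\in\Lambda^2M$, $\varphi_1,\dots,\varphi_p\in M$, let $e_0$ be an end of $\Delta$, and let $\delta\in N$ be such that $\omega(n_{e_0},\delta)\ne0$ (if $\omega(n_{e_0},\cdot)=0$, so that there is no such vector, $\delta$ is arbitrary). Let $m_C^{\mathbb C,\omega,e_0,(\varphi_i)}$ be the absolute value of the determinant, in lattice bases, of the linear map sending a curve to the class of $h(e_0)$ in $N_{\mathbb R}/\langle n_{e_0},\delta\rangle$, the moments $\omega(n_e,h(e))$ for $e\in\Delta\setminus\{e_0\}$, and the values $\varphi_i(h(i))$ (it is $0$ if the dimensions differ). Suppose that for every top-dimensional type $C$, $$m_C^{\mathbb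 C,(L_z)}=0\ \Rightarrow\ m_C^{\mathbb C,\omega,e_0,(\varphi_i)}=0 .$$ Let $K_\omega\subset\Lambda^2N$ be the sublattice spanned by the bivectors $\pi_V=a_V\wedge b_V$ with $\omega(a_V,b_V)=0$, where $V$ runs over the trivalent vertices of combinatorial types of degree $\Delta$ and $a_V,b_V$ are two of the outgoing slopes at $V$. For a top-dimensional type $C$ of degree $\Delta\sqcup\{0^p\}$, let $\delta_i^C$ be the slope (defined up to sign) of the curve at the marked point $i$, and let $$B_C^{K_\omega}=\prod_V\left(q^{a_V\wedge b_V}-q^{b_V\wedge a_V}\right)\in\mathbb Z[\Lambda^2N/K_\omega],$$ the product being over the vertices $V$ which carry no marked point, with $a_V,b_V$ two outgoing slopes such that $\omega(a_V,b_V)>0$; a vertex with $\omega(a_V,b_V)=0$ contributes the factor $0$. Then the families $(\mathcal L_z)$ outside some finite union of proper linear subspaces of $\prod_zQ_z\otimes\mathbb R$ are generic, and there are signs $\varepsilon_C\in\{\pm1\}$, depending only on the combinatorial type $C$ (for the given $(L_z),\omega,(\varphi_i)$), such that for every generic family $(\mathcal L_z)$ the set of rational tropical curves $\Gamma$ of degree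 $\Delta\sqcup\{0^p\}$ with $h(z)\in\mathcal L_z$ for all ends and marked points $z$ is finite, and the sum over these curves, with $C$ the combinatorial type of $\Gamma$, $$\sum_{\Gamma}\varepsilon_C\prod_{i=1}^p|\varphi_i(\delta_i^C)|\,B_C^{K_\omega}\in\mathbb Z[\Lambda^2N/K_\omega]$$ does not depend on the generic family $(\mathcal L_z)$. -/

import Mathlib

open scoped TensorProduct

namespace TropicalCount

/-! ### The absolute value of the determinant of a map between lattices -/

section AbsDet

variable {A B : Type*} [AddCommGroup A] [AddCommGroup B]

open scoped Classical in
/-- The absolute value of the determinant of a homomorphism between two lattices, computed in a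
`ℤ`-basis of the domain and a `ℤ`-basis of the codomain; it is `0` if the ranks differ. -/
noncomputable def absDet (f : A →ₗ[ℤ] B) : ℕ :=
  if h : ∃ k : ℕ, Nonempty (Module.Basis (Fin k) ℤ A × Module.Basis (Fin k) ℤ B) then
    (LinearMap.toMatrix h.choose_spec.some.1 h.choose_spec.some.2 f).det.natAbs
  else 0

/-- `absDet` may be computed in any pair of bases. -/
theorem absDet_eq {k : ℕ} (a : Module.Basis (Fin k) ℤ A) (b : Module.Basis (Fin k) ℤ B)
    (f : A →ₗ[ℤ] B) : absDet f = (LinearMap.toMatrix a b f).det.natAbs := by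
  have key : ∀ (j : ℕ) (q : Module.Basis (Fin j) ℤ A × Module.Basis (Fin j) ℤ B),
      (LinearMap.toMatrix q.1 q.2 f).det.natAbs = (LinearMap.toMatrix a b f).det.natAbs := by
    intro j q
    have hj : j = k := by
      have h1 := Module.finrank_eq_card_basis q.1
      have h2 := Module.finrank_eq_card_basis a
      simp only [Fintype.card_fin] at h1 h2
      omega
    subst hj
    have ua : IsUnit (q.1.toMatrix a).det :=
      Matrix.isUnit_det_of_right_inverse (q.1.toMatrix_mul_toMatrix_flip a)
    have ub : IsUnit (b.toMatrix q.2).det :=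
      Matrix.isUnit_det_of_right_inverse (b.toMatrix_mul_toMatrix_flip q.2)
    rw [← basis_toMatrix_mul_linearMap_toMatrix_mul_basis_toMatrix a q.1 b q.2 f, Matrix.det_mul,
      Matrix.det_mul, Int.natAbs_mul, Int.natAbs_mul, Int.isUnit_iff_natAbs_eq.1 ua,
      Int.isUnit_iff_natAbs_eq.1 ub, one_mul, mul_one]
  have h : ∃ k : ℕ, Nonempty (Module.Basis (Fin k) ℤ A × Module.Basis (Fin k) ℤ B) :=
    ⟨k, ⟨(a, b)⟩⟩
  rw [absDet, dif_pos h]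
  exact key _ _

end AbsDet

/-! ### Combinatorial types -/

/-- The combinatorial type of an abstract rational tropical curve whose unbounded ends are labelled
by `E`: a finite tree (vertices and bounded edges), with the unbounded end `e` attached to the
vertex `foot e`, all of whose vertices have valency at least three. -/
structure LabelledTree (E : Type*) where
  numVertices : ℕ
  graph : SimpleGraph (Fin numVertices)
  isTree : graph.IsTree
  foot : E → Fin numVertices
  three_le_valency : ∀ v, 3 ≤ Nat.card ({w // graph.Adj v w} ⊕ {e // foot e = v})

/-- The edges (bounded edges and unbounded ends) adjacent to a vertex. -/
abbrev LabelledTree.Branch {E : Type*} (T : LabelledTree E) (v : Fin T.numVertices) : Type _ :=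
  {w // T.graph.Adj v w} ⊕ {e // T.foot e = v}

variable {E N : Type*} [AddCommGroup N]

/-- The slope of a branch at `v`, oriented away from `v`, when `n e` is the slope of the unbounded
end `e` and `s` gives the slopes of the oriented bounded edges. -/
def LabelledTree.outSlope (T : LabelledTree E) (n : E → N) (s : T.graph.Dart → N)
    (v : Fin T.numVertices) : T.Branch v → N
  | .inl w => s ⟨(v, w.1), w.2⟩
  | .inr e => n e.1

/-- A combinatorial type of parametrized rational tropical curves of degree `n : E → N`: the slopes
of the bounded edges are those which satisfy the balancing condition at every vertex. -/
structure CombType (n : E → N) extends LabelledTree E where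
  slope : graph.Dart → N
  slope_symm : ∀ d, slope d.symm = -slope d
  balanced : ∀ v, ∑ᶠ b, toLabelledTree.outSlope n slope v b = 0

namespace CombType

variable {n : E → N}

/-- The outgoing slopes at a vertex. -/
abbrev out (C : CombType n) (v : Fin C.numVertices) : C.Branch v → N :=
  C.outSlope n C.slope v

/-- Every vertex is adjacent to precisely three edges; these are the top-dimensional types. -/
def IsTrivalent (C : CombType n) : Prop := ∀ v, Nat.card (C.Branch v) = 3

/-- The isomorphism `σ` of graphs respects the labelled ends and the slopes. -/
structure IsIso {C D : CombType n} (σ : C.graph ≃g D.graph) : Prop where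
  foot : ∀ e, σ (C.foot e) = D.foot e
  slope : ∀ d, D.slope (σ.toHom.mapDart d) = C.slope d

theorem IsIso.refl (C : CombType n) : IsIso (C := C) (D := C) SimpleGraph.Iso.refl :=
  ⟨fun _ => rfl, fun _ => rfl⟩

theorem IsIso.symm {C D : CombType n} {σ : C.graph ≃g D.graph} (h : IsIso σ) :
    IsIso (C := D) (D := C) σ.symm := by
  refine ⟨fun e => by rw [← h.foot e]; exact σ.symm_apply_apply _, fun d => ?_⟩
  rw [← h.slope]
  congr 1
  ext <;> simp [SimpleGraph.Hom.mapDart]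

theorem IsIso.trans {C D F : CombType n} {σ : C.graph ≃g D.graph} {τ : D.graph ≃g F.graph}
    (h : IsIso σ) (k : IsIso τ) : IsIso (C := C) (D := F) (σ.trans τ) := by
  refine ⟨fun e => by rw [← k.foot, ← h.foot]; rfl, fun d => ?_⟩
  rw [← h.slope, ← k.slope]
  rfl

instance setoid (n : E → N) : Setoid (CombType n) where
  r C D := ∃ σ : C.graph ≃g D.graph, IsIso σ
  iseqv :=
    { refl := fun C => ⟨_, IsIso.refl C⟩
      symm := fun ⟨_, h⟩ => ⟨_, h.symm⟩
      trans := fun ⟨_, h⟩ ⟨_, k⟩ => ⟨_, h.trans k⟩ }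

/-- The lattice of integral points in the linear span of the cone of the type `C`: integral
lengths of the bounded edges and positions in `N` of the vertices which are compatible with the
slopes. The lengths and the position of one vertex are free coordinates on it, and identify it with
`ℤ^(bounded edges) × N`. -/
def lattice (C : CombType n) :
    Submodule ℤ ((C.graph.edgeSet → ℤ) × (Fin C.numVertices → N)) where
  carrier := {x | ∀ d : C.graph.Dart,
    x.2 d.snd - x.2 d.fst = x.1 ⟨d.edge, d.edge_mem⟩ • C.slope d}
  add_mem' {x y} hx hy d := by
    have h1 := hx d
    have h2 := hy d
    simp only [Prod.fst_add, Prod.snd_add, Pi.add_apply, add_smul] at *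
    rw [← h1, ← h2]
    abel
  zero_mem' d := by simp
  smul_mem' c x hx d := by
    have h1 := hx d
    simp only [Prod.smul_fst, Prod.smul_snd, Pi.smul_apply, smul_assoc] at *
    rw [← h1, smul_sub]

/-- The position of the vertex `v`, as a linear map on the lattice of the type. -/
def posAt (C : CombType n) (v : Fin C.numVertices) : C.lattice →ₗ[ℤ] N :=
  LinearMap.proj v ∘ₗ LinearMap.snd ℤ _ _ ∘ₗ C.lattice.subtype

end CombType

/-- Combinatorial types of degree `n`, up to isomorphism. -/
abbrev CombClass (n : E → N) : Type _ := Quotient (CombType.setoid n)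

/-! ### Parametrized tropical curves and their moduli space -/

/-- A parametrized rational tropical curve of degree `n` in `N_ℝ = ℝ ⊗ N`: positive lengths of the
bounded edges and positions of the vertices, such that the map is affine on each bounded edge with
the prescribed slope. On the unbounded end `e` the map is `t ↦ pos (foot e) + t • n e`, `t ≥ 0`. -/
structure TropicalCurve (n : E → N) extends CombType n where
  length : graph.edgeSet → ℝ
  length_pos : ∀ γ, 0 < length γ
  pos : Fin numVertices → ℝ ⊗[ℤ] N
  affine : ∀ d : graph.Dart,
    pos d.snd - pos d.fst = length ⟨d.edge, d.edge_mem⟩ • ((1 : ℝ) ⊗ₜ[ℤ] slope d)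

namespace TropicalCurve

variable {n : E → N}

/-- The isometry `σ` commutes with the maps to `N_ℝ` and respects the labelled ends. -/
structure IsIso {Γ Γ' : TropicalCurve n} (σ : Γ.graph ≃g Γ'.graph) : Prop where
  type : CombType.IsIso (C := Γ.toCombType) (D := Γ'.toCombType) σ
  length : ∀ γ, Γ'.length (σ.mapEdgeSet γ) = Γ.length γ
  pos : ∀ v, Γ'.pos (σ v) = Γ.pos v

instance setoid (n : E → N) : Setoid (TropicalCurve n) where
  r Γ Γ' := ∃ σ : Γ.graph ≃g Γ'.graph, IsIso σ
  iseqv :=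
    { refl := fun Γ => ⟨SimpleGraph.Iso.refl, CombType.IsIso.refl _,
        fun γ => congrArg Γ.length (Subtype.ext (congrFun Sym2.map_id γ.1)), fun _ => rfl⟩
      symm := by
        rintro Γ Γ' ⟨σ, h⟩
        refine ⟨σ.symm, h.type.symm, fun γ => ?_, fun v => ?_⟩
        · rw [← h.length]
          exact congrArg _ (σ.mapEdgeSet.apply_symm_apply γ)
        · rw [← h.pos]
          exact congrArg _ (σ.apply_symm_apply v)
      trans := by
        rintro Γ Γ' Γ'' ⟨σ, h⟩ ⟨τ, k⟩
        refine ⟨σ.trans τ, h.type.trans k.type, fun γ => ?_, fun v => ?_⟩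
        · rw [← h.length, ← k.length]
          congr 1
          exact Subtype.ext (Sym2.map_map (g := τ) (f := σ) γ.1).symm
        · rw [← h.pos, ← k.pos]
          rfl }

end TropicalCurve

/-- The moduli space of parametrized rational tropical curves of degree `n`. -/
abbrev Moduli (n : E → N) : Type _ := Quotient (TropicalCurve.setoid n)

/-- The combinatorial type of a point of the moduli space. -/
def Moduli.type {n : E → N} : Moduli n → CombClass n :=
  Quotient.map TropicalCurve.toCombType fun _ _ ⟨σ, h⟩ => ⟨σ, h.type⟩

/-! ### Affine constraints -/

section Constraints

variable {n : E → N} (L : ∀ e, Submodule ℤ (N ⧸ Submodule.span ℤ {n e}))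

/-- The lattice `Q_e`, the quotient of `N / ⟨n_e⟩` by `L_e`. -/
abbrev ConstraintQuot (e : E) : Type _ := (N ⧸ Submodule.span ℤ {n e}) ⧸ L e

/-- The projection `N → N / ⟨n_e⟩ → Q_e`. -/
def toQuot (e : E) : N →ₗ[ℤ] ConstraintQuot L e :=
  (L e).mkQ ∘ₗ (Submodule.span ℤ {n e}).mkQ

/-- The composed evaluation map on the cone of the type `C`, on integral points. -/
def CombType.ev (C : CombType n) : C.lattice →ₗ[ℤ] ∀ e, ConstraintQuot L e :=
  LinearMap.pi fun e => toQuot L e ∘ₗ C.posAt (C.foot e)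

/-- The complex multiplicity `m_C^{ℂ,(L_e)}`. -/
noncomputable def CombType.complexMult (C : CombType n) : ℕ := absDet (C.ev L)

/-- The space `∏_e Q_e ⊗ ℝ`. Its points are the families `(𝓛_e)` of affine subspaces
`𝓛_e ⊆ N_ℝ / ⟨n_e⟩` with slope `L_e`. -/
abbrev ConstraintSpace : Type _ := ∀ e, ℝ ⊗[ℤ] ConstraintQuot L e

/-- The composed evaluation map on the moduli space: the class in `Q_e ⊗ ℝ` of the image of a point
of the end `e`, for every `e`. -/
noncomputable def Moduli.ev : Moduli n → ConstraintSpace L :=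
  Quotient.lift (fun Γ e => (toQuot L e).baseChange ℝ (Γ.pos (Γ.foot e))) (by
    rintro Γ Γ' ⟨σ, h⟩
    funext e
    rw [← h.type.foot, h.pos])

/-- The curves which satisfy the constraints `lam`. -/
def solutions (lam : ConstraintSpace L) : Set (Moduli n) := {Γ | Γ.ev L = lam}

/-- The constraints `lam` are generic: they lie neither in the image of a cone which is not
top-dimensional, nor in the image of a top-dimensional cone on which the composed evaluation map is
not invertible. -/
def IsGeneric (lam : ConstraintSpace L) : Prop :=
  ∀ Γ ∈ solutions L lam, ∀ C : CombType n, Γ.type = ⟦C⟧ → C.IsTrivalent ∧ C.complexMult L ≠ 0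

end Constraints

/-! ### Refined multiplicities -/

/-- The bivector `a ∧ b` in `Λ² N`. -/
noncomputable def wedge (a b : N) : ⋀[ℤ]^2 N := exteriorPower.ιMulti ℤ 2 ![a, b]

/-- The sublattice `K_ω` of `Λ² N` spanned by the bivectors `π_V` with `ω(π_V) = 0`, for the
trivalent vertices `V` of curves of degree `n`. Such a vertex is given by a partition of the ends
into three nonempty parts `A`, `B` and `(A ∪ B)ᶜ`, and two of its outgoing slopes are the sums of
the `n e` over `A` and over `B`. -/
noncomputable def kernelSpan [Fintype E] [DecidableEq E] (n : E → N) (ω : LinearMap.BilinForm ℤ N) :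
    Submodule ℤ (⋀[ℤ]^2 N) :=
  Submodule.span ℤ {π | ∃ A B : Finset E, Disjoint A B ∧ A.Nonempty ∧ B.Nonempty ∧
    (A ∪ B)ᶜ.Nonempty ∧ ω (∑ e ∈ A, n e) (∑ e ∈ B, n e) = 0 ∧
    π = wedge (∑ e ∈ A, n e) (∑ e ∈ B, n e)}

/-- The monomial `q ^ x`, with exponent taken modulo `K`. -/
noncomputable def qPow (K : Submodule ℤ (⋀[ℤ]^2 N)) (x : ⋀[ℤ]^2 N) :
    AddMonoidAlgebra ℤ ((⋀[ℤ]^2 N) ⧸ K) :=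
  AddMonoidAlgebra.single (K.mkQ x) 1

namespace CombType

variable {n : E → N}

/-- `a` and `b` are the outgoing slopes of two distinct edges adjacent to `v`. -/
def IsOutPair (C : CombType n) (v : Fin C.numVertices) (a b : N) : Prop :=
  ∃ x y : C.Branch v, x ≠ y ∧ C.out v x = a ∧ C.out v y = b

open scoped Classical in
/-- The factor `q ^ (a_V ∧ b_V) - q ^ (b_V ∧ a_V)` of a trivalent vertex `V`, where `a_V` and `b_V`
are two outgoing slopes with `ω(a_V, b_V) > 0`; it is `0` if `ω(a_V, b_V) = 0`. By balancing, it does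
not depend on the choice of `a_V` and `b_V`. -/
noncomputable def vertexFactor (ω : LinearMap.BilinForm ℤ N) (K : Submodule ℤ (⋀[ℤ]^2 N))
    (C : CombType n) (v : Fin C.numVertices) : AddMonoidAlgebra ℤ ((⋀[ℤ]^2 N) ⧸ K) :=
  if h : ∃ s : N × N, C.IsOutPair v s.1 s.2 ∧ 0 < ω s.1 s.2 then
    qPow K (wedge h.choose.1 h.choose.2) - qPow K (wedge h.choose.2 h.choose.1)
  else 0

/-- The map on branches induced by an isomorphism. -/
def IsIso.branchMap {C D : CombType n} {σ : C.graph ≃g D.graph} (h : IsIso σ)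
    (v : Fin C.numVertices) : C.Branch v → D.Branch (σ v) :=
  Sum.map (fun w => ⟨σ w.1, σ.map_adj_iff.2 w.2⟩) (fun e => ⟨e.1, by rw [← h.foot, e.2]⟩)

theorem IsIso.branchMap_injective {C D : CombType n} {σ : C.graph ≃g D.graph} (h : IsIso σ)
    (v : Fin C.numVertices) : Function.Injective (h.branchMap v) := by
  refine Function.Injective.sumMap (fun x y hxy => ?_) (fun x y hxy => ?_)
  · exact Subtype.ext (σ.injective (congrArg Subtype.val hxy))
  · have := congrArg Subtype.val hxy
    exact Subtype.ext this

theorem IsIso.out_branchMap {C D : CombType n} {σ : C.graph ≃g D.graph} (h : IsIso σ)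
    (v : Fin C.numVertices) (x : C.Branch v) : D.out (σ v) (h.branchMap v x) = C.out v x := by
  rcases x with w | e
  · exact h.slope ⟨(v, w.1), w.2⟩
  · rfl

theorem IsIso.isOutPair {C D : CombType n} {σ : C.graph ≃g D.graph} (h : IsIso σ)
    {v : Fin C.numVertices} {a b : N} (hab : C.IsOutPair v a b) : D.IsOutPair (σ v) a b := by
  obtain ⟨x, y, hxy, rfl, rfl⟩ := hab
  exact ⟨_, _, (h.branchMap_injective v).ne hxy, h.out_branchMap v x, h.out_branchMap v y⟩

theorem IsIso.isOutPair_iff {C D : CombType n} {σ : C.graph ≃g D.graph} (h : IsIso σ)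
    (v : Fin C.numVertices) (a b : N) : D.IsOutPair (σ v) a b ↔ C.IsOutPair v a b := by
  refine ⟨fun k => ?_, h.isOutPair⟩
  have k2 := h.symm.isOutPair k
  rwa [show σ.symm (σ v) = v from σ.symm_apply_apply v] at k2

theorem IsIso.vertexFactor_eq {C D : CombType n} {σ : C.graph ≃g D.graph} (h : IsIso σ)
    (ω : LinearMap.BilinForm ℤ N) (K : Submodule ℤ (⋀[ℤ]^2 N)) (v : Fin C.numVertices) :
    D.vertexFactor ω K (σ v) = C.vertexFactor ω K v := by
  classical
  have hP : (fun s : N × N => D.IsOutPair (σ v) s.1 s.2 ∧ 0 < ω s.1 s.2) =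
      fun s => C.IsOutPair v s.1 s.2 ∧ 0 < ω s.1 s.2 :=
    funext fun s => propext (and_congr_left fun _ => h.isOutPair_iff v s.1 s.2)
  have key : ∀ P Q : N × N → Prop, P = Q →
      (if k : ∃ s, P s then
        qPow K (wedge k.choose.1 k.choose.2) - qPow K (wedge k.choose.2 k.choose.1) else 0) =
      if k : ∃ s, Q s then
        qPow K (wedge k.choose.1 k.choose.2) - qPow K (wedge k.choose.2 k.choose.1) else 0 := by
    rintro P _ rfl
    rfl
  unfold vertexFactor
  convert key _ _ hP

end CombType

/-! ### Curves with marked points -/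

section Marked

variable {ι : Type*}

/-- The degree `Δ ⊔ {0^p}`: the ends of slope `0` are the marked points. -/
def markedDegree (n : ι → N) (p : ℕ) : ι ⊕ Fin p → N := Sum.elim n fun _ => 0

namespace CombType

variable {n : ι → N} {p : ℕ}

/-- The vertex `v` carries a marked point. -/
def IsMarked (C : CombType (markedDegree n p)) (v : Fin C.numVertices) : Prop :=
  ∃ i : Fin p, C.foot (.inr i) = v

/-- `s` is the outgoing slope of an edge, other than the marked point `i` itself, at the vertex which
carries `i`. -/
def IsSlopeAt (C : CombType (markedDegree n p)) (i : Fin p) (s : N) : Prop :=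
  ∃ x : C.Branch (C.foot (.inr i)), x ≠ .inr ⟨.inr i, rfl⟩ ∧ C.out _ x = s

/-- The slope `δ_i` of the curve at the marked point `i`. If the vertex of `i` is trivalent, then the
two other edges have opposite slopes, so that `δ_i` is well-defined up to sign. -/
noncomputable def markedSlope (C : CombType (markedDegree n p)) (i : Fin p) : N :=
  Classical.epsilon (C.IsSlopeAt i)

open scoped Classical in
/-- The refined multiplicity `B_C^K` of the curve without its marked points: the product runs over
the vertices which carry no marked point. -/
noncomputable def refinedMult (ω : LinearMap.BilinForm ℤ N) (K : Submodule ℤ (⋀[ℤ]^2 N))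
    (C : CombType (markedDegree n p)) : AddMonoidAlgebra ℤ ((⋀[ℤ]^2 N) ⧸ K) :=
  ∏ v with ¬ C.IsMarked v, C.vertexFactor ω K v

/-- The multiplicity `∏_i |φ_i(δ_i)| B_C^{K_ω}`. -/
noncomputable def weight [Fintype ι] [DecidableEq ι] (ω : LinearMap.BilinForm ℤ N)
    (φ : Fin p → N →ₗ[ℤ] ℤ) (C : CombType (markedDegree n p)) :
    AddMonoidAlgebra ℤ ((⋀[ℤ]^2 N) ⧸ kernelSpan n ω) :=
  (∏ i, (φ i (C.markedSlope i)).natAbs) • C.refinedMult ω (kernelSpan n ω)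

theorem IsIso.isSlopeAt {C D : CombType (markedDegree n p)} {σ : C.graph ≃g D.graph}
    (h : IsIso σ) {i : Fin p} {s : N} (hs : C.IsSlopeAt i s) : D.IsSlopeAt i s := by
  obtain ⟨x, hx, hs⟩ := hs
  have key : ∀ w (hw : D.foot (.inr i) = w), σ (C.foot (.inr i)) = w →
      (∃ y : D.Branch w, y ≠ .inr ⟨.inr i, hw⟩ ∧ D.out w y = s) → D.IsSlopeAt i s := by
    rintro w rfl - k
    exact k
  refine key _ (h.foot _).symm rfl ⟨h.branchMap _ x, fun e => hx ?_, ?_⟩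
  · exact h.branchMap_injective _ e
  · rw [h.out_branchMap, hs]

theorem IsIso.weight_eq [Fintype ι] [DecidableEq ι] {C D : CombType (markedDegree n p)}
    {σ : C.graph ≃g D.graph} (h : IsIso σ) (ω : LinearMap.BilinForm ℤ N)
    (φ : Fin p → N →ₗ[ℤ] ℤ) : C.weight ω φ = D.weight ω φ := by
  have h1 : C.markedSlope = D.markedSlope := by
    funext i
    exact congrArg _ (funext fun s => propext ⟨h.isSlopeAt, h.symm.isSlopeAt⟩)
  have h2 : ∀ v, D.IsMarked (σ v) ↔ C.IsMarked v := fun v => by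
    simp only [IsMarked, ← h.foot, EmbeddingLike.apply_eq_iff_eq]
  classical
  rw [weight, weight, h1, refinedMult, refinedMult]
  congr 1
  refine Finset.prod_equiv σ.toEquiv (fun v => ?_) (fun v _ => (h.vertexFactor_eq ω _ v).symm)
  simp only [Finset.mem_filter, Finset.mem_univ, true_and]
  exact not_congr (h2 v).symm

/-- The composed evaluation map of the problem `P(ω, e₀, (φ_i))` on the cone of the type `C`, on
integral points: the class of the end `e₀` modulo `n_{e₀}` and the direction `δ` of the constraint
`D`, the moments `ω(n_e, ·)` of the other ends, and the values of the `φ_i` at the marked points.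
The first factor is the lattice of the images of the elements of `N` in `N_ℝ / ⟨n_{e₀}, δ⟩`. -/
def momentEv (ω : LinearMap.BilinForm ℤ N) (φ : Fin p → N →ₗ[ℤ] ℤ) (e₀ : ι) (δ : N)
    (C : CombType (markedDegree n p)) :
    C.lattice →ₗ[ℤ] ((N ⧸ Submodule.span ℤ {n e₀, δ}) ⧸
      Submodule.torsion ℤ (N ⧸ Submodule.span ℤ {n e₀, δ})) ×
        ({e // e ≠ e₀} → ℤ) × (Fin p → ℤ) :=
  ((Submodule.torsion ℤ _).mkQ ∘ₗ (Submodule.span ℤ {n e₀, δ}).mkQ ∘ₗ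
    C.posAt (C.foot (.inl e₀))).prod
  ((LinearMap.pi fun e : {e // e ≠ e₀} => ω (n e.1) ∘ₗ C.posAt (C.foot (.inl e.1))).prod
    (LinearMap.pi fun i => φ i ∘ₗ C.posAt (C.foot (.inr i))))

/-- The complex multiplicity `m_C^{ℂ,ω,e₀,(φ_i)}`. -/
noncomputable def momentMult (ω : LinearMap.BilinForm ℤ N) (φ : Fin p → N →ₗ[ℤ] ℤ) (e₀ : ι) (δ : N)
    (C : CombType (markedDegree n p)) : ℕ :=
  absDet (C.momentEv ω φ e₀ δ)

end CombType

/-- The multiplicity `∏_i |φ_i(δ_i)| B_C^{K_ω}` of an isomorphism class of types. -/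
noncomputable def CombClass.weight [Fintype ι] [DecidableEq ι] {n : ι → N} {p : ℕ}
    (ω : LinearMap.BilinForm ℤ N) (φ : Fin p → N →ₗ[ℤ] ℤ) : CombClass (markedDegree n p) →
      AddMonoidAlgebra ℤ ((⋀[ℤ]^2 N) ⧸ kernelSpan n ω) :=
  Quotient.lift (fun C => C.weight ω φ) fun _ _ ⟨_, h⟩ => h.weight_eq ω φ

end Marked

end TropicalCount

/-!
A tree with labelled ends and without vertices of valency two is determined by the sets of ends
which lie beyond its bounded edges, as seen from a root end. These sets form a nested family (`IsNested`), and every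
nested family comes from a tree (`LabelledTree.splits`, `IsNested.tree`, `IsNested.tree_splits`).
Hence the moduli space of curves is a simplicial fan with one cone for each nested family `F`. The
coordinates on the cone are the lengths of the bounded edges; the position of the root vertex gives
a lineality space `N_ℝ` common to all cones. The evaluation map is linear on every cone, and the
curves which satisfy generic constraints correspond to the cones whose image contains the
constraints in its interior (`bijOn_solutions`).

For a map from such a fan to a vector space of the same dimension, a weighted number of preimages is
the same at all regular points if the weights satisfy a balancing condition at every wall, that is,
at every cone of codimension one (`FanMap.count_eq_count`): the ray which leaves a regular point in
a generic direction meets no image of a cone of codimension two, crossing the image of a wall does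
not change the number because of the balancing condition, and far out on the ray the number depends
on the direction only.

The refined multiplicities are balanced with respect to the moment problem, not with respect to the
given constraints. A wall is a type with one vertex of valency four, and the adjacent
top-dimensional types are the three resolutions of this vertex. A linear form which vanishes on the
image of the wall under the moment map determines a coefficient of `ω (slope, ·)` at each unmarked
edge. The signs of this form on the three resolutions turn the balancing condition into the identity
`qDiff_resolutions` between products of differences `q ^ (a ∧ b) - q ^ (b ∧ a)`, or into the
additivity of `φ_i` if the vertex carries the marked point `i` (`sum_resolutionTerm`,
`sum_sign_moment_smul_familyWeight`). The quotient by `K_ω` is needed where `ω` vanishes at the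
vertices of the resolutions.

To pass to the given constraints, let `ε_C` be the sign which compares the two orientations of the
cone of `C` obtained by pulling back fixed orientations of the targets of the two problems
(`coneSign`). The form defining a wall is proportional to a determinant in which only the ray
leaving the wall varies. This is so in both problems, so that multiplication by `ε_C` transforms
the balancing condition of one problem into that of the other (`sum_coneSign_smul_eq_zero`). This
requires that a cone with non-zero weight is non-degenerate for both problems. For the moment
problem this holds because the factors of all vertices are non-zero (`coneSpan_moment_eq_top`); for
the constraints it then follows from the hypothesis that the multiplicity of the moment problem
vanishes wherever that of the constraints does.

If `ω (n_{e₀}, ·) = 0`, the moment problem is always degenerate. In this case, the first unmarked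
vertex, as seen from `e₀`, has factor zero, so that all weights vanish unless there are only two
ends. The curves with two ends are lines with marked points; their weights do not involve `ω`, which
may then be replaced by a form with `ω (n_{e₀}, ·) ≠ 0` (`exists_sign_finsum_eq_of_degenerate`).
-/

namespace TropicalCount

/-! ### Wall crossing in a simplicial fan -/

section WallCrossing

variable {S W R : Type*} [Fintype S] [DecidableEq S] [AddCommGroup W] [Module ℝ W] [AddCommGroup R]

/-- A linear map from a fan whose cones are indexed by finite subsets of `S`: the ray `s` is sent to
`ray s`, and the common lineality space of all cones is sent onto `lin`. Only the top-dimensional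
cones `F ∈ top` on which the map is invertible are recorded, together with the coordinates
`coord F : W → ℝ^S` on the target given by such a cone. -/
structure FanMap (S W : Type*) [Fintype S] [DecidableEq S] [AddCommGroup W] [Module ℝ W] where
  top : Finset (Finset S)
  ray : S → W
  lin : Submodule ℝ W
  coord : Finset S → W →ₗ[ℝ] S → ℝ
  coord_of_notMem : ∀ F ∈ top, ∀ s ∉ F, ∀ w, coord F w s = 0
  coord_ray : ∀ F ∈ top, ∀ s ∈ F, coord F (ray s) = Pi.single s 1
  coord_lin : ∀ F ∈ top, ∀ x ∈ lin, coord F x = 0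
  sub_sum_mem : ∀ F ∈ top, ∀ w, w - ∑ s, coord F w s • ray s ∈ lin

namespace FanMap

variable (P : FanMap S W)

/-- The point `w` is not on the boundary of the image of a cone of `P.top`. -/
def IsRegular (w : W) : Prop :=
  ∀ F ∈ P.top, (∀ s ∈ F, 0 ≤ P.coord F w s) → ∀ s ∈ F, 0 < P.coord F w s

open scoped Classical in
/-- The sum of the weights `c F` of the cones `F` whose image contains `w` in its interior. -/
noncomputable def count (c : Finset S → R) (w : W) : R :=
  ∑ F ∈ P.top, if ∀ s ∈ F, 0 < P.coord F w s then c F else 0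

/-- The weights `c` satisfy the balancing condition at every wall. A wall `G` is cut out by a linear
form `α`, and the cones adjacent to `G` on the two sides of it are counted with opposite signs. -/
def IsBalanced (c : Finset S → R) : Prop :=
  ∀ (G : Finset S) (α : W →ₗ[ℝ] ℝ), (∀ g ∈ G, α (P.ray g) = 0) → (∀ x ∈ P.lin, α x = 0) →
    ∑ s with s ∉ G ∧ insert s G ∈ P.top, (SignType.sign (α (P.ray s)) : ℤ) • c (insert s G) = 0

variable {P}

theorem eq_sum_coord {F : Finset S} (hF : F ∈ P.top) {M : Type*} [AddCommGroup M] [Module ℝ M]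
    (f : W →ₗ[ℝ] M) (hf : ∀ x ∈ P.lin, f x = 0) (w : W) :
    f w = ∑ s ∈ F, P.coord F w s • f (P.ray s) := by
  have h := hf _ (P.sub_sum_mem F hF w)
  rw [map_sub, sub_eq_zero, map_sum] at h
  rw [h]
  symm
  refine Finset.sum_subset_zero_on_sdiff (Finset.subset_univ _) (fun s hs => ?_) (fun s _ => ?_)
  · rw [P.coord_of_notMem F hF s (by simpa using hs), zero_smul, map_zero]
  · rw [map_smul]

/-- On a common face the coordinates of two cones agree. -/
theorem coord_eq_coord {F F' : Finset S} (hF : F ∈ P.top) (hF' : F' ∈ P.top) {w : W}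
    (h : ∀ s ∈ F, s ∉ F' → P.coord F w s = 0) : P.coord F' w = P.coord F w := by
  rw [eq_sum_coord hF (P.coord F') (P.coord_lin F' hF') w]
  have : ∀ s ∈ F, P.coord F w s • P.coord F' (P.ray s) = Pi.single s (P.coord F w s) := by
    intro s hs
    by_cases hs' : s ∈ F'
    · rw [P.coord_ray F' hF' s hs', ← Pi.single_smul, smul_eq_mul, mul_one]
    · rw [h s hs hs', zero_smul, Pi.single_zero]
  rw [Finset.sum_congr rfl this]
  funext t
  rw [Finset.sum_apply]
  by_cases ht : t ∈ F
  · rw [Finset.sum_eq_single_of_mem t ht (fun s _ hst => Pi.single_eq_of_ne hst.symm _),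
      Pi.single_eq_same]
  · rw [P.coord_of_notMem F hF t ht]
    exact Finset.sum_eq_zero fun s hs => Pi.single_eq_of_ne (by rintro rfl; exact ht hs) _

/-- The point `w` lies in the relative interior of the facet of `F` opposite to `s`. -/
def IsFacetPoint (P : FanMap S W) (w : W) (F : Finset S) (s : S) : Prop :=
  P.coord F w s = 0 ∧ ∀ t ∈ F, t ≠ s → 0 < P.coord F w t

open scoped Classical in
/-- The cones adjacent to a wall through `w`, counted with the sign of the side on which `w + t u`
enters them, cancel. -/
theorem sum_wall_eq_zero {c : Finset S → R} (hc : P.IsBalanced c) (w u : W) :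
    ∑ F ∈ P.top, ∑ s ∈ F, (if P.IsFacetPoint w F s then
      (SignType.sign (P.coord F u s) : ℤ) • c F else 0) = 0 := by
  rw [Finset.sum_sigma']
  rw [← Finset.sum_filter]
  set A := (P.top.sigma fun F => F).filter fun x => P.IsFacetPoint w x.1 x.2 with hA
  rw [← Finset.sum_fiberwise_of_maps_to (g := fun x => x.1.erase x.2) (t := A.image fun x =>
    x.1.erase x.2) (fun x hx => Finset.mem_image_of_mem _ hx)]
  -- The pairs `(F, s)` are grouped by the wall `G = F \ {s}`; the equation of the wall is the
  -- `s₀`-th coordinate of any one of the cones adjacent to it.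
  refine Finset.sum_eq_zero fun G hG => ?_
  obtain ⟨⟨F₀, s₀⟩, h₀, rfl⟩ := Finset.mem_image.1 hG
  simp only [hA, Finset.mem_filter, Finset.mem_sigma] at h₀
  obtain ⟨⟨hF₀, hs₀⟩, hw₀⟩ := h₀
  set G := F₀.erase s₀ with hGdef
  let α : W →ₗ[ℝ] ℝ := LinearMap.proj s₀ ∘ₗ P.coord F₀
  have hα : ∀ w, α w = P.coord F₀ w s₀ := fun _ => rfl
  have hαG : ∀ g ∈ G, α (P.ray g) = 0 := by
    intro g hg
    rw [hα, P.coord_ray F₀ hF₀ g (Finset.mem_of_mem_erase hg)]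
    exact Pi.single_eq_of_ne (Finset.ne_of_mem_erase hg).symm _
  have hαL : ∀ x ∈ P.lin, α x = 0 := by
    intro x hx
    rw [hα, P.coord_lin F₀ hF₀ x hx]
    rfl
  have key : ∀ s, s ∉ G → insert s G ∈ P.top → ∀ v,
      α v = P.coord (insert s G) v s * α (P.ray s) := by
    intro s hs hF v
    rw [eq_sum_coord hF α hαL v, Finset.sum_insert hs, Finset.sum_eq_zero, add_zero, smul_eq_mul]
    intro g hg
    rw [hαG g hg, smul_zero]
  have h1 : α (P.ray s₀) = 1 := by
    rw [hα, P.coord_ray F₀ hF₀ s₀ hs₀, Pi.single_eq_same]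
  have hsum : ∑ x ∈ A with x.1.erase x.2 = G,
      (SignType.sign (P.coord x.1 u x.2) : ℤ) • c x.1 =
      ∑ s with s ∉ G ∧ insert s G ∈ P.top,
        (SignType.sign (α u) : ℤ) • (SignType.sign (α (P.ray s)) : ℤ) • c (insert s G) := by
    refine Finset.sum_bij' (fun x _ => x.2) (fun s _ => ⟨insert s G, s⟩) ?_ ?_ ?_ ?_ ?_
    · rintro ⟨F, s⟩ hx
      simp only [hA, Finset.mem_filter, Finset.mem_sigma, Finset.mem_univ, true_and] at hx ⊢
      obtain ⟨⟨⟨hF, hs⟩, -⟩, hG⟩ := hx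
      rw [← hG]
      exact ⟨Finset.notMem_erase _ _, by rwa [Finset.insert_erase hs]⟩
    · intro s hx
      simp only [hA, Finset.mem_filter, Finset.mem_sigma, Finset.mem_univ, true_and] at hx ⊢
      refine ⟨⟨⟨hx.2, Finset.mem_insert_self _ _⟩, ?_⟩, Finset.erase_insert hx.1⟩
      have hco : P.coord (insert s G) w = P.coord F₀ w := by
        refine coord_eq_coord hF₀ hx.2 fun t ht ht' => ?_
        by_cases hts : t = s₀
        · rw [hts]; exact hw₀.1
        · exact absurd (Finset.mem_insert_of_mem (Finset.mem_erase.2 ⟨hts, ht⟩)) ht'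
      have hzero : P.coord (insert s G) w s = 0 := by
        by_cases hss : s = s₀
        · rw [hco, hss]; exact hw₀.1
        · rw [hco]
          exact P.coord_of_notMem F₀ hF₀ s
            (fun hs => hx.1 (Finset.mem_erase.2 ⟨hss, hs⟩)) w
      refine ⟨hzero, fun t ht hts => ?_⟩
      have htG : t ∈ G := (Finset.mem_insert.1 ht).resolve_left hts
      show 0 < P.coord (insert s G) w t
      rw [hco]
      exact hw₀.2 t (Finset.mem_of_mem_erase htG) (Finset.ne_of_mem_erase htG)
    · rintro ⟨F, s⟩ hx
      simp only [hA, Finset.mem_filter, Finset.mem_sigma] at hx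
      obtain ⟨⟨⟨hF, hs⟩, -⟩, hG⟩ := hx
      simp only [← hG, Finset.insert_erase hs]
    · intro s hs
      rfl
    · rintro ⟨F, s⟩ hx
      simp only [hA, Finset.mem_filter, Finset.mem_sigma] at hx
      obtain ⟨⟨⟨hF, hs⟩, -⟩, hG⟩ := hx
      have hsG : s ∉ G := by rw [← hG]; exact Finset.notMem_erase _ _
      have hFG : insert s G = F := by rw [← hG]; exact Finset.insert_erase hs
      have hF' : insert s G ∈ P.top := by rwa [hFG]
      simp only [hFG]
      have e1 := key s hsG hF' (P.ray s₀)
      have e2 := key s hsG hF' u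
      rw [hFG] at e1 e2
      rw [h1] at e1
      have hne : α (P.ray s) ≠ 0 := fun h0 => by simp [h0] at e1
      have : (SignType.sign (P.coord F u s) : ℤ) =
          (SignType.sign (α u) : ℤ) * (SignType.sign (α (P.ray s)) : ℤ) := by
        have hsq : (SignType.sign (α (P.ray s)) : ℤ) * (SignType.sign (α (P.ray s)) : ℤ) = 1 := by
          rcases lt_or_gt_of_ne hne with h | h
          · simp [sign_neg h]
          · simp [sign_pos h]
        rw [e2, sign_mul, SignType.coe_mul, mul_assoc, hsq, mul_one]
      rw [this, mul_smul]
  rw [hsum, ← Finset.smul_sum, hc G α hαG hαL, smul_zero]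

open scoped Classical in
/-- The cones which contain the points `w + t u` for small `t > 0` and for small `t < 0` have the
same total weight, provided that `w` lies on no face of codimension two. -/
theorem sum_right_eq_sum_left {c : Finset S → R} (hc : P.IsBalanced c) (w u : W)
    (hw : ∀ F ∈ P.top, ∀ s ∈ F, ∀ t ∈ F, s ≠ t → P.coord F w s = 0 → P.coord F w t = 0 →
      ∃ r ∈ F, P.coord F w r < 0) :
    ∑ F ∈ P.top, (if ∀ s ∈ F, 0 < P.coord F w s ∨ P.coord F w s = 0 ∧ 0 < P.coord F u s
      then c F else 0) =
    ∑ F ∈ P.top, (if ∀ s ∈ F, 0 < P.coord F w s ∨ P.coord F w s = 0 ∧ P.coord F u s < 0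
      then c F else 0) := by
  rw [← sub_eq_zero, ← Finset.sum_sub_distrib]
  refine Eq.trans ?_ (sum_wall_eq_zero hc w u)
  refine Finset.sum_congr rfl fun F hF => ?_
  by_cases hneg : ∃ r ∈ F, P.coord F w r < 0
  · obtain ⟨r, hr, hneg⟩ := hneg
    have e : ∀ q : Prop, ¬ (0 < P.coord F w r ∨ P.coord F w r = 0 ∧ q) := by
      rintro q (h | ⟨h, -⟩) <;> linarith
    rw [if_neg fun h => e _ (h r hr), if_neg fun h => e _ (h r hr), sub_zero,
      Finset.sum_eq_zero fun s hs => if_neg ?_]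
    rintro ⟨h1, h2⟩
    by_cases hrs : r = s
    · rw [hrs] at hneg; linarith
    · have := h2 r hr hrs; linarith
  have hnn : ∀ r ∈ F, 0 ≤ P.coord F w r := fun r hr => by
    by_contra h
    exact hneg ⟨r, hr, not_le.1 h⟩
  by_cases hz : ∃ s ∈ F, P.coord F w s = 0
  · obtain ⟨s, hs, hz⟩ := hz
    have hpos : ∀ t ∈ F, t ≠ s → 0 < P.coord F w t := by
      intro t ht hts
      refine lt_of_le_of_ne (hnn t ht) fun h => hneg (hw F hF s hs t ht hts.symm hz h.symm)
    rw [Finset.sum_eq_single_of_mem s hs, if_pos (show P.IsFacetPoint w F s from ⟨hz, hpos⟩)]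
    · have e : ∀ q : S → Prop, (∀ t ∈ F, 0 < P.coord F w t ∨ P.coord F w t = 0 ∧ q t) ↔ q s := by
        intro q
        refine ⟨fun h => ?_, fun h t ht => ?_⟩
        · rcases h s hs with h | h
          · linarith
          · exact h.2
        · by_cases hts : t = s
          · rw [hts]; exact Or.inr ⟨hz, h⟩
          · exact Or.inl (hpos t ht hts)
      rw [if_congr (e fun t => 0 < P.coord F u t) rfl rfl,
        if_congr (e fun t => P.coord F u t < 0) rfl rfl]
      rcases lt_trichotomy (P.coord F u s) 0 with h | h | h
      · simp [h, h.not_gt]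
      · simp [h]
      · simp [h, h.not_gt]
    · intro t ht hts
      rw [if_neg]
      rintro ⟨h1, -⟩
      exact (hpos t ht hts).ne' h1
  · have hpos : ∀ s ∈ F, 0 < P.coord F w s := fun s hs =>
      lt_of_le_of_ne (hnn s hs) fun h => hz ⟨s, hs, h.symm⟩
    rw [if_pos fun s hs => Or.inl (hpos s hs), if_pos fun s hs => Or.inl (hpos s hs), sub_self,
      Finset.sum_eq_zero fun s hs => if_neg fun h => (hpos s hs).ne' h.1]

open Filter Topology in
/-- The condition `0 < x ∨ x = 0 ∧ 0 < b` on `x = a + t b` says that `a + t' b` is positive for all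
`t'` slightly larger than `t`; it does not change if `t` itself is slightly increased. -/
theorem eventually_right (a b t₀ : ℝ) (hb : b ≠ 0) : ∀ᶠ t in 𝓝[>] t₀,
    ((0 < a + t * b ∨ a + t * b = 0 ∧ 0 < b) ↔ (0 < a + t₀ * b ∨ a + t₀ * b = 0 ∧ 0 < b)) := by
  have hcont : Tendsto (fun t => a + t * b) (𝓝 t₀) (𝓝 (a + t₀ * b)) :=
    Continuous.tendsto (by fun_prop) t₀
  rcases lt_trichotomy (a + t₀ * b) 0 with h | h | h
  · filter_upwards [nhdsWithin_le_nhds (hcont.eventually (gt_mem_nhds h))] with t ht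
    constructor <;> rintro (h' | ⟨h', -⟩) <;> linarith
  · filter_upwards [self_mem_nhdsWithin] with t ht
    have ht : t₀ < t := ht
    rcases lt_or_gt_of_ne hb with hb | hb
    · have : a + t * b < 0 := by nlinarith
      constructor <;> rintro (h' | ⟨h', h''⟩) <;> linarith
    · have : 0 < a + t * b := by nlinarith
      simp [this, h, hb]
  · filter_upwards [nhdsWithin_le_nhds (hcont.eventually (lt_mem_nhds h))] with t ht
    simp [ht, h]

open Filter Topology in
theorem eventually_left (a b t₀ : ℝ) (hb : b ≠ 0) : ∀ᶠ t in 𝓝[<] t₀,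
    ((0 < a + t * b ∨ a + t * b = 0 ∧ 0 < b) ↔ (0 < a + t₀ * b ∨ a + t₀ * b = 0 ∧ b < 0)) := by
  have hcont : Tendsto (fun t => a + t * b) (𝓝 t₀) (𝓝 (a + t₀ * b)) :=
    Continuous.tendsto (by fun_prop) t₀
  rcases lt_trichotomy (a + t₀ * b) 0 with h | h | h
  · filter_upwards [nhdsWithin_le_nhds (hcont.eventually (gt_mem_nhds h))] with t ht
    constructor <;> rintro (h' | ⟨h', -⟩) <;> linarith
  · filter_upwards [self_mem_nhdsWithin] with t ht
    have ht : t < t₀ := ht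
    rcases lt_or_gt_of_ne hb with hb | hb
    · have : 0 < a + t * b := by nlinarith
      simp [this, h, hb]
    · have : a + t * b < 0 := by nlinarith
      constructor <;> rintro (h' | ⟨h', h''⟩) <;> linarith
  · filter_upwards [nhdsWithin_le_nhds (hcont.eventually (lt_mem_nhds h))] with t ht
    simp [ht, h]

open Filter Topology in
theorem eventually_atTop_pos (a b : ℝ) (hb : b ≠ 0) : ∀ᶠ t : ℝ in atTop,
    ((0 < a + t * b ∨ a + t * b = 0 ∧ 0 < b) ↔ 0 < b) := by
  rcases lt_or_gt_of_ne hb with hb | hb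
  · have := (tendsto_id.atTop_mul_const_of_neg hb).eventually_lt_atBot (-a)
    filter_upwards [this] with t ht
    simp only [id] at ht
    constructor
    · rintro (h' | ⟨h', h''⟩) <;> linarith
    · intro h; linarith
  · have := (tendsto_id.atTop_mul_const hb).eventually_gt_atTop (-a)
    filter_upwards [this] with t ht
    simp only [id] at ht
    simp [hb, show 0 < a + t * b by linarith]

open Filter Topology in
open scoped Classical in
/-- Moving a regular point along a sufficiently general line does not change the count: it equals
the count of the cones which contain the points far out on the line. -/
theorem count_eq_count_direction {c : Finset S → R} (hc : P.IsBalanced c) {w u : W}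
    (hw : P.IsRegular w) (hu : ∀ F ∈ P.top, ∀ s ∈ F, P.coord F u s ≠ 0)
    (hwu : ∀ F ∈ P.top, ∀ s ∈ F, ∀ t ∈ F, s ≠ t →
      P.coord F w t * P.coord F u s - P.coord F w s * P.coord F u t = 0 →
      P.coord F w s = 0 ∧ P.coord F w t = 0) :
    P.count c w = P.count c u := by
  -- `g t` is the weight of the cones which contain the points of the line slightly beyond
  -- `w + t u`.
  let g : ℝ → R := fun t => ∑ F ∈ P.top, if ∀ s ∈ F, 0 < P.coord F w s + t * P.coord F u s ∨
    P.coord F w s + t * P.coord F u s = 0 ∧ 0 < P.coord F u s then c F else 0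
  have hloc : IsLocallyConstant g := by
    rw [IsLocallyConstant.iff_eventually_eq]
    intro t₀
    have hsplit : 𝓝 t₀ = 𝓝[<] t₀ ⊔ (𝓝[>] t₀ ⊔ pure t₀) := by
      rw [← nhdsNE_sup_pure, ← nhdsLT_sup_nhdsGT, sup_assoc]
    rw [hsplit, eventually_sup, eventually_sup, eventually_pure]
    refine ⟨?_, ?_, rfl⟩
    · have h1 : ∀ᶠ t in 𝓝[<] t₀, ∀ F ∈ P.top, ∀ s ∈ F, _ :=
        (Finset.eventually_all _).2 fun F hF => (Finset.eventually_all _).2 fun s hs =>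
          eventually_left (P.coord F w s) (P.coord F u s) t₀ (hu F hF s hs)
      filter_upwards [h1] with t ht
      have h2 := sum_right_eq_sum_left hc (w + t₀ • u) u (fun F hF s hs r hr hsr h3 h4 => ?_)
      · simp only [map_add, map_smul, Pi.add_apply, Pi.smul_apply, smul_eq_mul] at h2
        refine Eq.trans ?_ h2.symm
        refine Finset.sum_congr rfl fun F hF => ?_
        exact if_congr (forall₂_congr fun s hs => ht F hF s hs) rfl rfl
      · simp only [map_add, map_smul, Pi.add_apply, Pi.smul_apply, smul_eq_mul] at h3 h4 ⊢
        obtain ⟨e1, e2⟩ := hwu F hF s hs r hr hsr (by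
          linear_combination P.coord F u s * h4 - P.coord F u r * h3)
        -- Only at `t₀ = 0` can two coordinates vanish together, and there `w` is regular.
        have ht0 : t₀ = 0 := by
          rw [e1, zero_add] at h3
          exact (mul_eq_zero.1 h3).resolve_right (hu F hF s hs)
        by_contra hcon
        have hnn : ∀ q ∈ F, 0 ≤ P.coord F w q := by
          intro q hq
          by_contra hq'
          exact hcon ⟨q, hq, by rw [ht0]; linarith⟩
        exact (hw F hF hnn s hs).ne' e1
    · have h1 : ∀ᶠ t in 𝓝[>] t₀, ∀ F ∈ P.top, ∀ s ∈ F, _ :=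
        (Finset.eventually_all _).2 fun F hF => (Finset.eventually_all _).2 fun s hs =>
          eventually_right (P.coord F w s) (P.coord F u s) t₀ (hu F hF s hs)
      filter_upwards [h1] with t ht
      refine Finset.sum_congr rfl fun F hF => ?_
      exact if_congr (forall₂_congr fun s hs => ht F hF s hs) rfl rfl
  have h0 : g 0 = P.count c w := by
    refine Finset.sum_congr rfl fun F hF => if_congr ⟨fun h => ?_, fun h s hs => ?_⟩ rfl rfl
    · refine hw F hF fun s hs => ?_
      have := h s hs
      rw [zero_mul, add_zero] at this
      rcases this with h | h
      · exact h.le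
      · exact h.1.ge
    · rw [zero_mul, add_zero]
      exact Or.inl (h s hs)
  have hinf : ∀ᶠ t in atTop, g t = P.count c u := by
    have h1 : ∀ᶠ t : ℝ in atTop, ∀ F ∈ P.top, ∀ s ∈ F, _ :=
        (Finset.eventually_all _).2 fun F hF => (Finset.eventually_all _).2 fun s hs =>
          eventually_atTop_pos (P.coord F w s) (P.coord F u s) (hu F hF s hs)
    filter_upwards [h1] with t ht
    refine Finset.sum_congr rfl fun F hF => ?_
    exact if_congr (forall₂_congr fun s hs => ht F hF s hs) rfl rfl
  obtain ⟨t, ht⟩ := hinf.exists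
  rw [← h0, ← ht]
  exact hloc.apply_eq_of_preconnectedSpace 0 t

/-- The weighted count of the cones over a regular point does not depend on the point if the weights
are balanced. -/
theorem count_eq_count {c : Finset S → R} (hc : P.IsBalanced c) {w w' : W}
    (hw : P.IsRegular w) (hw' : P.IsRegular w') : P.count c w = P.count c w' := by
  classical
  -- The direction `u` has to avoid finitely many hyperplanes: those of the walls, and those in
  -- which the line from `w` or from `w'` in the direction `u` meets a face of codimension two.
  let f₁ : {x : Finset S × S // x.1 ∈ P.top ∧ x.2 ∈ x.1} → Module.Dual ℝ W :=
    fun x => LinearMap.proj x.1.2 ∘ₗ P.coord x.1.1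
  let f₂ (v : W) : {x : Finset S × S × S // x.1 ∈ P.top ∧ x.2.1 ∈ x.1 ∧ x.2.2 ∈ x.1 ∧
      x.2.1 ≠ x.2.2 ∧ ¬ (P.coord x.1 v x.2.1 = 0 ∧ P.coord x.1 v x.2.2 = 0)} → Module.Dual ℝ W :=
    fun x => P.coord x.1.1 v x.1.2.2 • (LinearMap.proj x.1.2.1 ∘ₗ P.coord x.1.1) -
      P.coord x.1.1 v x.1.2.1 • (LinearMap.proj x.1.2.2 ∘ₗ P.coord x.1.1)
  have h₂ : ∀ v x, ∃ u, f₂ v x u ≠ 0 := by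
    rintro v ⟨⟨F, s, t⟩, hF, hs, ht, hst, hne⟩
    by_contra! hcon
    refine hne ⟨?_, ?_⟩
    · have := hcon (P.ray t)
      simpa [f₂, P.coord_ray F hF t ht, hst] using this
    · have := hcon (P.ray s)
      simpa [f₂, P.coord_ray F hF s hs, hst.symm] using this
  obtain ⟨u, hu⟩ := Module.Dual.exists_forall_ne_zero_of_forall_exists
    (Sum.elim f₁ (Sum.elim (f₂ w) (f₂ w'))) (by
      rintro (⟨⟨F, s⟩, hF, hs⟩ | x | x)
      · exact ⟨P.ray s, by simp [f₁, P.coord_ray F hF s hs]⟩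
      · exact h₂ w x
      · exact h₂ w' x)
  have hu1 : ∀ F ∈ P.top, ∀ s ∈ F, P.coord F u s ≠ 0 := fun F hF s hs =>
    hu (.inl ⟨(F, s), hF, hs⟩)
  rw [count_eq_count_direction hc hw hu1, count_eq_count_direction hc hw' hu1]
  · intro F hF s hs t ht hst h
    by_contra hne
    exact hu (.inr (.inr ⟨(F, s, t), hF, hs, ht, hst, hne⟩)) h
  · intro F hF s hs t ht hst h
    by_contra hne
    exact hu (.inr (.inl ⟨(F, s, t), hF, hs, ht, hst, hne⟩)) h

end FanMap

end WallCrossing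

end TropicalCount

namespace TropicalCount

/-! ### Comparison of the orientations given by two evaluation maps -/

section Orientation

variable {S W W' R : Type*} [DecidableEq S] [AddCommGroup W] [Module ℝ W]
  [AddCommGroup W'] [Module ℝ W'] [AddCommGroup R] {m r : ℕ}

/-- `B` is the basis of `W` formed by the images `p s` of the rays `s ∈ F`, enumerated by `l`,
followed by the images `y` of a basis of the lineality space. -/
structure IsFrame (p : S → W) (y : Fin r → W) (F : Finset S)
    (B : Module.Basis (Fin m ⊕ Fin r) ℝ W) (l : Fin m → S) : Prop where
  injective : Function.Injective l
  image : Finset.univ.image l = F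
  eq : ⇑B = Sum.elim (p ∘ l) y

theorem IsFrame.mem_iff {p : S → W} {y : Fin r → W} {F : Finset S}
    {B : Module.Basis (Fin m ⊕ Fin r) ℝ W} {l : Fin m → S} (h : IsFrame p y F B l) {s : S} :
    s ∈ F ↔ ∃ i, l i = s := by
  rw [← h.image]
  simp

/-- The coordinates on `W` along the rays of a cone, given by a basis of `W` as in `IsFrame`. -/
noncomputable def frameCoord (B : Module.Basis (Fin m ⊕ Fin r) ℝ W) (l : Fin m → S) :
    W →ₗ[ℝ] S → ℝ :=
  ∑ i, (B.coord (.inl i)).smulRight (Pi.single (l i) 1)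

theorem frameCoord_apply (B : Module.Basis (Fin m ⊕ Fin r) ℝ W) (l : Fin m → S) (w : W) :
    frameCoord B l w = ∑ i, Pi.single (l i) (B.repr w (.inl i)) := by
  simp only [frameCoord, LinearMap.sum_apply, LinearMap.smulRight_apply, Module.Basis.coord_apply]
  refine Finset.sum_congr rfl fun i _ => ?_
  rw [← Pi.single_smul, smul_eq_mul, mul_one]

theorem frameCoord_self (B : Module.Basis (Fin m ⊕ Fin r) ℝ W) {l : Fin m → S}
    (hl : Function.Injective l) (w : W) (i : Fin m) :
    frameCoord B l w (l i) = B.repr w (.inl i) := by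
  rw [frameCoord_apply, Finset.sum_apply, Finset.sum_eq_single_of_mem i (Finset.mem_univ _),
    Pi.single_eq_same]
  intro j _ hj
  exact Pi.single_eq_of_ne (fun e => hj (hl e).symm) _

/-- The fan with top-dimensional cones `top`, on each of which the rays and the lineality space are
mapped onto a basis of `W`. -/
noncomputable def FanMap.ofFrames [Fintype S] (p : S → W) (y : Fin r → W) (top : Finset (Finset S))
    (B : Finset S → Module.Basis (Fin m ⊕ Fin r) ℝ W) (l : Finset S → Fin m → S)
    (h : ∀ F ∈ top, IsFrame p y F (B F) (l F)) : FanMap S W where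
  top := top
  ray := p
  lin := Submodule.span ℝ (Set.range y)
  coord F := frameCoord (B F) (l F)
  coord_of_notMem F hF s hs w := by
    rw [frameCoord_apply, Finset.sum_apply]
    refine Finset.sum_eq_zero fun i _ => Pi.single_eq_of_ne ?_ _
    rintro rfl
    exact hs ((h F hF).mem_iff.2 ⟨i, rfl⟩)
  coord_ray F hF s hs := by
    obtain ⟨i, rfl⟩ := (h F hF).mem_iff.1 hs
    have e : p (l F i) = B F (.inl i) := by rw [(h F hF).eq]; rfl
    rw [frameCoord_apply, e, Finset.sum_eq_single_of_mem i (Finset.mem_univ _)]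
    · simp
    · intro j _ hj
      rw [Module.Basis.repr_self, Finsupp.single_eq_of_ne (by simpa using hj), Pi.single_zero]
  coord_lin F hF x hx := by
    induction hx using Submodule.span_induction with
    | mem x hx =>
      obtain ⟨j, rfl⟩ := hx
      have e : y j = B F (.inr j) := by rw [(h F hF).eq]; rfl
      rw [frameCoord_apply, e]
      refine Finset.sum_eq_zero fun i _ => ?_
      rw [Module.Basis.repr_self, Finsupp.single_eq_of_ne (by simp), Pi.single_zero]
    | zero => exact map_zero _
    | add x y _ _ hx hy => rw [map_add, hx, hy, add_zero]
    | smul c x _ hx => rw [map_smul, hx, smul_zero]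
  sub_sum_mem F hF w := by
    have e : ∑ s, frameCoord (B F) (l F) w s • p s =
        ∑ i, (B F).repr w (.inl i) • B F (.inl i) := by
      rw [← Finset.sum_subset (Finset.subset_univ (Finset.univ.image (l F))),
        Finset.sum_image fun i _ j _ hij => (h F hF).injective hij]
      · refine Finset.sum_congr rfl fun i _ => ?_
        rw [frameCoord_self _ (h F hF).injective, (h F hF).eq]
        rfl
      · intro s _ hs
        rw [frameCoord_apply, Finset.sum_apply, Finset.sum_eq_zero, zero_smul]
        intro i _
        refine Pi.single_eq_of_ne ?_ _
        rintro rfl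
        exact hs (Finset.mem_image_of_mem _ (Finset.mem_univ i))
    have hw := (B F).sum_repr w
    rw [Fintype.sum_sum_type] at hw
    rw [e, sub_eq_of_eq_add' hw.symm]
    refine Submodule.sum_mem _ fun j _ => Submodule.smul_mem _ _ (Submodule.subset_span ⟨j, ?_⟩)
    rw [(h F hF).eq]
    rfl

theorem exists_perm_of_image_eq {l l' : Fin m → S} (hl : Function.Injective l)
    (hl' : Function.Injective l') (h : Finset.univ.image l = Finset.univ.image l') :
    ∃ σ : Equiv.Perm (Fin m), l' = l ∘ σ := by
  have hr : Set.range l' = Set.range l := by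
    have := congrArg (fun A : Finset S => (A : Set S)) h
    simpa using this.symm
  refine ⟨(Equiv.ofInjective l' hl').trans ((Equiv.setCongr hr).trans
    (Equiv.ofInjective l hl).symm), ?_⟩
  funext i
  simp [Equiv.apply_ofInjective_symm]

theorem sum_elim_comp_perm {J V : Type*} (a : J → V) (b : Fin r → V) (l : Fin m → J)
    (σ : Equiv.Perm (Fin m)) : Sum.elim (a ∘ (l ∘ σ)) b =
      Sum.elim (a ∘ l) b ∘ (Equiv.sumCongr σ (Equiv.refl (Fin r))) := by
  funext i
  rcases i with i | i <;> rfl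

theorem IsFrame.det_ne_zero {p : S → W} {y : Fin r → W} {F : Finset S}
    {B : Module.Basis (Fin m ⊕ Fin r) ℝ W} {l : Fin m → S} (h : IsFrame p y F B l)
    (bW : Module.Basis (Fin m ⊕ Fin r) ℝ W) {l' : Fin m → S} (hl' : Function.Injective l')
    (hF : Finset.univ.image l' = F) : bW.det (Sum.elim (p ∘ l') y) ≠ 0 := by
  obtain ⟨σ, rfl⟩ := exists_perm_of_image_eq h.injective hl' (by rw [h.image, hF])
  rw [sum_elim_comp_perm, ← h.eq, AlternatingMap.map_perm]
  have hu := (bW.isUnit_det B).ne_zero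
  rcases Int.units_eq_one_or (Equiv.Perm.sign (Equiv.sumCongr σ (Equiv.refl (Fin r)))) with h | h
  · rwa [h, one_smul]
  · rw [h]
    simpa using hu

/-- The product of the determinants of the images of a cone under two evaluation maps does not
depend on the orientation of the cone. -/
theorem det_mul_det_eq {U U' : Type*} [AddCommGroup U] [Module ℝ U] [AddCommGroup U'] [Module ℝ U']
    (f : U [⋀^Fin m ⊕ Fin r]→ₗ[ℝ] ℝ) (f' : U' [⋀^Fin m ⊕ Fin r]→ₗ[ℝ] ℝ)
    (p : S → U) (y : Fin r → U) (p' : S → U') (y' : Fin r → U')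
    {l l' : Fin m → S} (hl : Function.Injective l) (hl' : Function.Injective l')
    (h : Finset.univ.image l = Finset.univ.image l') :
    f (Sum.elim (p ∘ l) y) * f' (Sum.elim (p' ∘ l) y') =
      f (Sum.elim (p ∘ l') y) * f' (Sum.elim (p' ∘ l') y') := by
  obtain ⟨σ, rfl⟩ := exists_perm_of_image_eq hl hl' h
  rw [sum_elim_comp_perm, sum_elim_comp_perm, AlternatingMap.map_perm, AlternatingMap.map_perm]
  rcases Int.units_eq_one_or (Equiv.Perm.sign (Equiv.sumCongr σ (Equiv.refl (Fin r)))) with h | h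
  · rw [h, one_smul, one_smul]
  · rw [h]
    simp

open scoped Classical in
/-- The sign of the cone `F`: it compares the two orientations of `F` obtained by pulling back
fixed orientations of `W` and of `W'` under the two evaluation maps. -/
noncomputable def coneSign (bW : Module.Basis (Fin m ⊕ Fin r) ℝ W)
    (bW' : Module.Basis (Fin m ⊕ Fin r) ℝ W') (p : S → W) (y : Fin r → W) (p' : S → W')
    (y' : Fin r → W') (F : Finset S) : ℤˣ :=
  if ∃ l : Fin m → S, Function.Injective l ∧ Finset.univ.image l = F ∧
    bW.det (Sum.elim (p ∘ l) y) * bW'.det (Sum.elim (p' ∘ l) y') < 0 then -1 else 1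

theorem coe_coneSign {bW : Module.Basis (Fin m ⊕ Fin r) ℝ W}
    {bW' : Module.Basis (Fin m ⊕ Fin r) ℝ W'} {p : S → W} {y : Fin r → W} {p' : S → W'}
    {y' : Fin r → W'} {F : Finset S} {l : Fin m → S} (hl : Function.Injective l)
    (hF : Finset.univ.image l = F) (h : bW.det (Sum.elim (p ∘ l) y) ≠ 0)
    (h' : bW'.det (Sum.elim (p' ∘ l) y') ≠ 0) :
    ((coneSign bW bW' p y p' y' F : ℤˣ) : ℤ) = SignType.sign (bW.det (Sum.elim (p ∘ l) y)) *
      SignType.sign (bW'.det (Sum.elim (p' ∘ l) y')) := by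
  rw [← SignType.coe_mul, ← sign_mul]
  rcases lt_or_gt_of_ne (mul_ne_zero h h') with hlt | hgt
  · rw [coneSign, if_pos ⟨l, hl, hF, hlt⟩, sign_neg hlt]
    rfl
  · rw [coneSign, if_neg, sign_pos hgt]
    · rfl
    · rintro ⟨l', hl', hF', hlt⟩
      rw [det_mul_det_eq bW.det bW'.det p y p' y' hl' hl
        (hF'.trans hF.symm)] at hlt
      exact lt_asymm hlt hgt

theorem sum_elim_update {J V : Type*} (p : J → V) (y : Fin r → V) (l : Fin m → J) (j : Fin m)
    (s : J) : Sum.elim (p ∘ Function.update l j s) y =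
      Function.update (Sum.elim (p ∘ l) y) (.inl j) (p s) := by
  funext i
  rcases i with i | i
  · by_cases h : i = j
    · subst h; simp
    · simp [h]
  · simp

theorem update_injective {J : Type*} {l : Fin m → J} (hl : Function.Injective l) {j : Fin m} {s : J}
    (hs : ∀ i, i ≠ j → l i ≠ s) : Function.Injective (Function.update l j s) := by
  intro a b hab
  by_cases ha : a = j <;> by_cases hb : b = j
  · rw [ha, hb]
  · subst ha
    rw [Function.update_self, Function.update_of_ne hb] at hab
    exact absurd hab.symm (hs b hb)
  · subst hb
    rw [Function.update_self, Function.update_of_ne ha] at hab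
    exact absurd hab (hs a ha)
  · rw [Function.update_of_ne ha, Function.update_of_ne hb] at hab
    exact hl hab

theorem image_update {l : Fin m → S} {j : Fin m} {s : S} {G : Finset S}
    (hl : Function.Injective l) (hj : l j ∉ G) (hG : Finset.univ.image l = insert (l j) G) :
    Finset.univ.image (Function.update l j s) = insert s G := by
  ext t
  simp only [Finset.mem_image, Finset.mem_univ, true_and, Finset.mem_insert]
  constructor
  · rintro ⟨i, rfl⟩
    by_cases hi : i = j
    · subst hi; simp
    · right
      rw [Function.update_of_ne hi]
      have : l i ∈ insert (l j) G := hG ▸ Finset.mem_image_of_mem _ (Finset.mem_univ _)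
      exact (Finset.mem_insert.1 this).resolve_left fun e => hi (hl e)
  · rintro (rfl | ht)
    · exact ⟨j, Function.update_self ..⟩
    · have : t ∈ Finset.univ.image l := hG ▸ Finset.mem_insert_of_mem ht
      obtain ⟨i, -, rfl⟩ := Finset.mem_image.1 this
      refine ⟨i, Function.update_of_ne ?_ ..⟩
      rintro rfl
      exact hj ht

/-- If weights are balanced with respect to an evaluation map `p'` to `W'`, then these weights,
multiplied by the signs comparing orientations, are balanced with respect to `p`. -/
theorem sum_coneSign_smul_eq_zero [Fintype S] (bW : Module.Basis (Fin m ⊕ Fin r) ℝ W)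
    (bW' : Module.Basis (Fin m ⊕ Fin r) ℝ W') (p : S → W) (y : Fin r → W) (p' : S → W')
    (y' : Fin r → W') (top : Finset (Finset S))
    (htop : ∀ F ∈ top, ∃ B l, IsFrame (m := m) p y F B l) (c : Finset S → R)
    (hc : ∀ F, c F ≠ 0 → F ∈ top ∧ ∃ B l, IsFrame (m := m) p' y' F B l)
    (hbal : ∀ (G : Finset S) (β : W' →ₗ[ℝ] ℝ), (∀ g ∈ G, β (p' g) = 0) → (∀ j, β (y' j) = 0) →
      ∑ s with s ∉ G, (SignType.sign (β (p' s)) : ℤ) • c (insert s G) = 0)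
    (G : Finset S) (α : W →ₗ[ℝ] ℝ) (hα : ∀ g ∈ G, α (p g) = 0) (hαy : ∀ j, α (y j) = 0) :
    ∑ s with s ∉ G ∧ insert s G ∈ top, (SignType.sign (α (p s)) : ℤ) •
      (coneSign bW bW' p y p' y' (insert s G) : ℤ) • c (insert s G) = 0 := by
  by_cases hne : ∃ s, s ∉ G ∧ insert s G ∈ top
  swap
  · rw [Finset.filter_false_of_mem fun s _ h => hne ⟨s, h⟩, Finset.sum_empty]
  obtain ⟨s₀, hs₀, hF₀⟩ := hne
  obtain ⟨B₀, l₀, hB₀⟩ := htop _ hF₀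
  obtain ⟨j, hj⟩ := hB₀.mem_iff.1 (Finset.mem_insert_self s₀ G)
  subst hj
  -- Both `α` and the determinant `δ`, as functions of the image of the ray outside `G`, vanish on
  -- the wall `G`, so that they are proportional. On the other side, the multiple `κ • δ'` of the
  -- corresponding determinant is a form to which `hbal` applies.
  let δ : W →ₗ[ℝ] ℝ := bW.det.toMultilinearMap.toLinearMap (Sum.elim (p ∘ l₀) y) (.inl j)
  let δ' : W' →ₗ[ℝ] ℝ := bW'.det.toMultilinearMap.toLinearMap (Sum.elim (p' ∘ l₀) y') (.inl j)
  have hδ : ∀ s, δ (p s) = bW.det (Sum.elim (p ∘ Function.update l₀ j s) y) := fun s => by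
    rw [sum_elim_update]; rfl
  have hδ' : ∀ s, δ' (p' s) = bW'.det (Sum.elim (p' ∘ Function.update l₀ j s) y') := fun s => by
    rw [sum_elim_update]; rfl
  have hG : ∀ g ∈ G, ∃ i, i ≠ j ∧ l₀ i = g := fun g hg => by
    obtain ⟨i, rfl⟩ := hB₀.mem_iff.1 (Finset.mem_insert_of_mem hg)
    exact ⟨i, fun e => hs₀ (e ▸ hg), rfl⟩
  have hjG : ∀ i, i ≠ j → l₀ i ∈ G := fun i hi =>
    (Finset.mem_insert.1 (hB₀.mem_iff.2 ⟨i, rfl⟩)).resolve_left fun e => hi (hB₀.injective e)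
  have hvan : ∀ i, i ≠ Sum.inl j → δ (Sum.elim (p ∘ l₀) y i) = 0 := fun i hi =>
    bW.det.map_update_self _ hi.symm
  have hvan' : ∀ i, i ≠ Sum.inl j → δ' (Sum.elim (p' ∘ l₀) y' i) = 0 := fun i hi =>
    bW'.det.map_update_self _ hi.symm
  have hprop : ∀ w, α w * δ (p (l₀ j)) = α (p (l₀ j)) * δ w := by
    have : (δ (p (l₀ j))) • α = (α (p (l₀ j))) • δ := by
      refine B₀.ext fun i => ?_
      simp only [LinearMap.smul_apply, smul_eq_mul, hB₀.eq]
      by_cases hi : i = .inl j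
      · subst hi
        simp [mul_comm]
      · rw [hvan i hi, mul_zero]
        rcases i with i | i
        · rw [Sum.elim_inl, Function.comp_apply,
            hα _ (hjG i fun e => hi (congrArg _ e)), mul_zero]
        · rw [Sum.elim_inr, hαy, mul_zero]
    intro w
    have := LinearMap.congr_fun this w
    simp only [LinearMap.smul_apply, smul_eq_mul] at this
    linarith
  have hinj : ∀ s, s ∉ G → Function.Injective (Function.update l₀ j s) := fun s hs =>
    update_injective hB₀.injective fun i hi => by rintro rfl; exact hs (hjG i hi)
  have himg : ∀ s, Finset.univ.image (Function.update l₀ j s) = insert s G := fun s =>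
    image_update hB₀.injective hs₀ hB₀.image
  have hδ₀ : δ (p (l₀ j)) ≠ 0 := by
    rw [hδ]
    exact hB₀.det_ne_zero bW (hinj _ hs₀) (himg _)
  obtain ⟨κ, hκ⟩ : ∃ κ : ℝ, κ = α (p (l₀ j)) * δ (p (l₀ j)) := ⟨_, rfl⟩
  have hsgn : ∀ s, (SignType.sign (α (p s)) : ℤ) =
      SignType.sign κ * SignType.sign (δ (p s)) := by
    intro s
    rw [← SignType.coe_mul, ← sign_mul]
    have h2 : 0 < δ (p (l₀ j)) * δ (p (l₀ j)) := mul_self_pos.2 hδ₀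
    have h3 : α (p s) * (δ (p (l₀ j)) * δ (p (l₀ j))) = κ * δ (p s) := by
      rw [hκ]
      linear_combination δ (p (l₀ j)) * hprop (p s)
    rw [← h3, sign_mul, sign_pos h2, mul_one]
  have hterm : ∀ s, s ∉ G → insert s G ∈ top → (SignType.sign (α (p s)) : ℤ) •
      (coneSign bW bW' p y p' y' (insert s G) : ℤ) • c (insert s G) =
      (SignType.sign (((κ • δ') : W' →ₗ[ℝ] ℝ) (p' s)) : ℤ) • c (insert s G) := by
    intro s hs hF
    by_cases hcF : c (insert s G) = 0
    · rw [hcF, smul_zero, smul_zero, smul_zero]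
    obtain ⟨B, l, hB⟩ := htop _ hF
    obtain ⟨B', l', hB'⟩ := (hc _ hcF).2
    have hd := hB.det_ne_zero bW (hinj s hs) (himg s)
    have hd' := hB'.det_ne_zero bW' (hinj s hs) (himg s)
    rw [coe_coneSign (hinj s hs) (himg s) hd hd', ← hδ, ← hδ', hsgn, smul_smul,
      LinearMap.smul_apply, smul_eq_mul, sign_mul, SignType.coe_mul]
    congr 1
    rw [← hδ] at hd
    have hsq : (SignType.sign (δ (p s)) : ℤ) * (SignType.sign (δ (p s)) : ℤ) = 1 := by
      rcases lt_or_gt_of_ne hd with h | h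
      · simp [sign_neg h]
      · simp [sign_pos h]
    linear_combination (SignType.sign κ * SignType.sign (δ' (p' s)) : ℤ) * hsq
  rw [Finset.sum_congr rfl fun s hs =>
    hterm s (Finset.mem_filter.1 hs).2.1 (Finset.mem_filter.1 hs).2.2]
  rw [← hbal G (κ • δ')]
  · refine Finset.sum_subset (fun s hs => ?_) (fun s hs hs' => ?_)
    · simp only [Finset.mem_filter, Finset.mem_univ, true_and] at hs ⊢
      exact hs.1
    · simp only [Finset.mem_filter, Finset.mem_univ, true_and] at hs hs'
      by_cases hcF : c (insert s G) = 0
      · rw [hcF, smul_zero]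
      · exact absurd ⟨hs, (hc _ hcF).1⟩ hs'
  · intro g hg
    obtain ⟨i, hi, rfl⟩ := hG g hg
    have := hvan' (.inl i) (fun e => hi (Sum.inl_injective e))
    rw [LinearMap.smul_apply]
    exact (congrArg (κ • ·) this).trans (smul_zero _)
  · intro i
    have := hvan' (.inr i) (by simp)
    rw [LinearMap.smul_apply]
    exact (congrArg (κ • ·) this).trans (smul_zero _)

end Orientation

end TropicalCount

namespace TropicalCount

/-! ### Nested families of sets of ends -/

section Nested

open Finset

variable {E : Type*} [Fintype E] [DecidableEq E] (o : E)

/-- The ends other than the root end `o`. -/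
def ground : Finset E := univ.erase o

/-- A nested family: the combinatorial type of a tree with root end `o`, encoded by the sets of ends
which lie beyond its bounded edges as seen from `o`. -/
structure IsNested (F : Finset (Finset E)) : Prop where
  ssubset : ∀ A ∈ F, A ⊂ ground o
  two_le : ∀ A ∈ F, 2 ≤ #A
  laminar : ∀ A ∈ F, ∀ B ∈ F, A ⊆ B ∨ B ⊆ A ∨ Disjoint A B

/-- The sets of ends beyond the vertices. The set of all ends other than the root belongs to the
vertex adjacent to the root end. -/
def nodes (F : Finset (Finset E)) : Finset (Finset E) := insert (ground o) F

/-- The sets of ends beyond the edges, bounded or not, except for the root end. -/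
def cells (F : Finset (Finset E)) : Finset (Finset E) := F ∪ (ground o).image singleton

/-- The smallest node which strictly contains `B`. -/
def parent (F : Finset (Finset E)) (B : Finset E) : Finset E := ((nodes o F).filter (B ⊂ ·)).inf id

/-- The cells of the edges which start at the vertex with node `A` and point away from the root. -/
def children (F : Finset (Finset E)) (A : Finset E) : Finset (Finset E) :=
  (cells o F).filter (parent o F · = A)

variable {o} {F : Finset (Finset E)} {A B C : Finset E}

theorem mem_ground {e : E} : e ∈ ground o ↔ e ≠ o := by simp [ground]

theorem mem_nodes : A ∈ nodes o F ↔ A = ground o ∨ A ∈ F := by simp [nodes]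

theorem mem_cells : A ∈ cells o F ↔ A ∈ F ∨ ∃ e ≠ o, {e} = A := by
  simp [cells, mem_ground]

theorem mem_children : B ∈ children o F A ↔ B ∈ cells o F ∧ parent o F B = A := by
  simp [children]

theorem parent_eq_of (hA : A ∈ nodes o F) (hBA : B ⊂ A)
    (hmin : ∀ A' ∈ nodes o F, B ⊂ A' → A ⊆ A') : parent o F B = A := by
  apply le_antisymm
  · exact inf_le (f := id) (mem_filter.2 ⟨hA, hBA⟩)
  · refine Finset.le_inf fun A' hA' => ?_
    exact hmin A' (mem_filter.1 hA').1 (mem_filter.1 hA').2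

namespace IsNested

theorem mono {G : Finset (Finset E)} (h : IsNested o F) (hG : G ⊆ F) : IsNested o G :=
  ⟨fun A hA => h.ssubset A (hG hA), fun A hA => h.two_le A (hG hA),
    fun A hA B hB => h.laminar A (hG hA) B (hG hB)⟩

theorem node_subset (h : IsNested o F) (hA : A ∈ nodes o F) : A ⊆ ground o := by
  rcases mem_nodes.1 hA with rfl | hA
  · exact Subset.rfl
  · exact (h.ssubset A hA).subset

theorem two_le_node (h : IsNested o F) (hE : 2 ≤ #(ground o)) (hA : A ∈ nodes o F) : 2 ≤ #A := by
  rcases mem_nodes.1 hA with rfl | hA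
  · exact hE
  · exact h.two_le A hA

theorem cell_ssubset (h : IsNested o F) (hE : 2 ≤ #(ground o)) (hB : B ∈ cells o F) :
    B ⊂ ground o := by
  rcases mem_cells.1 hB with hB | ⟨e, he, rfl⟩
  · exact h.ssubset B hB
  · refine ⟨singleton_subset_iff.2 (mem_ground.2 he), fun hs => ?_⟩
    have := card_le_card hs
    rw [card_singleton] at this
    omega

theorem cell_nonempty (h : IsNested o F) (hB : B ∈ cells o F) : B.Nonempty := by
  rcases mem_cells.1 hB with hB | ⟨e, he, rfl⟩
  · exact card_pos.1 (by have := h.two_le B hB; omega)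
  · exact singleton_nonempty e

theorem mem_of_cell_of_two_le (hB : B ∈ cells o F) (h2 : 2 ≤ #B) : B ∈ F := by
  rcases mem_cells.1 hB with hB | ⟨e, he, rfl⟩
  · exact hB
  · rw [card_singleton] at h2; omega

theorem laminar_node (h : IsNested o F) (hA : A ∈ nodes o F) (hB : B ∈ nodes o F) :
    A ⊆ B ∨ B ⊆ A ∨ Disjoint A B := by
  rcases mem_nodes.1 hA with rfl | hA'
  · exact Or.inr (Or.inl (h.node_subset hB))
  rcases mem_nodes.1 hB with rfl | hB'
  · exact Or.inl (h.node_subset hA)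
  exact h.laminar A hA' B hB'

omit [Fintype E] in
theorem singleton_laminar (e : E) (B : Finset E) :
    {e} ⊆ B ∨ B ⊆ {e} ∨ Disjoint {e} B := by
  by_cases he : e ∈ B
  · exact Or.inl (singleton_subset_iff.2 he)
  · exact Or.inr (Or.inr (disjoint_singleton_left.2 he))

theorem laminar_cell (h : IsNested o F) (hA : A ∈ cells o F) (hB : B ∈ cells o F) :
    A ⊆ B ∨ B ⊆ A ∨ Disjoint A B := by
  rcases mem_cells.1 hA with hA | ⟨e, he, rfl⟩
  · rcases mem_cells.1 hB with hB | ⟨e, he, rfl⟩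
    · exact h.laminar A hA B hB
    · rcases singleton_laminar e A with h | h | h
      · exact Or.inr (Or.inl h)
      · exact Or.inl h
      · exact Or.inr (Or.inr h.symm)
  · exact singleton_laminar e B

/-- The nodes which contain a given nonempty set form a chain, so that there is a smallest one. -/
theorem parent_spec (h : IsNested o F) (hB : B.Nonempty) (hBo : B ⊂ ground o) :
    parent o F B ∈ nodes o F ∧ B ⊂ parent o F B ∧
      ∀ A ∈ nodes o F, B ⊂ A → parent o F B ⊆ A := by
  have hne : ((nodes o F).filter (B ⊂ ·)).Nonempty :=
    ⟨ground o, mem_filter.2 ⟨mem_nodes.2 (Or.inl rfl), hBo⟩⟩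
  obtain ⟨A₀, hA₀, hmin⟩ := exists_min_image _ card hne
  rw [mem_filter] at hA₀
  have key : ∀ A ∈ nodes o F, B ⊂ A → A₀ ⊆ A := by
    intro A hA hBA
    rcases h.laminar_node hA₀.1 hA with h' | h' | h'
    · exact h'
    · exact (eq_of_subset_of_card_le h' (hmin A (mem_filter.2 ⟨hA, hBA⟩))).symm.subset
    · obtain ⟨b, hb⟩ := hB
      exact absurd (hBA.subset hb) (disjoint_left.1 h' (hA₀.2.subset hb))
  rw [parent_eq_of hA₀.1 hA₀.2 key]
  exact ⟨hA₀.1, hA₀.2, key⟩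

variable (h : IsNested o F) (hE : 2 ≤ #(ground o))
include h hE

theorem parent_cell (hB : B ∈ cells o F) :
    parent o F B ∈ nodes o F ∧ B ⊂ parent o F B ∧ ∀ A ∈ nodes o F, B ⊂ A → parent o F B ⊆ A :=
  h.parent_spec (h.cell_nonempty hB) (h.cell_ssubset hE hB)

theorem ssubset_of_mem_children (hB : B ∈ children o F A) : B ⊂ A := by
  obtain ⟨hB', rfl⟩ := mem_children.1 hB
  exact (h.parent_cell hE hB').2.1

theorem exists_mem_children (hA : A ∈ nodes o F) {e : E} (he : e ∈ A) :
    ∃ B ∈ children o F A, e ∈ B := by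
  have hs : ((cells o F).filter fun B => e ∈ B ∧ B ⊂ A).Nonempty := by
    refine ⟨{e}, mem_filter.2 ⟨mem_cells.2 (Or.inr ⟨e, mem_ground.1 (h.node_subset hA he), rfl⟩),
      mem_singleton_self e, singleton_subset_iff.2 he, fun hs => ?_⟩⟩
    have := card_le_card hs
    have := h.two_le_node hE hA
    rw [card_singleton] at *
    omega
  obtain ⟨B, hB, hmax⟩ := exists_max_image _ card hs
  obtain ⟨hB, heB, hBA⟩ := mem_filter.1 hB
  obtain ⟨h1, h2, h3⟩ := h.parent_cell hE hB
  refine ⟨B, mem_children.2 ⟨hB, ?_⟩, heB⟩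
  by_contra hne
  have hlt : parent o F B ⊂ A := lt_of_le_of_ne (h3 A hA hBA) hne
  rcases mem_nodes.1 h1 with h1 | h1
  · rw [h1] at hlt
    exact hlt.not_subset (h.node_subset hA)
  · have := hmax _ (mem_filter.2 ⟨mem_cells.2 (Or.inl h1), h2.subset heB, hlt⟩)
    exact absurd (card_lt_card h2) (not_lt.2 this)

theorem disjoint_children (hB : B ∈ children o F A) (hC : C ∈ children o F A) (hne : B ≠ C) :
    Disjoint B C := by
  have key : ∀ {B C : Finset E}, B ∈ children o F A → C ∈ children o F A → B ≠ C → ¬ B ⊆ C := by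
    intro B C hB hC hne hBC
    have hlt : B ⊂ C := lt_of_le_of_ne hBC hne
    obtain ⟨hB', hBA⟩ := mem_children.1 hB
    obtain ⟨hC', hCA⟩ := mem_children.1 hC
    have hC2 : 2 ≤ #C := by
      have := card_lt_card hlt
      have := (h.cell_nonempty hB').card_pos
      omega
    have := (h.parent_cell hE hB').2.2 C (mem_nodes.2 (Or.inr (mem_of_cell_of_two_le hC' hC2))) hlt
    rw [hBA] at this
    exact (h.ssubset_of_mem_children hE hC).not_subset this
  rcases h.laminar_cell (mem_children.1 hB).1 (mem_children.1 hC).1 with h' | h' | h'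
  · exact absurd h' (key hB hC hne)
  · exact absurd h' (key hC hB hne.symm)
  · exact h'

theorem biUnion_children (hA : A ∈ nodes o F) : (children o F A).biUnion id = A := by
  ext e
  rw [mem_biUnion]
  constructor
  · rintro ⟨B, hB, he⟩
    exact (h.ssubset_of_mem_children hE hB).subset he
  · exact h.exists_mem_children hE hA

theorem two_le_card_children (hA : A ∈ nodes o F) : 2 ≤ #(children o F A) := by
  obtain ⟨e, he⟩ := card_pos.1 (lt_of_lt_of_le two_pos (h.two_le_node hE hA))
  obtain ⟨B, hB, -⟩ := h.exists_mem_children hE hA he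
  obtain ⟨e', he', hne⟩ := exists_of_ssubset (h.ssubset_of_mem_children hE hB)
  obtain ⟨B', hB', he''⟩ := h.exists_mem_children hE hA he'
  exact one_lt_card.2 ⟨B, hB, B', hB', fun e => hne (e ▸ he'')⟩

omit hE in
theorem card_nodes : #(nodes o F) = #F + 1 :=
  card_insert_of_notMem fun hg => (h.ssubset _ hg).not_subset Subset.rfl

/-- Every edge other than the root end starts at precisely one vertex. -/
theorem sum_card_children : ∑ A ∈ nodes o F, #(children o F A) = #F + #(ground o) := by
  have h1 : #(cells o F) = #F + #(ground o) := by
    rw [cells, card_union_of_disjoint, card_image_of_injective _ singleton_injective]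
    rw [disjoint_left]
    intro A hA hA'
    obtain ⟨e, -, rfl⟩ := mem_image.1 hA'
    have := h.two_le _ hA
    rw [card_singleton] at this
    omega
  rw [← h1]
  exact (card_eq_sum_card_fiberwise fun B hB => (h.parent_cell hE hB).1).symm

theorem sum_card_children_sub_two :
    ∑ A ∈ nodes o F, (#(children o F A) - 2) + (#F + 2) = #(ground o) := by
  have h1 := h.sum_card_children hE
  have h2 : ∑ A ∈ nodes o F, #(children o F A) =
      ∑ A ∈ nodes o F, (#(children o F A) - 2) + ∑ A ∈ nodes o F, 2 := by
    rw [← sum_add_distrib]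
    refine sum_congr rfl fun A hA => ?_
    have := h.two_le_card_children hE hA
    omega
  rw [sum_const, h.card_nodes, smul_eq_mul] at h2
  omega

theorem card_add_two_le : #F + 2 ≤ #(ground o) := by
  have := h.sum_card_children_sub_two hE
  omega

theorem card_children_eq_two_iff :
    (∀ A ∈ nodes o F, #(children o F A) = 2) ↔ #F + 2 = #(ground o) := by
  have h1 := h.sum_card_children_sub_two hE
  constructor
  · intro h2
    rw [sum_eq_zero fun A hA => Nat.sub_eq_zero_of_le (h2 A hA).le] at h1
    omega
  · intro h2 A hA
    have h3 : ∑ A ∈ nodes o F, (#(children o F A) - 2) = 0 := by omega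
    have h4 := sum_eq_zero_iff.1 h3 A hA
    have := h.two_le_card_children hE hA
    omega

/-- A family of codimension one has exactly one vertex of valency four. -/
theorem exists_card_children_eq_three (hcard : #F + 3 = #(ground o)) :
    ∃ A ∈ nodes o F, #(children o F A) = 3 ∧
      ∀ A' ∈ nodes o F, A' ≠ A → #(children o F A') = 2 := by
  have h1 := h.sum_card_children_sub_two hE
  have h3 : ∑ A ∈ nodes o F, (#(children o F A) - 2) = 1 := by omega
  obtain ⟨A, hA, hne⟩ := exists_ne_zero_of_sum_ne_zero (by rw [h3]; exact one_ne_zero)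
  have h4 := add_sum_erase _ (fun A => #(children o F A) - 2) hA
  refine ⟨A, hA, by omega, fun A' hA' hAA => ?_⟩
  have h5 : ∑ A ∈ (nodes o F).erase A, (#(children o F A) - 2) = 0 := by omega
  have h6 := sum_eq_zero_iff.1 h5 A' (mem_erase.2 ⟨hAA, hA'⟩)
  have := h.two_le_card_children hE hA'
  omega

omit h hE in
theorem cells_insert (s : Finset E) : cells o (insert s F) = insert s (cells o F) := by
  simp [cells]

omit h hE in
theorem nodes_insert (s : Finset E) : nodes o (insert s F) = insert s (nodes o F) := by
  exact Finset.insert_comm _ _ _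

theorem ssubset_pair {X Y Z : Finset E} (hch : children o F A = {X, Y, Z}) (hXZ : X ≠ Z)
    (hYZ : Y ≠ Z) : X ∪ Y ⊂ A := by
  have hX : X ∈ children o F A := by simp [hch]
  have hY : Y ∈ children o F A := by simp [hch]
  have hZ : Z ∈ children o F A := by simp [hch]
  refine ⟨union_subset (h.ssubset_of_mem_children hE hX).subset
    (h.ssubset_of_mem_children hE hY).subset, fun hs => ?_⟩
  obtain ⟨z, hz⟩ := h.cell_nonempty (mem_children.1 hZ).1
  rcases mem_union.1 (hs ((h.ssubset_of_mem_children hE hZ).subset hz)) with hz' | hz'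
  · exact disjoint_left.1 (h.disjoint_children hE hX hZ hXZ) hz' hz
  · exact disjoint_left.1 (h.disjoint_children hE hY hZ hYZ) hz' hz

theorem ssubset_union {X Y : Finset E} (hX : X ∈ children o F A) (hY : Y ∈ children o F A)
    (hXY : X ≠ Y) : X ⊂ X ∪ Y := by
  refine ⟨subset_union_left, fun hs => ?_⟩
  obtain ⟨y, hy⟩ := h.cell_nonempty (mem_children.1 hY).1
  exact disjoint_left.1 (h.disjoint_children hE hX hY hXY) (hs (mem_union_right _ hy)) hy

theorem union_notMem {X Y Z : Finset E} (hch : children o F A = {X, Y, Z})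
    (hXY : X ≠ Y) (hXZ : X ≠ Z) (hYZ : Y ≠ Z) : X ∪ Y ∉ nodes o F := by
  intro hs
  have hX : X ∈ children o F A := by simp [hch]
  have hY : Y ∈ children o F A := by simp [hch]
  have := (h.parent_cell hE (mem_children.1 hX).1).2.2 _ hs (h.ssubset_union hE hX hY hXY)
  rw [(mem_children.1 hX).2] at this
  exact (h.ssubset_pair hE hch hXZ hYZ).not_subset this

/-- A vertex with three edges pointing away from the root can be resolved by joining two of them. -/
theorem insert_union (hA : A ∈ nodes o F) {X Y Z : Finset E} (hch : children o F A = {X, Y, Z})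
    (hXY : X ≠ Y) (hXZ : X ≠ Z) (hYZ : Y ≠ Z) : IsNested o (insert (X ∪ Y) F) := by
  have hX : X ∈ children o F A := by simp [hch]
  have hY : Y ∈ children o F A := by simp [hch]
  have hsA := h.ssubset_pair hE hch hXZ hYZ
  have hcomp : ∀ B ∈ F, X ∪ Y ⊆ B ∨ B ⊆ X ∪ Y ∨ Disjoint (X ∪ Y) B := by
    intro B hB
    have hBn : B ∈ nodes o F := mem_nodes.2 (Or.inr hB)
    have hBc : B ∈ cells o F := mem_cells.2 (Or.inl hB)
    rcases h.laminar_node hA hBn with h' | h' | h'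
    · exact Or.inl (hsA.subset.trans h')
    · rcases h'.eq_or_ssubset with rfl | h'
      · exact Or.inl hsA.subset
      have key : ∀ X ∈ children o F A, B ⊆ X ∨ Disjoint X B := by
        intro X hX
        rcases h.laminar_cell (mem_children.1 hX).1 hBc with h2 | h2 | h2
        · rcases h2.eq_or_ssubset with rfl | h2
          · exact Or.inl Subset.rfl
          have := (h.parent_cell hE (mem_children.1 hX).1).2.2 _ hBn h2
          rw [(mem_children.1 hX).2] at this
          exact absurd this h'.not_subset
        · exact Or.inl h2
        · exact Or.inr h2
      rcases key X hX with h2 | h2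
      · exact Or.inr (Or.inl (h2.trans subset_union_left))
      rcases key Y hY with h3 | h3
      · exact Or.inr (Or.inl (h3.trans subset_union_right))
      · exact Or.inr (Or.inr (disjoint_union_left.2 ⟨h2, h3⟩))
    · exact Or.inr (Or.inr (h'.mono_left hsA.subset))
  refine ⟨?_, ?_, ?_⟩
  · intro B hB
    rcases mem_insert.1 hB with rfl | hB
    · exact lt_of_lt_of_le hsA (h.node_subset hA)
    · exact h.ssubset B hB
  · intro B hB
    rcases mem_insert.1 hB with rfl | hB
    · have h1 := card_lt_card (h.ssubset_union hE hX hY hXY)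
      have := (h.cell_nonempty (mem_children.1 hX).1).card_pos
      omega
    · exact h.two_le B hB
  · intro B hB C hC
    rcases mem_insert.1 hB with rfl | hB
    · rcases mem_insert.1 hC with rfl | hC
      · exact Or.inl Subset.rfl
      · exact hcomp C hC
    · rcases mem_insert.1 hC with rfl | hC
      · rcases hcomp B hB with h' | h' | h'
        · exact Or.inr (Or.inl h')
        · exact Or.inl h'
        · exact Or.inr (Or.inr h'.symm)
      · exact h.laminar B hB C hC

theorem parent_insert_self (hA : A ∈ nodes o F) {X Y Z : Finset E}
    (hch : children o F A = {X, Y, Z}) (hXY : X ≠ Y) (hXZ : X ≠ Z) (hYZ : Y ≠ Z) :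
    parent o (insert (X ∪ Y) F) (X ∪ Y) = A := by
  have hX : X ∈ children o F A := by simp [hch]
  have hY : Y ∈ children o F A := by simp [hch]
  refine parent_eq_of (by rw [nodes_insert]; exact mem_insert_of_mem hA)
    (h.ssubset_pair hE hch hXZ hYZ) fun A' hA' hs => ?_
  rw [nodes_insert] at hA'
  have hA'' := (mem_insert.1 hA').resolve_left hs.ne'
  have := (h.parent_cell hE (mem_children.1 hX).1).2.2 A' hA''
    ((h.ssubset_union hE hX hY hXY).trans hs)
  rwa [(mem_children.1 hX).2] at this

theorem parent_insert_left {X Y Z : Finset E}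
    (hch : children o F A = {X, Y, Z}) (hXY : X ≠ Y) (hXZ : X ≠ Z) (hYZ : Y ≠ Z) :
    parent o (insert (X ∪ Y) F) X = X ∪ Y := by
  have hX : X ∈ children o F A := by simp [hch]
  have hY : Y ∈ children o F A := by simp [hch]
  refine parent_eq_of (by rw [nodes_insert]; exact mem_insert_self _ _)
    (h.ssubset_union hE hX hY hXY) fun A' hA' hs => ?_
  rw [nodes_insert] at hA'
  rcases mem_insert.1 hA' with rfl | hA'
  · exact Subset.rfl
  · have := (h.parent_cell hE (mem_children.1 hX).1).2.2 A' hA' hs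
    rw [(mem_children.1 hX).2] at this
    exact (h.ssubset_pair hE hch hXZ hYZ).subset.trans this

theorem parent_insert_of_ne {X Y Z : Finset E}
    (hch : children o F A = {X, Y, Z}) (hB : B ∈ cells o F) (hBX : B ≠ X) (hBY : B ≠ Y) :
    parent o (insert (X ∪ Y) F) B = parent o F B := by
  have hX : X ∈ children o F A := by simp [hch]
  have hY : Y ∈ children o F A := by simp [hch]
  obtain ⟨h1, h2, h3⟩ := h.parent_cell hE hB
  refine parent_eq_of (by rw [nodes_insert]; exact mem_insert_of_mem h1) h2 fun A' hA' hs => ?_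
  rw [nodes_insert] at hA'
  rcases mem_insert.1 hA' with rfl | hA'
  swap
  · exact h3 A' hA' hs
  have key : ∀ X ∈ children o F A, B ≠ X → parent o F B ⊆ X ∨ X ⊆ B ∨ Disjoint B X := by
    intro X hX hBX
    rcases h.laminar_cell hB (mem_children.1 hX).1 with h' | h' | h'
    · have hlt : B ⊂ X := lt_of_le_of_ne h' hBX
      have := card_lt_card hlt
      have := (h.cell_nonempty hB).card_pos
      exact Or.inl (h3 X (mem_nodes.2 (Or.inr (mem_of_cell_of_two_le (mem_children.1 hX).1
        (by omega)))) hlt)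
    · exact Or.inr (Or.inl h')
    · exact Or.inr (Or.inr h')
  rcases key X hX hBX with hx | hx | hx
  · exact hx.trans subset_union_left
  · rcases key Y hY hBY with hy | hy | hy
    · exact hy.trans subset_union_right
    · exact absurd (union_subset hx hy) hs.not_subset
    · refine absurd (Subset.antisymm (fun b hb => ?_) hx) hBX
      exact (mem_union.1 (hs.subset hb)).resolve_right (disjoint_left.1 hy hb)
  · rcases key Y hY hBY with hy | hy | hy
    · exact hy.trans subset_union_right
    · refine absurd (Subset.antisymm (fun b hb => ?_) hy) hBY
      exact (mem_union.1 (hs.subset hb)).resolve_left (disjoint_left.1 hx hb)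
    · obtain ⟨b, hb⟩ := h.cell_nonempty hB
      rcases mem_union.1 (hs.subset hb) with h' | h'
      · exact absurd h' (disjoint_left.1 hx hb)
      · exact absurd h' (disjoint_left.1 hy hb)

/-- The vertices of the resolution of a vertex with three edges pointing away from the root. -/
theorem children_insert (hA : A ∈ nodes o F) {X Y Z : Finset E}
    (hch : children o F A = {X, Y, Z}) (hXY : X ≠ Y) (hXZ : X ≠ Z) (hYZ : Y ≠ Z) :
    children o (insert (X ∪ Y) F) (X ∪ Y) = {X, Y} ∧
    children o (insert (X ∪ Y) F) A = {X ∪ Y, Z} ∧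
    ∀ A' ∈ nodes o F, A' ≠ A → children o (insert (X ∪ Y) F) A' = children o F A' := by
  have hX : X ∈ children o F A := by simp [hch]
  have hY : Y ∈ children o F A := by simp [hch]
  have hZ : Z ∈ children o F A := by simp [hch]
  have hchY : children o F A = {Y, X, Z} := by rw [hch, Finset.insert_comm]
  have hs := h.union_notMem hE hch hXY hXZ hYZ
  have hsA : X ∪ Y ≠ A := (h.ssubset_pair hE hch hXZ hYZ).ne
  have p0 := h.parent_insert_self hE hA hch hXY hXZ hYZ
  have pX := h.parent_insert_left hE hch hXY hXZ hYZ
  have pY := h.parent_insert_left hE hchY hXY.symm hYZ hXZ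
  rw [union_comm Y X] at pY
  have pB : ∀ B ∈ cells o F, B ≠ X → B ≠ Y → _ := fun B hB hBX hBY =>
    h.parent_insert_of_ne hE hch hB hBX hBY
  have hXA := mem_children.1 hX
  have hYA := mem_children.1 hY
  have hZA := mem_children.1 hZ
  refine ⟨?_, ?_, fun A' hA' hne => ?_⟩
  · ext B
    rw [mem_children, cells_insert, mem_insert, mem_insert, mem_singleton]
    constructor
    · rintro ⟨rfl | hB, hp⟩
      · exact absurd (hp.symm.trans p0) hsA
      · by_contra! hcon
        rw [pB B hB hcon.1 hcon.2] at hp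
        exact hs (hp ▸ (h.parent_cell hE hB).1)
    · rintro (rfl | rfl)
      · exact ⟨Or.inr hXA.1, pX⟩
      · exact ⟨Or.inr hYA.1, pY⟩
  · ext B
    rw [mem_children, cells_insert, mem_insert, mem_insert, mem_singleton]
    constructor
    · rintro ⟨rfl | hB, hp⟩
      · exact Or.inl rfl
      · right
        have hBX : B ≠ X := by rintro rfl; exact hsA (pX.symm.trans hp)
        have hBY : B ≠ Y := by rintro rfl; exact hsA (pY.symm.trans hp)
        rw [pB B hB hBX hBY] at hp
        have : B ∈ children o F A := mem_children.2 ⟨hB, hp⟩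
        rw [hch] at this
        simpa [hBX, hBY] using this
    · rintro (rfl | rfl)
      · exact ⟨Or.inl rfl, p0⟩
      · exact ⟨Or.inr hZA.1, (pB B hZA.1 hXZ.symm hYZ.symm).trans hZA.2⟩
  · ext B
    rw [mem_children, cells_insert, mem_insert, mem_children]
    have hsA' : X ∪ Y ≠ A' := by rintro rfl; exact hs hA'
    constructor
    · rintro ⟨rfl | hB, hp⟩
      · exact absurd (hp.symm.trans p0) hne
      · have hBX : B ≠ X := by rintro rfl; exact hsA' (pX.symm.trans hp)
        have hBY : B ≠ Y := by rintro rfl; exact hsA' (pY.symm.trans hp)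
        rw [pB B hB hBX hBY] at hp
        exact ⟨hB, hp⟩
    · rintro ⟨hB, hp⟩
      have hBX : B ≠ X := by rintro rfl; exact hne (hp.symm.trans hXA.2)
      have hBY : B ≠ Y := by rintro rfl; exact hne (hp.symm.trans hYA.2)
      exact ⟨Or.inr hB, (pB B hB hBX hBY).trans hp⟩

omit h in
/-- A set which can be added to a nested family is a union of edges starting at a common vertex. -/
theorem of_insert {s : Finset E} (hs : s ∉ F) (hI : IsNested o (insert s F)) (hF : IsNested o F) :
    s ⊂ parent o F s ∧ parent o F s ∈ nodes o F ∧
      (∀ C ∈ children o F (parent o F s), C ⊆ s ∨ Disjoint C s) ∧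
      ∀ C ∈ children o F (parent o F s), C ≠ s := by
  have hs2 := hI.two_le s (mem_insert_self _ _)
  obtain ⟨h1, h2, h3⟩ := hF.parent_spec (B := s) (card_pos.1 (by omega))
    (hI.ssubset s (mem_insert_self _ _))
  have h4 : ∀ C ∈ children o F (parent o F s), C ≠ s := by
    rintro C hC rfl
    exact hs (mem_of_cell_of_two_le (mem_children.1 hC).1 hs2)
  refine ⟨h2, h1, fun C hC => ?_, h4⟩
  have hsC : ¬ s ⊆ C := by
    intro hsC
    have hlt : s ⊂ C := lt_of_le_of_ne hsC (h4 C hC).symm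
    have := card_lt_card hlt
    have h5 := h3 C (mem_nodes.2 (Or.inr (mem_of_cell_of_two_le (mem_children.1 hC).1
      (by omega)))) hlt
    exact (hF.ssubset_of_mem_children hE hC).not_subset h5
  rcases mem_cells.1 (mem_children.1 hC).1 with hCF | ⟨e, he, rfl⟩
  · rcases hI.laminar C (mem_insert_of_mem hCF) s (mem_insert_self _ _) with h' | h' | h'
    · exact Or.inl h'
    · exact absurd h' hsC
    · exact Or.inr h'
  · rcases singleton_laminar e s with h' | h' | h'
    · exact Or.inl h'
    · exact absurd h' hsC
    · exact Or.inr h'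

/-- A family of codimension one is contained in precisely three maximal ones, which correspond to
the three ways to resolve its vertex of valency four. -/
theorem exists_resolutions (hcard : #F + 3 = #(ground o)) :
    ∃ A ∈ nodes o F, ∃ X Y Z : Finset E, X ≠ Y ∧ X ≠ Z ∧ Y ≠ Z ∧ children o F A = {X, Y, Z} ∧
      (∀ A' ∈ nodes o F, A' ≠ A → #(children o F A') = 2) ∧
      ∀ s ∉ F, IsNested o (insert s F) → s = X ∪ Y ∨ s = X ∪ Z ∨ s = Y ∪ Z := by
  obtain ⟨A, hA, h3, h2⟩ := h.exists_card_children_eq_three hE hcard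
  obtain ⟨X, Y, Z, hXY, hXZ, hYZ, hch⟩ := card_eq_three.1 h3
  refine ⟨A, hA, X, Y, Z, hXY, hXZ, hYZ, hch, h2, fun s hs hI => ?_⟩
  obtain ⟨k1, k2, k3, k4⟩ := of_insert hE hs hI h
  have hsne : s.Nonempty := card_pos.1 (by have := hI.two_le s (mem_insert_self _ _); omega)
  have hU := h.biUnion_children hE k2
  by_cases hP : parent o F s = A
  · rw [hP, hch] at k3 k4
    rw [hP, hch] at hU
    rw [hP] at k1
    simp only [mem_insert, mem_singleton, forall_eq_or_imp, forall_eq] at k3 k4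
    have hU' : ∀ e, e ∈ A ↔ e ∈ X ∨ e ∈ Y ∨ e ∈ Z := by
      intro e; rw [← hU]; simp
    obtain ⟨cX, cY, cZ⟩ := k3
    have hsA : ∀ e ∈ s, e ∈ X ∨ e ∈ Y ∨ e ∈ Z := fun e he => (hU' e).1 (k1.subset he)
    rcases cX with cX | cX <;> rcases cY with cY | cY <;> rcases cZ with cZ | cZ
    · refine absurd (fun e he => ?_) k1.not_subset
      rcases (hU' e).1 he with h' | h' | h'
      exacts [cX h', cY h', cZ h']
    · refine Or.inl (Subset.antisymm (fun e he => ?_) (union_subset cX cY))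
      have := disjoint_right.1 cZ he
      have := hsA e he
      simp only [mem_union]; tauto
    · refine Or.inr (Or.inl (Subset.antisymm (fun e he => ?_) (union_subset cX cZ)))
      have := disjoint_right.1 cY he
      have := hsA e he
      simp only [mem_union]; tauto
    · refine absurd (Subset.antisymm cX fun e he => ?_) k4.1
      have := disjoint_right.1 cY he
      have := disjoint_right.1 cZ he
      have := hsA e he
      tauto
    · refine Or.inr (Or.inr (Subset.antisymm (fun e he => ?_) (union_subset cY cZ)))
      have := disjoint_right.1 cX he
      have := hsA e he
      simp only [mem_union]; tauto
    · refine absurd (Subset.antisymm cY fun e he => ?_) k4.2.1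
      have := disjoint_right.1 cX he
      have := disjoint_right.1 cZ he
      have := hsA e he
      tauto
    · refine absurd (Subset.antisymm cZ fun e he => ?_) k4.2.2
      have := disjoint_right.1 cX he
      have := disjoint_right.1 cY he
      have := hsA e he
      tauto
    · obtain ⟨e, he⟩ := hsne
      have := disjoint_right.1 cX he
      have := disjoint_right.1 cY he
      have := disjoint_right.1 cZ he
      have := hsA e he
      tauto
  · exfalso
    obtain ⟨C, D, hCD, hch'⟩ := card_eq_two.1 (h2 _ k2 hP)
    rw [hch'] at k3 k4 hU
    simp only [mem_insert, mem_singleton, forall_eq_or_imp, forall_eq] at k3 k4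
    have hU' : ∀ e, e ∈ parent o F s ↔ e ∈ C ∨ e ∈ D := by
      intro e; rw [← hU]; simp
    obtain ⟨cX, cY⟩ := k3
    have hsA : ∀ e ∈ s, e ∈ C ∨ e ∈ D := fun e he => (hU' e).1 (k1.subset he)
    rcases cX with cX | cX <;> rcases cY with cY | cY
    · refine absurd (fun e he => ?_) k1.not_subset
      rcases (hU' e).1 he with h' | h'
      exacts [cX h', cY h']
    · refine absurd (Subset.antisymm cX fun e he => ?_) k4.1
      have := disjoint_right.1 cY he
      have := hsA e he
      tauto
    · refine absurd (Subset.antisymm cY fun e he => ?_) k4.2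
      have := disjoint_right.1 cX he
      have := hsA e he
      tauto
    · obtain ⟨e, he⟩ := hsne
      have := disjoint_right.1 cX he
      have := disjoint_right.1 cY he
      have := hsA e he
      tauto

end IsNested

end Nested

end TropicalCount

namespace TropicalCount

/-! ### Bivectors and the differences `q ^ (a ∧ b) - q ^ (b ∧ a)` -/

section Wedge

variable {N : Type*} [AddCommGroup N]

theorem wedge_add_left (a b c : N) : wedge (a + b) c = wedge a c + wedge b c := by
  have h := (exteriorPower.ιMulti ℤ 2 (M := N)).map_update_add ![a, c] 0 a b
  have e : ∀ x : N, Function.update ![a, c] 0 x = ![x, c] := fun x => by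
    funext i; fin_cases i <;> rfl
  rwa [e, e, e] at h

theorem wedge_self (a : N) : wedge a a = 0 :=
  (exteriorPower.ιMulti ℤ 2 (M := N)).map_eq_zero_of_eq ![a, a] (i := 0) (j := 1) rfl zero_ne_one

theorem wedge_swap (a b : N) : wedge b a = -wedge a b := by
  have h := (exteriorPower.ιMulti ℤ 2 (M := N)).map_swap ![a, b] (i := 0) (j := 1) zero_ne_one
  rw [show (![a, b] ∘ (Equiv.swap (0 : Fin 2) 1)) = ![b, a] by
    funext i; fin_cases i <;> rfl] at h
  exact h

theorem wedge_neg_left (a b : N) : wedge (-a) b = -wedge a b := by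
  have h := wedge_add_left (-a) a b
  have h0 : wedge (0 : N) b = 0 := by simpa using (wedge_add_left (0 : N) 0 b)
  rw [neg_add_cancel, h0] at h
  exact eq_neg_of_add_eq_zero_left h.symm

theorem wedge_zero_left (b : N) : wedge (0 : N) b = 0 := by
  simpa using (wedge_add_left (0 : N) 0 b)

theorem wedge_zero_right (b : N) : wedge b (0 : N) = 0 := by
  rw [wedge_swap, wedge_zero_left, neg_zero]

variable (K : Submodule ℤ (⋀[ℤ]^2 N))

theorem qPow_add (x y : ⋀[ℤ]^2 N) : qPow K (x + y) = qPow K x * qPow K y := by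
  rw [qPow, qPow, qPow, AddMonoidAlgebra.single_mul_single, map_add, one_mul]

/-- The difference `q ^ (a ∧ b) - q ^ (b ∧ a)`. -/
noncomputable def qDiff (a b : N) : AddMonoidAlgebra ℤ ((⋀[ℤ]^2 N) ⧸ K) :=
  qPow K (wedge a b) - qPow K (wedge b a)

theorem qDiff_eq (a b : N) : qDiff K a b = qPow K (wedge a b) - qPow K (-wedge a b) := by
  rw [qDiff, wedge_swap a b]

theorem qDiff_swap (a b : N) : qDiff K b a = -qDiff K a b := by
  rw [qDiff, qDiff, neg_sub]

theorem qDiff_eq_zero {a b : N} (h : wedge a b ∈ K) : qDiff K a b = 0 := by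
  have h' : K.mkQ (wedge a b) = 0 := (Submodule.Quotient.mk_eq_zero K).2 h
  rw [qDiff_eq, qPow, qPow, map_neg, h', neg_zero, sub_self]

/-- The products over the two vertices of the three resolutions of a vertex of valency four, with
outgoing slopes `x`, `y`, `z` and `-(x + y + z)`, are linearly dependent. -/
theorem qDiff_resolutions (x y z : N) :
    qDiff K x y * qDiff K (x + y) z - qDiff K x z * qDiff K (x + z) y +
      qDiff K y z * qDiff K (y + z) x = 0 := by
  have e1 : wedge (x + y) z = wedge x z + wedge y z := wedge_add_left _ _ _
  have e2 : wedge (x + z) y = wedge x y + -wedge y z := by rw [wedge_add_left, wedge_swap y z]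
  have e3 : wedge (y + z) x = -wedge x y + -wedge x z := by
    rw [wedge_add_left, wedge_swap x y, wedge_swap x z]
  rw [qDiff_eq, qDiff_eq, qDiff_eq, qDiff_eq, qDiff_eq, qDiff_eq, e1, e2, e3]
  simp only [neg_add, neg_neg, qPow_add]
  ring

end Wedge

/-! ### Refined multiplicities of nested families -/

section Weights

open Finset

variable {N : Type*} [AddCommGroup N]

/-- The sum of the slopes of the ends in `A`; this is the slope of an edge which separates `A` from
the other ends. -/
def degSum {E : Type*} (n : E → N) (A : Finset E) : N := ∑ e ∈ A, n e

theorem degSum_union {E : Type*} [DecidableEq E] (n : E → N) {A B : Finset E}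
    (h : Disjoint A B) : degSum n (A ∪ B) = degSum n A + degSum n B := sum_union h

theorem degSum_singleton {E : Type*} (n : E → N) (e : E) : degSum n {e} = n e := sum_singleton _ _

variable {ι : Type*} {p : ℕ}

/-- The edge with cell `A` is a marked point. -/
def IsMark (A : Finset (ι ⊕ Fin p)) : Prop := ∃ i : Fin p, A = {.inr i}

theorem IsMark.card_eq_one {A : Finset (ι ⊕ Fin p)} (h : IsMark A) : #A = 1 := by
  obtain ⟨i, rfl⟩ := h
  exact card_singleton _

variable (ω : LinearMap.BilinForm ℤ N) (K : Submodule ℤ (⋀[ℤ]^2 N)) (φ : Fin p → N →ₗ[ℤ] ℤ)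
  (n : ι → N)

open scoped Classical in
/-- The factor of a trivalent vertex whose edges pointing away from the root have the cells `X`
and `Y`: it is `|φ_i(δ_i)|` if the vertex carries the marked point `i`, and the difference
`q ^ (a ∧ b) - q ^ (b ∧ a)`, where `ω(a, b) > 0`, otherwise. -/
noncomputable def joinFactor (X Y : Finset (ι ⊕ Fin p)) : AddMonoidAlgebra ℤ ((⋀[ℤ]^2 N) ⧸ K) :=
  if h : IsMark X then ((φ h.choose (degSum (markedDegree n p) Y)).natAbs : ℕ)
  else if h : IsMark Y then ((φ h.choose (degSum (markedDegree n p) X)).natAbs : ℕ)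
  else (SignType.sign (ω (degSum (markedDegree n p) X) (degSum (markedDegree n p) Y)) : ℤ) •
    qDiff K (degSum (markedDegree n p) X) (degSum (markedDegree n p) Y)

variable {ω K φ n}

theorem IsMark.choose_eq {i : Fin p} (h : IsMark ({.inr i} : Finset (ι ⊕ Fin p))) :
    h.choose = i := by
  have := h.choose_spec
  rw [singleton_inj, Sum.inr.injEq] at this
  exact this.symm

theorem degSum_mark (i : Fin p) : degSum (markedDegree n p) {.inr i} = 0 := by
  rw [degSum_singleton]; rfl

theorem joinFactor_mark_left (i : Fin p) (Y : Finset (ι ⊕ Fin p)) :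
    joinFactor ω K φ n {.inr i} Y = ((φ i (degSum (markedDegree n p) Y)).natAbs : ℕ) := by
  have h : IsMark ({.inr i} : Finset (ι ⊕ Fin p)) := ⟨i, rfl⟩
  rw [joinFactor, dif_pos h, h.choose_eq]

theorem joinFactor_mark_right (X : Finset (ι ⊕ Fin p)) (i : Fin p) :
    joinFactor ω K φ n X {.inr i} = ((φ i (degSum (markedDegree n p) X)).natAbs : ℕ) := by
  have h : IsMark ({.inr i} : Finset (ι ⊕ Fin p)) := ⟨i, rfl⟩
  by_cases hX : IsMark X
  · obtain ⟨j, rfl⟩ := hX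
    rw [joinFactor_mark_left, degSum_mark, degSum_mark, map_zero, map_zero]
  · rw [joinFactor, dif_neg hX, dif_pos h, h.choose_eq]

theorem joinFactor_of_not_isMark {X Y : Finset (ι ⊕ Fin p)} (hX : ¬ IsMark X) (hY : ¬ IsMark Y) :
    joinFactor ω K φ n X Y = (SignType.sign (ω (degSum (markedDegree n p) X)
      (degSum (markedDegree n p) Y)) : ℤ) •
        qDiff K (degSum (markedDegree n p) X) (degSum (markedDegree n p) Y) := by
  rw [joinFactor, dif_neg hX, dif_neg hY]

theorem joinFactor_comm (hω : ω.IsAlt) (X Y : Finset (ι ⊕ Fin p)) :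
    joinFactor ω K φ n X Y = joinFactor ω K φ n Y X := by
  by_cases hX : IsMark X
  · obtain ⟨i, rfl⟩ := hX
    rw [joinFactor_mark_left, joinFactor_mark_right]
  by_cases hY : IsMark Y
  · obtain ⟨i, rfl⟩ := hY
    rw [joinFactor_mark_left, joinFactor_mark_right]
  rw [joinFactor_of_not_isMark hX hY, joinFactor_of_not_isMark hY hX, qDiff_swap K (degSum _ X),
    ← hω.neg_eq (degSum _ X), Left.sign_neg]
  simp

variable (ω K φ n) in
open scoped Classical in
/-- The factor of the vertex with the given set of cells of edges pointing away from the root; it is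
`0` unless the vertex is trivalent. -/
noncomputable def vertexWeight [DecidableEq ι] (ch : Finset (Finset (ι ⊕ Fin p))) :
    AddMonoidAlgebra ℤ ((⋀[ℤ]^2 N) ⧸ K) :=
  if h : ∃ s : Finset (ι ⊕ Fin p) × Finset (ι ⊕ Fin p), s.1 ≠ s.2 ∧ ch = {s.1, s.2} then
    joinFactor ω K φ n h.choose.1 h.choose.2 else 0

theorem vertexWeight_pair [DecidableEq ι] (hω : ω.IsAlt) {X Y : Finset (ι ⊕ Fin p)} (hXY : X ≠ Y) :
    vertexWeight ω K φ n {X, Y} = joinFactor ω K φ n X Y := by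
  classical
  have h : ∃ s : Finset (ι ⊕ Fin p) × Finset (ι ⊕ Fin p), s.1 ≠ s.2 ∧
      ({X, Y} : Finset (Finset (ι ⊕ Fin p))) = {s.1, s.2} := ⟨(X, Y), hXY, rfl⟩
  have hw : vertexWeight ω K φ n {X, Y} = joinFactor ω K φ n h.choose.1 h.choose.2 := by
    rw [vertexWeight, dif_pos h]
  rw [hw]
  obtain ⟨h1, h2⟩ := h.choose_spec
  have hX : X ∈ ({h.choose.1, h.choose.2} : Finset (Finset (ι ⊕ Fin p))) := by rw [← h2]; simp
  have hY : Y ∈ ({h.choose.1, h.choose.2} : Finset (Finset (ι ⊕ Fin p))) := by rw [← h2]; simp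
  simp only [mem_insert, mem_singleton] at hX hY
  rcases hX with hX | hX <;> rcases hY with hY | hY
  · exact absurd (hX.trans hY.symm) hXY
  · rw [← hX, ← hY]
  · rw [← hX, ← hY, joinFactor_comm hω]
  · exact absurd (hX.trans hY.symm) hXY

variable (ω φ n) in
/-- A linear combination of the moments `ω(n_e, ·)` and of the forms `φ_i` for the ends and marked
points in `A`, evaluated at a common point `x`. -/
noncomputable def momentSum (c : ι → ℝ) (d : Fin p → ℝ) (A : Finset (ι ⊕ Fin p)) (x : N) : ℝ :=
  ∑ z ∈ A, Sum.elim (fun e => c e * (ω (n e) x : ℝ)) (fun i => d i * (φ i x : ℝ)) z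

theorem momentSum_union [DecidableEq ι] {c : ι → ℝ} {d : Fin p → ℝ} {A B : Finset (ι ⊕ Fin p)}
    (h : Disjoint A B) (x : N) : momentSum ω φ n c d (A ∪ B) x =
      momentSum ω φ n c d A x + momentSum ω φ n c d B x := sum_union h

theorem momentSum_add {c : ι → ℝ} {d : Fin p → ℝ} (A : Finset (ι ⊕ Fin p)) (x y : N) :
    momentSum ω φ n c d A (x + y) = momentSum ω φ n c d A x + momentSum ω φ n c d A y := by
  rw [momentSum, momentSum, momentSum, ← sum_add_distrib]
  refine sum_congr rfl fun z _ => ?_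
  rcases z with e | i <;> simp <;> ring

theorem momentSum_mark {c : ι → ℝ} {d : Fin p → ℝ} (i : Fin p) (x : N) :
    momentSum ω φ n c d {.inr i} x = d i * (φ i x : ℝ) := by
  rw [momentSum, sum_singleton]; rfl

theorem momentSum_eq {c : ι → ℝ} {d : Fin p → ℝ} {A : Finset (ι ⊕ Fin p)} {κ : ℝ}
    (hc : ∀ e, .inl e ∈ A → c e = κ) (hd : ∀ i, .inr i ∈ A → d i = 0) (x : N) :
    momentSum ω φ n c d A x = κ * (ω (degSum (markedDegree n p) A) x : ℝ) := by
  rw [momentSum, degSum, map_sum, LinearMap.sum_apply, Int.cast_sum, mul_sum]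
  refine sum_congr rfl fun z hz => ?_
  rcases z with e | i
  · simp [hc e hz, markedDegree]
  · simp [hd i hz, markedDegree]

variable [Fintype ι] [DecidableEq ι]

variable (ω K φ n) in
open scoped Classical in
/-- The refined multiplicity of a combinatorial type, in terms of its nested family; it is `0`
unless the type is trivalent. -/
noncomputable def familyWeight (o : ι ⊕ Fin p) (F : Finset (Finset (ι ⊕ Fin p))) :
    AddMonoidAlgebra ℤ ((⋀[ℤ]^2 N) ⧸ K) :=
  if IsNested o F ∧ #F + 2 = #(ground o) then
    ∏ A ∈ nodes o F, vertexWeight ω K φ n (children o F A) else 0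

theorem familyWeight_ne_zero {o : ι ⊕ Fin p} {F : Finset (Finset (ι ⊕ Fin p))}
    (h : familyWeight ω K φ n o F ≠ 0) : IsNested o F ∧ #F + 2 = #(ground o) := by
  rw [familyWeight] at h
  by_contra h'
  exact h (if_neg h')

/-- If the moments are compatible at all vertices beyond the edge `A`, and all these vertices have a
non-zero factor, then all moments of ends in `A` have the same coefficient, and the marked points in
`A` do not occur. -/
theorem exists_coeff_eq (hω : ω.IsAlt) {o : ι ⊕ Fin p} (hE : 2 ≤ #(ground o))
    {F : Finset (Finset (ι ⊕ Fin p))} (h : IsNested o F) {c : ι → ℝ} {d : Fin p → ℝ}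
    (A : Finset (ι ⊕ Fin p)) (hA : A ∈ cells o F ∨ A ∈ nodes o F) (hAm : ¬ IsMark A)
    (hw : ∀ B ∈ nodes o F, B ⊆ A → vertexWeight ω K φ n (children o F B) ≠ 0)
    (hz : ∀ B ∈ nodes o F, B ⊆ A → momentSum ω φ n c d B (degSum (markedDegree n p) B) = 0) :
    ∃ κ, (∀ e, .inl e ∈ A → c e = κ) ∧ ∀ i, .inr i ∈ A → d i = 0 := by
  induction hk : #A using Nat.strong_induction_on generalizing A with
  | _ k IH =>
  subst hk
  by_cases hAn : A ∈ nodes o F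
  swap
  · have hAc := hA.resolve_right hAn
    rcases mem_cells.1 hAc with hAF | ⟨z, hz, rfl⟩
    · exact absurd (mem_nodes.2 (Or.inr hAF)) hAn
    · rcases z with e | i
      · exact ⟨c e, by simp, by simp⟩
      · exact absurd ⟨i, rfl⟩ hAm
  have hwA := hw A hAn Subset.rfl
  have hzA := hz A hAn Subset.rfl
  obtain ⟨⟨X, Y⟩, hXY, hch⟩ : ∃ s : Finset (ι ⊕ Fin p) × Finset (ι ⊕ Fin p), s.1 ≠ s.2 ∧
      children o F A = {s.1, s.2} := by
    by_contra hcon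
    refine hwA ?_
    rw [vertexWeight, dif_neg hcon]
  simp only at hXY hch
  rw [hch, vertexWeight_pair hω hXY] at hwA
  have hX : X ∈ children o F A := by simp [hch]
  have hY : Y ∈ children o F A := by simp [hch]
  have hdis := h.disjoint_children hE hX hY hXY
  have hU : A = X ∪ Y := by
    rw [← h.biUnion_children hE hAn, hch]
    simp
  have hXA := h.ssubset_of_mem_children hE hX
  have hYA := h.ssubset_of_mem_children hE hY
  rw [hU, degSum_union _ hdis, momentSum_union hdis] at hzA
  have IHX := fun hXm => IH _ (card_lt_card hXA) X (Or.inl (mem_children.1 hX).1) hXm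
    (fun B hB hBX => hw B hB (hBX.trans hXA.subset))
    (fun B hB hBX => hz B hB (hBX.trans hXA.subset)) rfl
  have IHY := fun hYm => IH _ (card_lt_card hYA) Y (Or.inl (mem_children.1 hY).1) hYm
    (fun B hB hBX => hw B hB (hBX.trans hYA.subset))
    (fun B hB hBX => hz B hB (hBX.trans hYA.subset)) rfl
  have hmark : ∀ (i : Fin p) (X : Finset (ι ⊕ Fin p)) (κ : ℝ), joinFactor ω K φ n {.inr i} X ≠ 0 →
      (∀ e, .inl e ∈ X → c e = κ) → (∀ i, .inr i ∈ X → d i = 0) →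
      momentSum ω φ n c d X (degSum (markedDegree n p) X) +
        d i * (φ i (degSum (markedDegree n p) X) : ℝ) = 0 → d i = 0 := by
    intro i X κ hJ h1 h2 h3
    rw [momentSum_eq h1 h2, hω.self_eq_zero, Int.cast_zero, mul_zero, zero_add] at h3
    refine (mul_eq_zero.1 h3).resolve_right fun h4 => hJ ?_
    rw [joinFactor_mark_left, Int.cast_eq_zero.1 h4, Int.natAbs_zero, Nat.cast_zero]
  by_cases hXm : IsMark X
  · obtain ⟨i, rfl⟩ := hXm
    have hYm : ¬ IsMark Y := by
      rintro ⟨j, rfl⟩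
      refine hwA ?_
      rw [joinFactor_mark_left, degSum_mark, map_zero, Int.natAbs_zero, Nat.cast_zero]
    obtain ⟨κ, h1, h2⟩ := IHY hYm
    rw [degSum_mark, zero_add, momentSum_mark, add_comm] at hzA
    have hdi := hmark i Y κ hwA h1 h2 hzA
    refine ⟨κ, fun e he => h1 e ?_, fun j hj => ?_⟩
    · rw [hU] at he
      simpa using he
    · rw [hU] at hj
      rcases mem_union.1 hj with hj | hj
      · rw [mem_singleton, Sum.inr.injEq] at hj
        rwa [hj]
      · exact h2 j hj
  by_cases hYm : IsMark Y
  · obtain ⟨i, rfl⟩ := hYm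
    obtain ⟨κ, h1, h2⟩ := IHX hXm
    rw [degSum_mark, add_zero, momentSum_mark] at hzA
    rw [joinFactor_comm hω] at hwA
    have hdi := hmark i X κ hwA h1 h2 hzA
    refine ⟨κ, fun e he => h1 e ?_, fun j hj => ?_⟩
    · rw [hU] at he
      simpa using he
    · rw [hU] at hj
      rcases mem_union.1 hj with hj | hj
      · exact h2 j hj
      · rw [mem_singleton, Sum.inr.injEq] at hj
        rwa [hj]
  obtain ⟨κ, h1, h2⟩ := IHX hXm
  obtain ⟨κ', h1', h2'⟩ := IHY hYm
  rw [momentSum_eq h1 h2, momentSum_eq h1' h2', map_add, map_add, hω.self_eq_zero,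
    hω.self_eq_zero, ← hω.neg_eq (degSum _ X), zero_add, add_zero, Int.cast_neg] at hzA
  have hne : ω (degSum (markedDegree n p) X) (degSum (markedDegree n p) Y) ≠ 0 := by
    intro h0
    refine hwA ?_
    rw [joinFactor_of_not_isMark hXm hYm, h0, sign_zero]
    simp
  have hκ : κ = κ' := by
    have hne' : (ω (degSum (markedDegree n p) X) (degSum (markedDegree n p) Y) : ℝ) ≠ 0 :=
      Int.cast_ne_zero.2 hne
    have : (κ - κ') * (ω (degSum (markedDegree n p) X) (degSum (markedDegree n p) Y) : ℝ) = 0 := by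
      linear_combination hzA
    exact sub_eq_zero.1 ((mul_eq_zero.1 this).resolve_right hne')
  refine ⟨κ, fun e he => ?_, fun i hi => ?_⟩
  · rw [hU] at he
    rcases mem_union.1 he with he | he
    · exact h1 e he
    · exact (h1' e he).trans hκ.symm
  · rw [hU] at hi
    rcases mem_union.1 hi with hi | hi
    · exact h2 i hi
    · exact h2' i hi

end Weights

end TropicalCount

namespace TropicalCount

/-! ### The refined balancing identity at a wall -/

section WallIdentity

open Finset

variable {N : Type*} [AddCommGroup N] {ι : Type*} {p : ℕ} [DecidableEq ι]
  (ω : LinearMap.BilinForm ℤ N) (K : Submodule ℤ (⋀[ℤ]^2 N)) (φ : Fin p → N →ₗ[ℤ] ℤ)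
  (n : ι → N) (c : ι → ℝ) (d : Fin p → ℝ)

/-- The contribution to the balancing condition at a wall of the resolution which joins the edges
with cells `X` and `Y`. -/
noncomputable def resolutionTerm (X Y Z : Finset (ι ⊕ Fin p)) :
    AddMonoidAlgebra ℤ ((⋀[ℤ]^2 N) ⧸ K) :=
  (SignType.sign (momentSum ω φ n c d (X ∪ Y) (degSum (markedDegree n p) (X ∪ Y))) : ℤ) •
    (joinFactor ω K φ n X Y * joinFactor ω K φ n (X ∪ Y) Z)

variable {ω K φ n c d}

theorem resolutionTerm_comm (hω : ω.IsAlt) (X Y Z : Finset (ι ⊕ Fin p)) :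
    resolutionTerm ω K φ n c d X Y Z = resolutionTerm ω K φ n c d Y X Z := by
  rw [resolutionTerm, resolutionTerm, union_comm, joinFactor_comm hω X Y]

variable (ω φ n c d) in
/-- The moments at the edge with cell `X` are those of a marked point or of a single end. -/
def IsCoherent (X : Finset (ι ⊕ Fin p)) : Prop :=
  IsMark X ∨ ∃ κ : ℝ, ∀ x, momentSum ω φ n c d X x = κ * (ω (degSum (markedDegree n p) X) x : ℝ)

omit [DecidableEq ι] in
theorem IsCoherent.self_eq_zero (hω : ω.IsAlt) {X : Finset (ι ⊕ Fin p)}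
    (h : IsCoherent ω φ n c d X) : momentSum ω φ n c d X (degSum (markedDegree n p) X) = 0 := by
  rcases h with ⟨i, rfl⟩ | ⟨κ, h⟩
  · rw [momentSum_mark, degSum_mark, map_zero, Int.cast_zero, mul_zero]
  · rw [h, hω.self_eq_zero, Int.cast_zero, mul_zero]

theorem momentSum_union_self {X Y : Finset (ι ⊕ Fin p)} (h : Disjoint X Y)
    (hX : momentSum ω φ n c d X (degSum (markedDegree n p) X) = 0)
    (hY : momentSum ω φ n c d Y (degSum (markedDegree n p) Y) = 0) :
    momentSum ω φ n c d (X ∪ Y) (degSum (markedDegree n p) (X ∪ Y)) =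
      momentSum ω φ n c d X (degSum (markedDegree n p) Y) +
        momentSum ω φ n c d Y (degSum (markedDegree n p) X) := by
  rw [degSum_union _ h, momentSum_union h, momentSum_add, momentSum_add, hX, hY]
  ring

theorem not_isMark_union {X Y : Finset (ι ⊕ Fin p)} (h : Disjoint X Y) (hX : X.Nonempty)
    (hY : Y.Nonempty) : ¬ IsMark (X ∪ Y) := by
  intro hm
  have := hm.card_eq_one
  rw [card_union_of_disjoint h] at this
  have := hX.card_pos
  have := hY.card_pos
  omega

theorem sign_mul_natAbs (a : ℤ) : (SignType.sign (a : ℝ) : ℤ) * (a.natAbs : ℤ) = a := by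
  rw [Int.natCast_natAbs, sign_intCast]
  exact sign_mul_abs a

/-- The balancing identity at a vertex of valency four which carries two marked points. The
resolution joining the marked points has slope zero and multiplicity zero, the other two have equal
multiplicities and lie on opposite sides of the wall. -/
theorem resolution_two_marks {X : Finset (ι ⊕ Fin p)} {i j : Fin p}
    (hX : momentSum ω φ n c d X (degSum (markedDegree n p) X) = 0)
    (hXi : Disjoint X {.inr i}) (hXj : Disjoint X {.inr j})
    (hsum : momentSum ω φ n c d X (degSum (markedDegree n p) X) +
      d i * (φ i (degSum (markedDegree n p) X) : ℝ) +
      d j * (φ j (degSum (markedDegree n p) X) : ℝ) = 0) :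
    resolutionTerm ω K φ n c d X {.inr j} {.inr i} +
      resolutionTerm ω K φ n c d X {.inr i} {.inr j} +
      resolutionTerm ω K φ n c d {.inr j} {.inr i} X = 0 := by
  have h3 : resolutionTerm ω K φ n c d {.inr j} {.inr i} X = 0 := by
    rw [resolutionTerm, joinFactor_mark_left, degSum_mark, map_zero, Int.natAbs_zero,
      Nat.cast_zero, zero_mul, smul_zero]
  have e : ∀ k : Fin p, Disjoint X {.inr k} →
      momentSum ω φ n c d (X ∪ {.inr k}) (degSum (markedDegree n p) X) =
        d k * (φ k (degSum (markedDegree n p) X) : ℝ) := by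
    intro k hk
    rw [momentSum_union hk, hX, momentSum_mark, zero_add]
  rw [h3, add_zero, resolutionTerm, resolutionTerm, joinFactor_mark_right, joinFactor_mark_right,
    joinFactor_mark_right, joinFactor_mark_right, degSum_union _ hXi, degSum_union _ hXj,
    degSum_mark, degSum_mark, add_zero, e i hXi, e j hXj]
  rw [hX, zero_add] at hsum
  rw [eq_neg_of_add_eq_zero_left hsum, Left.sign_neg,
    mul_comm ((φ i _).natAbs : AddMonoidAlgebra ℤ ((⋀[ℤ]^2 N) ⧸ K)), ← add_smul]
  simp

/-- The balancing identity at a vertex of valency four which carries one marked point `i`. The three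
multiplicities have a common factor, and the other factors are `|φ_i|` at the slopes `x`, `y` and
`x + y`, with signs which turn the identity into the additivity of `φ_i`. -/
theorem resolution_one_mark (hω : ω.IsAlt) {X Y : Finset (ι ⊕ Fin p)} {i : Fin p} {κ κ' : ℝ}
    (hX : ∀ x, momentSum ω φ n c d X x = κ * (ω (degSum (markedDegree n p) X) x : ℝ))
    (hY : ∀ x, momentSum ω φ n c d Y x = κ' * (ω (degSum (markedDegree n p) Y) x : ℝ))
    (hXm : ¬ IsMark X) (hYm : ¬ IsMark Y) (hXn : X.Nonempty) (hYn : Y.Nonempty)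
    (hXi : Disjoint X {.inr i}) (hYi : Disjoint Y {.inr i}) (hXY : Disjoint X Y)
    (hsum : momentSum ω φ n c d (X ∪ Y) (degSum (markedDegree n p) (X ∪ Y)) +
      d i * (φ i (degSum (markedDegree n p) (X ∪ Y)) : ℝ) = 0) :
    resolutionTerm ω K φ n c d X Y {.inr i} + resolutionTerm ω K φ n c d X {.inr i} Y +
      resolutionTerm ω K φ n c d Y {.inr i} X = 0 := by
  have hX0 : momentSum ω φ n c d X (degSum (markedDegree n p) X) = 0 := by
    rw [hX, hω.self_eq_zero, Int.cast_zero, mul_zero]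
  have hY0 : momentSum ω φ n c d Y (degSum (markedDegree n p) Y) = 0 := by
    rw [hY, hω.self_eq_zero, Int.cast_zero, mul_zero]
  have hi : ({.inr i} : Finset (ι ⊕ Fin p)).Nonempty := singleton_nonempty _
  have eX : joinFactor ω K φ n (X ∪ {.inr i}) Y = joinFactor ω K φ n X Y := by
    rw [joinFactor_of_not_isMark (not_isMark_union hXi hXn hi) hYm,
      joinFactor_of_not_isMark hXm hYm, degSum_union _ hXi, degSum_mark, add_zero]
  have eY : joinFactor ω K φ n (Y ∪ {.inr i}) X = joinFactor ω K φ n X Y := by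
    rw [joinFactor_comm hω X Y, joinFactor_of_not_isMark (not_isMark_union hYi hYn hi) hXm,
      joinFactor_of_not_isMark hYm hXm, degSum_union _ hYi, degSum_mark, add_zero]
  have mX : momentSum ω φ n c d (X ∪ {.inr i}) (degSum (markedDegree n p) (X ∪ {.inr i})) =
        d i * (φ i (degSum (markedDegree n p) X) : ℝ) := by
    rw [degSum_union _ hXi, momentSum_union hXi, degSum_mark, add_zero, hX0, momentSum_mark,
      zero_add]
  have mY : momentSum ω φ n c d (Y ∪ {.inr i}) (degSum (markedDegree n p) (Y ∪ {.inr i})) =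
        d i * (φ i (degSum (markedDegree n p) Y) : ℝ) := by
    rw [degSum_union _ hYi, momentSum_union hYi, degSum_mark, add_zero, hY0, momentSum_mark,
      zero_add]
  rw [resolutionTerm, resolutionTerm, resolutionTerm, mX, mY, eX, eY, joinFactor_mark_right,
    joinFactor_mark_right, joinFactor_mark_right, eq_neg_of_add_eq_zero_left hsum, Left.sign_neg,
    sign_mul, sign_mul, sign_mul, degSum_union _ hXY]
  simp only [zsmul_eq_mul, SignType.coe_neg, SignType.coe_mul, Int.cast_mul, Int.cast_neg]
  have key : ∀ a : ℤ, ((SignType.sign (a : ℝ) : ℤ) : AddMonoidAlgebra ℤ ((⋀[ℤ]^2 N) ⧸ K)) *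
      ((a.natAbs : ℕ) : AddMonoidAlgebra ℤ ((⋀[ℤ]^2 N) ⧸ K)) = ((a : ℤ) : _) := by
    intro a
    rw [← Int.cast_natCast (R := AddMonoidAlgebra ℤ ((⋀[ℤ]^2 N) ⧸ K)), ← Int.cast_mul,
      sign_mul_natAbs]
  have k1 := key (φ i (degSum (markedDegree n p) X + degSum (markedDegree n p) Y))
  have k2 := key (φ i (degSum (markedDegree n p) X))
  have k3 := key (φ i (degSum (markedDegree n p) Y))
  have k4 := Int.cast_add (R := AddMonoidAlgebra ℤ ((⋀[ℤ]^2 N) ⧸ K))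
    (φ i (degSum (markedDegree n p) X)) (φ i (degSum (markedDegree n p) Y))
  rw [map_add] at k1 ⊢
  linear_combination (((SignType.sign (d i) : ℤ) : AddMonoidAlgebra ℤ ((⋀[ℤ]^2 N) ⧸ K)) *
    joinFactor ω K φ n X Y) * (k2 + k3 - k1 - k4)

/-- The sign of the contribution of a resolution without marked points. -/
theorem sign_smul_join (hω : ω.IsAlt) {X Y Z : Finset (ι ⊕ Fin p)} {κ κ' : ℝ}
    (hX : ∀ x, momentSum ω φ n c d X x = κ * (ω (degSum (markedDegree n p) X) x : ℝ))
    (hY : ∀ x, momentSum ω φ n c d Y x = κ' * (ω (degSum (markedDegree n p) Y) x : ℝ))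
    (hXm : ¬ IsMark X) (hYm : ¬ IsMark Y) (hZm : ¬ IsMark Z) (hXn : X.Nonempty) (hYn : Y.Nonempty)
    (hXY : Disjoint X Y)
    (hK : ω (degSum (markedDegree n p) X) (degSum (markedDegree n p) Y) = 0 →
      wedge (degSum (markedDegree n p) X) (degSum (markedDegree n p) Y) ∈ K)
    (hK' : ω (degSum (markedDegree n p) X + degSum (markedDegree n p) Y)
        (degSum (markedDegree n p) Z) = 0 →
      wedge (degSum (markedDegree n p) X + degSum (markedDegree n p) Y)
        (degSum (markedDegree n p) Z) ∈ K) {τ : ℝ}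
    (hτ : κ - κ' = τ * (ω (degSum (markedDegree n p) X + degSum (markedDegree n p) Y)
      (degSum (markedDegree n p) Z) : ℝ)) :
    resolutionTerm ω K φ n c d X Y Z = (SignType.sign τ : ℤ) •
      (qDiff K (degSum (markedDegree n p) X) (degSum (markedDegree n p) Y) *
        qDiff K (degSum (markedDegree n p) X + degSum (markedDegree n p) Y)
          (degSum (markedDegree n p) Z)) := by
  have hX0 : momentSum ω φ n c d X (degSum (markedDegree n p) X) = 0 := by
    rw [hX, hω.self_eq_zero, Int.cast_zero, mul_zero]
  have hY0 : momentSum ω φ n c d Y (degSum (markedDegree n p) Y) = 0 := by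
    rw [hY, hω.self_eq_zero, Int.cast_zero, mul_zero]
  rw [resolutionTerm, momentSum_union_self hXY hX0 hY0, hX, hY, joinFactor_of_not_isMark hXm hYm,
    joinFactor_of_not_isMark (not_isMark_union hXY hXn hYn) hZm, degSum_union _ hXY]
  set x := degSum (markedDegree n p) X
  set y := degSum (markedDegree n p) Y
  set z := degSum (markedDegree n p) Z
  by_cases h1 : ω x y = 0
  · rw [qDiff_eq_zero K (hK h1)]
    simp
  by_cases h2 : ω (x + y) z = 0
  · rw [qDiff_eq_zero K (hK' h2)]
    simp
  have e : κ * (ω x y : ℝ) + κ' * (ω y x : ℝ) = τ * ((ω (x + y) z : ℝ) * (ω x y : ℝ)) := by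
    rw [← hω.neg_eq x y, Int.cast_neg]
    linear_combination (ω x y : ℝ) * hτ
  have hsq : ∀ a : ℤ, a ≠ 0 → (SignType.sign a : ℤ) * (SignType.sign a : ℤ) = 1 := by
    intro a ha
    rcases lt_or_gt_of_ne ha with h | h
    · simp [sign_neg h]
    · simp [sign_pos h]
  rw [e, smul_mul_smul_comm, smul_smul, sign_mul, sign_mul, sign_intCast, sign_intCast]
  congr 1
  rw [SignType.coe_mul, SignType.coe_mul]
  linear_combination (SignType.sign τ : ℤ) * ((SignType.sign (ω x y) : ℤ) *
    (SignType.sign (ω x y) : ℤ)) * hsq _ h2 + (SignType.sign τ : ℤ) * hsq _ h1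

/-- The balancing identity at a vertex of valency four without marked points. Its signs are those of
`qDiff_resolutions`, up to a common sign `τ`. -/
theorem resolution_no_mark (hω : ω.IsAlt) {X Y Z : Finset (ι ⊕ Fin p)}
    {κ₁ κ₂ κ₃ : ℝ}
    (hX : ∀ x, momentSum ω φ n c d X x = κ₁ * (ω (degSum (markedDegree n p) X) x : ℝ))
    (hY : ∀ x, momentSum ω φ n c d Y x = κ₂ * (ω (degSum (markedDegree n p) Y) x : ℝ))
    (hZ : ∀ x, momentSum ω φ n c d Z x = κ₃ * (ω (degSum (markedDegree n p) Z) x : ℝ))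
    (hXm : ¬ IsMark X) (hYm : ¬ IsMark Y) (hZm : ¬ IsMark Z)
    (hXn : X.Nonempty) (hYn : Y.Nonempty) (hZn : Z.Nonempty)
    (hXY : Disjoint X Y) (hXZ : Disjoint X Z) (hYZ : Disjoint Y Z) {o : ι ⊕ Fin p} [Fintype ι]
    (hXo : X ⊆ ground o) (hYo : Y ⊆ ground o) (hZo : Z ⊆ ground o)
    (hK : ∀ A B, A ⊆ ground o → B ⊆ ground o → Disjoint A B →
      ω (degSum (markedDegree n p) A) (degSum (markedDegree n p) B) = 0 →
      wedge (degSum (markedDegree n p) A) (degSum (markedDegree n p) B) ∈ K)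
    (hsum : momentSum ω φ n c d (X ∪ Y ∪ Z) (degSum (markedDegree n p) (X ∪ Y ∪ Z)) = 0) :
    resolutionTerm ω K φ n c d X Y Z + resolutionTerm ω K φ n c d X Z Y +
      resolutionTerm ω K φ n c d Y Z X = 0 := by
  have hXYZ : Disjoint (X ∪ Y) Z := disjoint_union_left.2 ⟨hXZ, hYZ⟩
  have hXZY : Disjoint (X ∪ Z) Y := disjoint_union_left.2 ⟨hXY, hYZ.symm⟩
  have hYZX : Disjoint (Y ∪ Z) X := disjoint_union_left.2 ⟨hXY.symm, hXZ.symm⟩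
  have k1 := hK X Y hXo hYo hXY
  have k2 := hK X Z hXo hZo hXZ
  have k3 := hK Y Z hYo hZo hYZ
  have k4 := hK _ Z (union_subset hXo hYo) hZo hXYZ
  have k5 := hK _ Y (union_subset hXo hZo) hYo hXZY
  have k6 := hK _ X (union_subset hYo hZo) hXo hYZX
  rw [momentSum_union hXYZ, momentSum_union hXY, hX, hY, hZ] at hsum
  rw [degSum_union _ hXYZ, degSum_union _ hXY] at hsum
  rw [degSum_union _ hXY] at k4
  rw [degSum_union _ hXZ] at k5
  rw [degSum_union _ hYZ] at k6
  have T1 := fun τ hτ => sign_smul_join (K := K) (τ := τ) hω hX hY hXm hYm hZm hXn hYn hXY k1 k4 hτ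
  have T2 := fun τ hτ => sign_smul_join (K := K) (τ := τ) hω hX hZ hXm hZm hYm hXn hZn hXZ k2 k5 hτ
  have T3 := fun τ hτ => sign_smul_join (K := K) (τ := τ) hω hY hZ hYm hZm hXm hYn hZn hYZ k3 k6 hτ
  have Q := qDiff_resolutions K (degSum (markedDegree n p) X) (degSum (markedDegree n p) Y)
    (degSum (markedDegree n p) Z)
  set x := degSum (markedDegree n p) X
  set y := degSum (markedDegree n p) Y
  set z := degSum (markedDegree n p) Z
  have s1 : ω y x = -ω x y := (hω.neg_eq x y).symm
  have s2 : ω z x = -ω x z := (hω.neg_eq x z).symm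
  have s3 : ω z y = -ω y z := (hω.neg_eq y z).symm
  simp only [map_add, LinearMap.add_apply, s1, s2, s3, hω.self_eq_zero, Int.cast_add, Int.cast_neg,
    zero_add, add_zero] at T1 T2 T3 hsum k4 k5 k6
  have hrel : (κ₁ - κ₂) * ((ω x y : ℝ) + ω x z) + (κ₂ - κ₃) * ((ω x z : ℝ) + ω y z) = 0 := by
    linear_combination hsum
  -- The two coefficients are proportional to the pairings at the other vertex of the resolutions.
  by_cases h1 : (ω x z : ℝ) + ω y z = 0
  · by_cases h2 : (ω x y : ℝ) + ω x z = 0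
    -- Here each resolution has a vertex at which `ω` vanishes, so that its bivector lies in `K`.
    · have w1 : qDiff K (x + y) z = 0 := qDiff_eq_zero K (k4 (by exact_mod_cast h1))
      have w2 : qDiff K (x + z) y = 0 := qDiff_eq_zero K (k5 (by
        have : ((ω x y : ℤ) : ℝ) + -(ω y z : ℝ) = 0 := by linear_combination h2 - h1
        exact_mod_cast this))
      have w3 : qDiff K (y + z) x = 0 := qDiff_eq_zero K (k6 (by
        have : -((ω x y : ℤ) : ℝ) + -(ω x z : ℝ) = 0 := by linear_combination -h2
        exact_mod_cast this))
      have e : ∀ X Y Z : Finset (ι ⊕ Fin p), ¬ IsMark Z → X.Nonempty → Y.Nonempty → Disjoint X Y →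
          qDiff K (degSum (markedDegree n p) X + degSum (markedDegree n p) Y)
            (degSum (markedDegree n p) Z) = 0 → resolutionTerm ω K φ n c d X Y Z = 0 := by
        intro X Y Z hZm hXn hYn hXY h0
        rw [resolutionTerm, joinFactor_of_not_isMark (not_isMark_union hXY hXn hYn) hZm,
          degSum_union _ hXY, h0]
        simp
      rw [e X Y Z hZm hXn hYn hXY w1, e X Z Y hYm hXn hZn hXZ w2, e Y Z X hXm hYn hZn hYZ w3]
      simp
    · have hv : κ₂ - κ₃ = ((κ₃ - κ₂) / ((ω x y : ℝ) + ω x z)) * (-(ω x y : ℝ) + -(ω x z : ℝ)) := by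
        field_simp
        ring
      have hu : κ₁ - κ₂ = 0 := by
        rw [h1, mul_zero, add_zero] at hrel
        exact (mul_eq_zero.1 hrel).resolve_right h2
      set τ := (κ₃ - κ₂) / ((ω x y : ℝ) + ω x z)
      rw [T1 τ (by rw [h1, mul_zero, hu]), T3 τ hv,
        T2 (-τ) (by linear_combination hu + hv - τ * h1), Left.sign_neg, SignType.coe_neg, neg_smul,
        ← sub_eq_add_neg, ← smul_sub, ← smul_add, Q, smul_zero]
  · have hu : κ₁ - κ₂ = ((κ₁ - κ₂) / ((ω x z : ℝ) + ω y z)) * ((ω x z : ℝ) + ω y z) := by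
      field_simp
    set τ := (κ₁ - κ₂) / ((ω x z : ℝ) + ω y z)
    have hv : κ₂ - κ₃ = τ * (-(ω x y : ℝ) + -(ω x z : ℝ)) := by
      refine mul_right_cancel₀ h1 ?_
      linear_combination hrel - ((ω x y : ℝ) + ω x z) * hu
    rw [T1 τ hu, T3 τ hv, T2 (-τ) (by linear_combination hu + hv), Left.sign_neg,
      SignType.coe_neg, neg_smul, ← sub_eq_add_neg, ← smul_sub, ← smul_add, Q, smul_zero]

/-- The balancing identity at a vertex of valency four. -/
theorem sum_resolutionTerm (hω : ω.IsAlt) {X Y Z : Finset (ι ⊕ Fin p)}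
    (hX : IsCoherent ω φ n c d X) (hY : IsCoherent ω φ n c d Y) (hZ : IsCoherent ω φ n c d Z)
    (hXn : X.Nonempty) (hYn : Y.Nonempty) (hZn : Z.Nonempty)
    (hXY : Disjoint X Y) (hXZ : Disjoint X Z) (hYZ : Disjoint Y Z) {o : ι ⊕ Fin p} [Fintype ι]
    (hXo : X ⊆ ground o) (hYo : Y ⊆ ground o) (hZo : Z ⊆ ground o)
    (hK : ∀ A B, A ⊆ ground o → B ⊆ ground o → Disjoint A B →
      ω (degSum (markedDegree n p) A) (degSum (markedDegree n p) B) = 0 →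
      wedge (degSum (markedDegree n p) A) (degSum (markedDegree n p) B) ∈ K)
    (hsum : momentSum ω φ n c d (X ∪ Y ∪ Z) (degSum (markedDegree n p) (X ∪ Y ∪ Z)) = 0) :
    resolutionTerm ω K φ n c d X Y Z + resolutionTerm ω K φ n c d X Z Y +
      resolutionTerm ω K φ n c d Y Z X = 0 := by
  have hXYZ : Disjoint (X ∪ Y) Z := disjoint_union_left.2 ⟨hXZ, hYZ⟩
  have two : ∀ (X : Finset (ι ⊕ Fin p)) (i j : Fin p), Disjoint X {.inr i} → Disjoint X {.inr j} →
      Disjoint ({.inr i} : Finset (ι ⊕ Fin p)) {.inr j} → IsCoherent ω φ n c d X →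
      momentSum ω φ n c d (X ∪ {.inr i} ∪ {.inr j})
        (degSum (markedDegree n p) (X ∪ {.inr i} ∪ {.inr j})) = 0 → _ :=
    fun X i j hi hj hij hX hs => resolution_two_marks (K := K) (hX.self_eq_zero hω) hi hj (by
      have h' : Disjoint (X ∪ {.inr i}) ({.inr j} : Finset (ι ⊕ Fin p)) :=
        disjoint_union_left.2 ⟨hj, hij⟩
      rw [momentSum_union h', momentSum_union hi, momentSum_mark, momentSum_mark,
        degSum_union _ h', degSum_union _ hi, degSum_mark, degSum_mark, add_zero, add_zero] at hs
      exact hs)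
  have one : ∀ (X Y : Finset (ι ⊕ Fin p)) (i : Fin p), Disjoint X {.inr i} → Disjoint Y {.inr i} →
      Disjoint X Y → X.Nonempty → Y.Nonempty → ¬ IsMark X → ¬ IsMark Y →
      IsCoherent ω φ n c d X → IsCoherent ω φ n c d Y →
      momentSum ω φ n c d (X ∪ Y ∪ {.inr i})
        (degSum (markedDegree n p) (X ∪ Y ∪ {.inr i})) = 0 →
      resolutionTerm ω K φ n c d X Y {.inr i} + resolutionTerm ω K φ n c d X {.inr i} Y +
        resolutionTerm ω K φ n c d Y {.inr i} X = 0 := by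
    intro X Y i hXi hYi hXY hXn hYn hXm hYm hX hY hs
    obtain ⟨κ, hX⟩ := hX.resolve_left hXm
    obtain ⟨κ', hY⟩ := hY.resolve_left hYm
    refine resolution_one_mark (K := K) hω hX hY hXm hYm hXn hYn hXi hYi hXY ?_
    have h' : Disjoint (X ∪ Y) ({.inr i} : Finset (ι ⊕ Fin p)) := disjoint_union_left.2 ⟨hXi, hYi⟩
    rw [momentSum_union h', momentSum_mark, degSum_union _ h', degSum_mark, add_zero] at hs
    exact hs
  have hs1 : momentSum ω φ n c d (Y ∪ X ∪ Z) (degSum (markedDegree n p) (Y ∪ X ∪ Z)) = 0 := by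
    rwa [union_comm Y X]
  have hs2 : momentSum ω φ n c d (X ∪ Z ∪ Y) (degSum (markedDegree n p) (X ∪ Z ∪ Y)) = 0 := by
    rwa [union_right_comm]
  have hs3 : momentSum ω φ n c d (Z ∪ X ∪ Y) (degSum (markedDegree n p) (Z ∪ X ∪ Y)) = 0 := by
    rwa [union_assoc, union_comm]
  have hs4 : momentSum ω φ n c d (Y ∪ Z ∪ X) (degSum (markedDegree n p) (Y ∪ Z ∪ X)) = 0 := by
    rwa [union_comm, ← union_assoc]
  have sw := fun X Y Z => resolutionTerm_comm (K := K) (φ := φ) (n := n) (c := c) (d := d) hω X Y Z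
  by_cases hZm : IsMark Z
  · by_cases hYm : IsMark Y
    · obtain ⟨i, rfl⟩ := hZm
      obtain ⟨j, rfl⟩ := hYm
      have := two X i j hXZ hXY hYZ.symm hX hs2
      linear_combination this
    by_cases hXm : IsMark X
    · obtain ⟨i, rfl⟩ := hZm
      obtain ⟨j, rfl⟩ := hXm
      have := two Y i j hYZ hXY.symm hXZ.symm hY hs4
      rw [sw Y {.inr j}] at this
      linear_combination this
    · obtain ⟨i, rfl⟩ := hZm
      exact one X Y i hXZ hYZ hXY hXn hYn hXm hYm hX hY hsum
  by_cases hYm : IsMark Y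
  · by_cases hXm : IsMark X
    · obtain ⟨i, rfl⟩ := hYm
      obtain ⟨j, rfl⟩ := hXm
      have := two Z j i hXZ.symm hYZ.symm hXY hZ hs3
      rw [sw Z {.inr i}, sw Z {.inr j}, sw {.inr i} {.inr j}] at this
      linear_combination this
    · obtain ⟨i, rfl⟩ := hYm
      have := one X Z i hXY hYZ.symm hXZ hXn hZn hXm hZm hX hZ hs2
      rw [sw Z {.inr i}] at this
      linear_combination this
  by_cases hXm : IsMark X
  · obtain ⟨i, rfl⟩ := hXm
    have := one Y Z i hXY.symm hXZ.symm hYZ hYn hZn hYm hZm hY hZ hs4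
    rw [sw Y {.inr i}, sw Z {.inr i}] at this
    linear_combination this
  obtain ⟨κ₁, hX⟩ := hX.resolve_left hXm
  obtain ⟨κ₂, hY⟩ := hY.resolve_left hYm
  obtain ⟨κ₃, hZ⟩ := hZ.resolve_left hZm
  exact resolution_no_mark hω hX hY hZ hXm hYm hZm hXn hYn hZn hXY hXZ hYZ hXo hYo hZo hK hsum

end WallIdentity

end TropicalCount

namespace TropicalCount

section WallSum

open Finset

variable {N : Type*} [AddCommGroup N] {ι : Type*} {p : ℕ} [Fintype ι] [DecidableEq ι]
  {ω : LinearMap.BilinForm ℤ N} {K : Submodule ℤ (⋀[ℤ]^2 N)} {φ : Fin p → N →ₗ[ℤ] ℤ}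
  {n : ι → N} {c : ι → ℝ} {d : Fin p → ℝ} {o : ι ⊕ Fin p}

/-- The multiplicity of a resolution of a vertex of valency four. -/
theorem familyWeight_insert (hω : ω.IsAlt) (hE : 2 ≤ #(ground o))
    {G : Finset (Finset (ι ⊕ Fin p))} (h : IsNested o G) (hcard : #G + 3 = #(ground o))
    {A X Y Z : Finset (ι ⊕ Fin p)} (hA : A ∈ nodes o G) (hch : children o G A = {X, Y, Z})
    (hXY : X ≠ Y) (hXZ : X ≠ Z) (hYZ : Y ≠ Z) :
    familyWeight ω K φ n o (insert (X ∪ Y) G) =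
      (∏ A' ∈ (nodes o G).erase A, vertexWeight ω K φ n (children o G A')) *
        (joinFactor ω K φ n X Y * joinFactor ω K φ n (X ∪ Y) Z) := by
  have hs := h.union_notMem hE hch hXY hXZ hYZ
  have hsG : X ∪ Y ∉ G := fun h' => hs (mem_nodes.2 (Or.inr h'))
  obtain ⟨c1, c2, c3⟩ := h.children_insert hE hA hch hXY hXZ hYZ
  have hZ : Z ∈ children o G A := by simp [hch]
  have hX : X ∈ children o G A := by simp [hch]
  have hne : X ∪ Y ≠ Z := by
    rintro rfl
    obtain ⟨x, hx⟩ := h.cell_nonempty (mem_children.1 hX).1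
    exact disjoint_left.1 (h.disjoint_children hE hX hZ hXZ) hx (mem_union_left _ hx)
  rw [familyWeight, if_pos ⟨h.insert_union hE hA hch hXY hXZ hYZ, by
    rw [card_insert_of_notMem hsG]; omega⟩, IsNested.nodes_insert, prod_insert hs, c1,
    ← mul_prod_erase _ _ hA, c2, vertexWeight_pair hω hXY, vertexWeight_pair hω hne,
    prod_congr rfl fun A' hA' => by rw [c3 A' (mem_of_mem_erase hA') (ne_of_mem_erase hA')]]
  ring

theorem union_ne_union {T : Type*} [DecidableEq T] {X Y Z : Finset T} (hY : Y.Nonempty)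
    (hXY : Disjoint X Y) (hYZ : Disjoint Y Z) : X ∪ Y ≠ X ∪ Z := by
  intro e
  obtain ⟨y, hy⟩ := hY
  rcases mem_union.1 (e ▸ mem_union_right X hy) with h | h
  · exact disjoint_right.1 hXY hy h
  · exact disjoint_left.1 hYZ hy h

/-- The refined multiplicities of the types adjacent to a wall, multiplied by the signs of the
equation of the wall under the moment map, cancel. -/
theorem sum_sign_smul_familyWeight (hω : ω.IsAlt) (hE : 2 ≤ #(ground o))
    (hK : ∀ A B, A ⊆ ground o → B ⊆ ground o → Disjoint A B →
      ω (degSum (markedDegree n p) A) (degSum (markedDegree n p) B) = 0 →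
      wedge (degSum (markedDegree n p) A) (degSum (markedDegree n p) B) ∈ K)
    (G : Finset (Finset (ι ⊕ Fin p)))
    (hG : ∀ B ∈ nodes o G, momentSum ω φ n c d B (degSum (markedDegree n p) B) = 0) :
    ∑ s with s ∉ G, (SignType.sign (momentSum ω φ n c d s (degSum (markedDegree n p) s)) : ℤ) •
      familyWeight ω K φ n o (insert s G) = 0 := by
  by_cases hall : ∀ s ∉ G, familyWeight ω K φ n o (insert s G) = 0
  · refine sum_eq_zero fun s hs => ?_
    rw [hall s (mem_filter.1 hs).2, smul_zero]
  push Not at hall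
  obtain ⟨s₀, hs₀, hw₀⟩ := hall
  obtain ⟨hI, hcard⟩ := familyWeight_ne_zero hw₀
  have h : IsNested o G := hI.mono (subset_insert _ _)
  rw [card_insert_of_notMem hs₀] at hcard
  obtain ⟨A, hA, X, Y, Z, hXY, hXZ, hYZ, hch, -, hcl⟩ := h.exists_resolutions hE (by omega)
  have hchY : children o G A = {X, Z, Y} := by rw [hch, Finset.pair_comm]
  have hchX : children o G A = {Y, Z, X} := by
    rw [hch, Finset.insert_comm, Finset.pair_comm]
  have hX : X ∈ children o G A := by simp [hch]
  have hY : Y ∈ children o G A := by simp [hch]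
  have hZ : Z ∈ children o G A := by simp [hch]
  have nX := h.cell_nonempty (mem_children.1 hX).1
  have nY := h.cell_nonempty (mem_children.1 hY).1
  have nZ := h.cell_nonempty (mem_children.1 hZ).1
  have dXY := h.disjoint_children hE hX hY hXY
  have dXZ := h.disjoint_children hE hX hZ hXZ
  have dYZ := h.disjoint_children hE hY hZ hYZ
  have ne1 : X ∪ Y ≠ X ∪ Z := union_ne_union nY dXY dYZ
  have ne2 : X ∪ Y ≠ Y ∪ Z := by rw [union_comm X Y]; exact union_ne_union nX dXY.symm dXZ
  have ne3 : X ∪ Z ≠ Y ∪ Z := by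
    rw [union_comm X Z, union_comm Y Z]; exact union_ne_union nX dXZ.symm dXY
  have w1 := familyWeight_insert (K := K) (φ := φ) (n := n) hω hE h (by omega) hA hch hXY hXZ hYZ
  have w2 := familyWeight_insert (K := K) (φ := φ) (n := n) hω hE h (by omega) hA hchY hXZ hXY
    hYZ.symm
  have w3 := familyWeight_insert (K := K) (φ := φ) (n := n) hω hE h (by omega) hA hchX hYZ
    hXY.symm hXZ.symm
  have hs1 := h.union_notMem hE hch hXY hXZ hYZ
  have hs2 := h.union_notMem hE hchY hXZ hXY hYZ.symm
  have hs3 := h.union_notMem hE hchX hYZ hXY.symm hXZ.symm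
  have hsub : ({X ∪ Y, X ∪ Z, Y ∪ Z} : Finset (Finset (ι ⊕ Fin p))) ⊆ univ.filter (· ∉ G) := by
    intro s hs
    simp only [mem_insert, mem_singleton] at hs
    refine mem_filter.2 ⟨mem_univ _, fun h' => ?_⟩
    have h' := mem_nodes.2 (Or.inr h' : s = ground o ∨ s ∈ G)
    rcases hs with rfl | rfl | rfl
    exacts [hs1 h', hs2 h', hs3 h']
  rw [← sum_subset hsub fun s hs hs' => ?_]
  swap
  · simp only [mem_insert, mem_singleton] at hs'
    by_cases hw : familyWeight ω K φ n o (insert s G) = 0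
    · rw [hw, smul_zero]
    · exact absurd (hcl s (mem_filter.1 hs).2 (familyWeight_ne_zero hw).1) hs'
  rw [sum_insert (by simp [ne1, ne2]), sum_insert (by simp [ne3]), sum_singleton, w1, w2, w3]
  set ρ := ∏ A' ∈ (nodes o G).erase A, vertexWeight ω K φ n (children o G A') with hρ
  by_cases hv : ∃ A' ∈ (nodes o G).erase A, vertexWeight ω K φ n (children o G A') = 0
  · obtain ⟨A', hA', h0⟩ := hv
    rw [prod_eq_zero hA' h0] at hρ
    simp [hρ]
  push Not at hv
  have coh : ∀ C ∈ children o G A, IsCoherent ω φ n c d C := by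
    intro C hC
    by_cases hm : IsMark C
    · exact Or.inl hm
    obtain ⟨κ, h1, h2⟩ := exists_coeff_eq (K := K) (φ := φ) (n := n) hω hE h (c := c) (d := d) C
      (Or.inl (mem_children.1 hC).1) hm (fun B hB hBC => hv B (mem_erase.2 ⟨by
        rintro rfl
        exact (h.ssubset_of_mem_children hE hC).not_subset hBC, hB⟩))
      (fun B hB _ => hG B hB)
    exact Or.inr ⟨κ, momentSum_eq h1 h2⟩
  have hUA : X ∪ Y ∪ Z = A := by
    rw [← h.biUnion_children hE hA, hch]
    simp [union_assoc]
  have key := sum_resolutionTerm (K := K) (o := o) hω (coh X hX) (coh Y hY) (coh Z hZ) nX nY nZ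
    dXY dXZ dYZ
    ((h.ssubset_of_mem_children hE hX).subset.trans (h.node_subset hA))
    ((h.ssubset_of_mem_children hE hY).subset.trans (h.node_subset hA))
    ((h.ssubset_of_mem_children hE hZ).subset.trans (h.node_subset hA)) hK
    (by rw [hUA]; exact hG A hA)
  rw [resolutionTerm, resolutionTerm, resolutionTerm] at key
  simp only [zsmul_eq_mul] at key ⊢
  linear_combination ρ * key

end WallSum

/-! ### Evaluation maps and their real images -/

section Evaluation

open Finset

variable {E N B : Type*} [DecidableEq E] [AddCommGroup N] [AddCommGroup B]

/-- The position of the ends for the curve whose only bounded edge of non-zero length is the one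
separating `A` from the other ends, which has length one; the root is at the origin. -/
def rayVector (n : E → N) (A : Finset E) : E → N := fun e => if e ∈ A then degSum n A else 0

/-- The linear span of the image of a cone of the moduli space under the evaluation map `Φ`. -/
noncomputable def coneSpan (n : E → N) (Φ : (E → N) →ₗ[ℤ] B) (F : Finset (Finset E)) :
    Submodule ℝ (ℝ ⊗[ℤ] B) :=
  Submodule.span ℝ ((fun A => (1 : ℝ) ⊗ₜ[ℤ] Φ (rayVector n A)) '' F ∪
    Set.range fun x : N => (1 : ℝ) ⊗ₜ[ℤ] Φ fun _ => x)

end Evaluation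

section Moment

open Finset

variable {N : Type*} [AddCommGroup N] {ι : Type*} {p : ℕ}

/-- The target of the moment problem. -/
abbrev MomentTarget (n : ι → N) (p : ℕ) (e₀ : ι) (δ : N) : Type _ :=
  ((N ⧸ Submodule.span ℤ {n e₀, δ}) ⧸ Submodule.torsion ℤ (N ⧸ Submodule.span ℤ {n e₀, δ})) ×
    ({e // e ≠ e₀} → ℤ) × (Fin p → ℤ)

/-- The evaluation of the moment problem as a function of the positions of the ends. -/
def momentMap (ω : LinearMap.BilinForm ℤ N) (φ : Fin p → N →ₗ[ℤ] ℤ) (n : ι → N) (e₀ : ι) (δ : N) :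
    (ι ⊕ Fin p → N) →ₗ[ℤ] MomentTarget n p e₀ δ :=
  ((Submodule.torsion ℤ _).mkQ ∘ₗ (Submodule.span ℤ {n e₀, δ}).mkQ ∘ₗ
    LinearMap.proj (.inl e₀)).prod
  ((LinearMap.pi fun e : {e // e ≠ e₀} => ω (n e.1) ∘ₗ LinearMap.proj (.inl e.1)).prod
    (LinearMap.pi fun i => φ i ∘ₗ LinearMap.proj (.inr i)))

variable [Fintype ι] [DecidableEq ι] {ω : LinearMap.BilinForm ℤ N} {K : Submodule ℤ (⋀[ℤ]^2 N)}
  {φ : Fin p → N →ₗ[ℤ] ℤ} {n : ι → N} {e₀ : ι} {δ : N}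

omit [DecidableEq ι] in
theorem sum_markedDegree (hsum : ∑ e, n e = 0) : ∑ z, markedDegree n p z = 0 := by
  simp [markedDegree, hsum]

theorem degSum_ground (hsum : ∑ e, n e = 0) :
    degSum (markedDegree n p) (ground (.inl e₀)) = -n e₀ := by
  rw [degSum, ground]
  have := add_sum_erase univ (markedDegree n p) (mem_univ (.inl e₀ : ι ⊕ Fin p))
  rw [sum_markedDegree hsum] at this
  exact eq_neg_of_add_eq_zero_right this

/-- A linear form on the target of the moment problem is given by coefficients of the moments and of
the forms `φ_i`, and by a linear form `ψ` on `N` which vanishes on `n e₀` and on `δ`. -/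
theorem exists_coeff (β : MomentTarget n p e₀ δ →ₗ[ℤ] ℝ) :
    ∃ (c : ι → ℝ) (d : Fin p → ℝ) (ψ : N →ₗ[ℤ] ℝ), ψ (n e₀) = 0 ∧ ψ δ = 0 ∧
      (∀ x : ι ⊕ Fin p → N, β (momentMap ω φ n e₀ δ x) = ψ (x (.inl e₀)) +
        ∑ z ∈ ground (.inl e₀), Sum.elim (fun e => c e * (ω (n e) (x (.inl e)) : ℝ))
          (fun i => d i * (φ i (x (.inr i)) : ℝ)) z) ∧
      (ψ = 0 → (∀ e, e ≠ e₀ → c e = 0) → (∀ i, d i = 0) → β = 0) := by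
  let c : ι → ℝ := fun e => if h : e ≠ e₀ then β (0, Pi.single ⟨e, h⟩ 1, 0) else 0
  let d : Fin p → ℝ := fun i => β (0, 0, Pi.single i 1)
  let ψ' := β ∘ₗ LinearMap.inl ℤ _ _
  let ψ : N →ₗ[ℤ] ℝ := ψ' ∘ₗ (Submodule.torsion ℤ _).mkQ ∘ₗ (Submodule.span ℤ {n e₀, δ}).mkQ
  have hψ : ∀ x ∈ Submodule.span ℤ {n e₀, δ}, ψ x = 0 := by
    intro x hx
    have : (Submodule.span ℤ {n e₀, δ}).mkQ x = 0 := (Submodule.Quotient.mk_eq_zero _).2 hx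
    simp only [ψ, LinearMap.comp_apply, this, map_zero]
  have hβ : ∀ a b g, β (a, b, g) = ψ' a + ∑ e, (b e : ℝ) * c e.1 + ∑ i, (g i : ℝ) * d i := by
    intro a b g
    have e1 : (a, b, g) = (a, 0, 0) + ∑ e, b e • ((0, Pi.single e 1, 0) : MomentTarget n p e₀ δ) +
        ∑ i, g i • ((0, 0, Pi.single i 1) : MomentTarget n p e₀ δ) := by
      refine Prod.ext ?_ (Prod.ext ?_ ?_)
      · simp [Prod.fst_sum]
      · funext e
        simp [Prod.fst_sum, Prod.snd_sum, Finset.sum_apply, Pi.single_apply]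
      · funext i
        simp [Prod.snd_sum, Finset.sum_apply, Pi.single_apply]
    rw [e1, map_add, map_add, map_sum, map_sum]
    refine congrArg₂ _ (congrArg₂ _ rfl (sum_congr rfl fun e _ => ?_))
      (sum_congr rfl fun i _ => ?_)
    · rw [map_zsmul, zsmul_eq_mul]
      simp only [c, dif_pos e.2]
    · rw [map_zsmul, zsmul_eq_mul]
  refine ⟨c, d, ψ, hψ _ (Submodule.subset_span (by simp)), hψ _ (Submodule.subset_span (by simp)),
    fun x => ?_, fun h1 h2 h3 => ?_⟩
  · have e2 : ∑ z ∈ ground (.inl e₀ : ι ⊕ Fin p), Sum.elim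
        (fun e => c e * (ω (n e) (x (.inl e)) : ℝ)) (fun i => d i * (φ i (x (.inr i)) : ℝ)) z =
        ∑ e : {e // e ≠ e₀}, (ω (n e.1) (x (.inl e.1)) : ℝ) * c e.1 +
          ∑ i, (φ i (x (.inr i)) : ℝ) * d i := by
      have e3 : ∑ z ∈ ground (.inl e₀ : ι ⊕ Fin p), Sum.elim
          (fun e => c e * (ω (n e) (x (.inl e)) : ℝ)) (fun i => d i * (φ i (x (.inr i)) : ℝ)) z =
          ∑ z, Sum.elim (fun e => c e * (ω (n e) (x (.inl e)) : ℝ))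
            (fun i => d i * (φ i (x (.inr i)) : ℝ)) z := by
        refine sum_subset (subset_univ _) fun z _ hz => ?_
        have : z = .inl e₀ := by simpa [mem_ground] using hz
        rw [this]
        simp [c]
      rw [e3, Fintype.sum_sum_type]
      congr 1
      · simp only [Sum.elim_inl]
        rw [← Finset.sum_subtype (univ.filter (· ≠ e₀)) (by simp)
          (fun e => (ω (n e) (x (.inl e)) : ℝ) * c e), sum_filter]
        refine sum_congr rfl fun e _ => ?_
        split_ifs with he
        · exact mul_comm _ _
        · simp only [c, dif_neg he, zero_mul]
      · exact sum_congr rfl fun i _ => mul_comm _ _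
    rw [e2, ← add_assoc]
    exact hβ _ _ _
  · refine LinearMap.ext fun y => ?_
    obtain ⟨a, b, g⟩ := y
    rw [hβ, LinearMap.zero_apply]
    have e1 : ψ' a = 0 := by
      obtain ⟨a, rfl⟩ := Submodule.mkQ_surjective _ a
      obtain ⟨a, rfl⟩ := Submodule.mkQ_surjective _ a
      exact LinearMap.congr_fun h1 a
    rw [e1, sum_eq_zero fun e _ => by rw [h2 _ e.2, mul_zero],
      sum_eq_zero fun i _ => by rw [h3 i, mul_zero]]
    simp

theorem sum_ground_rayVector (ω : LinearMap.BilinForm ℤ N) (φ : Fin p → N →ₗ[ℤ] ℤ) (c : ι → ℝ)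
    (d : Fin p → ℝ) {A : Finset (ι ⊕ Fin p)} (hA : A ⊆ ground (.inl e₀)) :
    ∑ z ∈ ground (.inl e₀), Sum.elim
        (fun e => c e * (ω (n e) (rayVector (markedDegree n p) A (.inl e)) : ℝ))
        (fun i => d i * (φ i (rayVector (markedDegree n p) A (.inr i)) : ℝ)) z =
      momentSum ω φ n c d A (degSum (markedDegree n p) A) := by
  rw [momentSum, ← sum_subset hA fun z _ hz => ?_]
  · refine sum_congr rfl fun z hz => ?_
    rcases z with e | i <;> simp [rayVector, hz]
  · rcases z with e | i <;> simp [rayVector, hz]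

theorem rayVector_root {A : Finset (ι ⊕ Fin p)} (hA : A ⊆ ground (.inl e₀)) :
    rayVector (markedDegree n p) A (.inl e₀) = 0 :=
  if_neg fun h => mem_ground.1 (hA h) rfl

/-- Evaluation of a linear form on the target of the moment problem: the moments are compatible at
the edges and vertices of a family on whose cone the form vanishes. -/
theorem exists_coeff_of_vanishing (hsum : ∑ e, n e = 0)
    (β : MomentTarget n p e₀ δ →ₗ[ℤ] ℝ) (hdiag : ∀ x, β (momentMap ω φ n e₀ δ fun _ => x) = 0) :
    ∃ (c : ι → ℝ) (d : Fin p → ℝ),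
      (∀ A ⊆ ground (.inl e₀), β (momentMap ω φ n e₀ δ (rayVector (markedDegree n p) A)) =
        momentSum ω φ n c d A (degSum (markedDegree n p) A)) ∧
      momentSum ω φ n c d (ground (.inl e₀)) (degSum (markedDegree n p) (ground (.inl e₀))) = 0 ∧
      momentSum ω φ n c d (ground (.inl e₀)) δ = 0 ∧
      ((∀ e, e ≠ e₀ → c e = 0) → (∀ i, d i = 0) → β = 0) := by
  obtain ⟨c, d, ψ, h1, h2, h3, h4⟩ := exists_coeff (ω := ω) (φ := φ) β
  have hd : ∀ x, momentSum ω φ n c d (ground (.inl e₀)) x = -ψ x := by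
    intro x
    have := h3 fun _ => x
    rw [hdiag] at this
    exact eq_neg_of_add_eq_zero_right this.symm
  refine ⟨c, d, fun A hA => ?_, ?_, ?_, fun hc hd' => h4 ?_ hc hd'⟩
  · rw [h3, rayVector_root hA, map_zero, zero_add, sum_ground_rayVector ω φ c d hA]
  · rw [degSum_ground hsum, hd, map_neg, h1, neg_zero, neg_zero]
  · rw [hd, h2, neg_zero]
  · refine LinearMap.ext fun x => ?_
    have := hd x
    rw [momentSum_eq (κ := 0) (fun e he => hc e fun h => mem_ground.1 he (by rw [h]))
      (fun i _ => hd' i), zero_mul] at this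
    rw [LinearMap.zero_apply, ← neg_eq_zero, ← this]

/-- Balancing of the refined multiplicities with respect to the moment problem. -/
theorem sum_sign_moment_smul_familyWeight (hω : ω.IsAlt) (hsum : ∑ e, n e = 0)
    (hE : 2 ≤ #(ground (.inl e₀ : ι ⊕ Fin p)))
    (hK : ∀ A B, A ⊆ ground (.inl e₀) → B ⊆ ground (.inl e₀) → Disjoint A B →
      ω (degSum (markedDegree n p) A) (degSum (markedDegree n p) B) = 0 →
      wedge (degSum (markedDegree n p) A) (degSum (markedDegree n p) B) ∈ K)
    (G : Finset (Finset (ι ⊕ Fin p))) (β : MomentTarget n p e₀ δ →ₗ[ℤ] ℝ)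
    (hβ : ∀ A ∈ G, β (momentMap ω φ n e₀ δ (rayVector (markedDegree n p) A)) = 0)
    (hdiag : ∀ x, β (momentMap ω φ n e₀ δ fun _ => x) = 0) :
    ∑ s with s ∉ G,
      (SignType.sign (β (momentMap ω φ n e₀ δ (rayVector (markedDegree n p) s))) : ℤ) •
        familyWeight ω K φ n (.inl e₀) (insert s G) = 0 := by
  obtain ⟨c, d, h1, h2, -, -⟩ := exists_coeff_of_vanishing (ω := ω) (φ := φ) hsum β hdiag
  by_cases hG : IsNested (.inl e₀) G
  · rw [← sum_sign_smul_familyWeight (φ := φ) (c := c) (d := d) hω hE hK G]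
    · refine sum_congr rfl fun s _ => ?_
      by_cases hw : familyWeight ω K φ n (.inl e₀) (insert s G) = 0
      · rw [hw, smul_zero, smul_zero]
      · rw [h1 s ((familyWeight_ne_zero hw).1.ssubset s (mem_insert_self _ _)).subset]
    · intro B hB
      rcases mem_nodes.1 hB with rfl | hB'
      · exact h2
      · rw [← h1 B (hG.node_subset hB), hβ B hB']
  · refine sum_eq_zero fun s _ => ?_
    by_cases hw : familyWeight ω K φ n (.inl e₀) (insert s G) = 0
    · rw [hw, smul_zero]
    · exact absurd ((familyWeight_ne_zero hw).1.mono (subset_insert _ _)) hG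

/-- A subset of a `ℤ`-module `B` spans `ℝ ⊗ B` if no non-zero real linear form on `B` vanishes on
it. -/
theorem span_tensor_eq_top {B : Type*} [AddCommGroup B] (s : Set B)
    (h : ∀ β : B →ₗ[ℤ] ℝ, (∀ b ∈ s, β b = 0) → β = 0) :
    Submodule.span ℝ ((fun b => (1 : ℝ) ⊗ₜ[ℤ] b) '' s) = ⊤ := by
  by_contra hne
  obtain ⟨f, hf, hker⟩ := Submodule.exists_le_ker_of_lt_top _ (lt_top_iff_ne_top.2 hne)
  refine hf ?_
  let β : B →ₗ[ℤ] ℝ := (f.restrictScalars ℤ) ∘ₗ TensorProduct.mk ℤ ℝ B 1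
  have hβ := h β fun b hb => hker (Submodule.subset_span ⟨b, hb, rfl⟩)
  ext b
  exact LinearMap.congr_fun hβ b

/-- If all vertices have non-zero factors, the moment problem is non-degenerate on the cone of the
type: a linear form which vanishes on its image has coefficients proportional to those of
`ω (n e₀, ·)`, and the value at `δ` shows that the factor of proportionality is zero. -/
theorem coneSpan_moment_eq_top (hω : ω.IsAlt) (hsum : ∑ e, n e = 0)
    (hE : 2 ≤ #(ground (.inl e₀ : ι ⊕ Fin p))) (hδ : ω (n e₀) δ ≠ 0)
    {F : Finset (Finset (ι ⊕ Fin p))} (hF : familyWeight ω K φ n (.inl e₀) F ≠ 0) :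
    coneSpan (markedDegree n p) (momentMap ω φ n e₀ δ) F = ⊤ := by
  obtain ⟨h, hcard⟩ := familyWeight_ne_zero hF
  have e : coneSpan (markedDegree n p) (momentMap ω φ n e₀ δ) F = Submodule.span ℝ
      ((fun b => (1 : ℝ) ⊗ₜ[ℤ] b) ''
        ((fun A => momentMap ω φ n e₀ δ (rayVector (markedDegree n p) A)) '' F ∪
          Set.range fun x => momentMap ω φ n e₀ δ fun _ => x)) := by
    rw [coneSpan, Set.image_union, Set.image_image, ← Set.range_comp]
    rfl
  rw [e]
  refine span_tensor_eq_top _ fun β hβ => ?_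
  obtain ⟨c, d, h1, h2, h3, h4⟩ := exists_coeff_of_vanishing (ω := ω) (φ := φ) hsum β
    fun x => hβ _ (Or.inr ⟨x, rfl⟩)
  have hw : ∀ B ∈ nodes (.inl e₀) F, vertexWeight ω K φ n (children (.inl e₀) F B) ≠ 0 := by
    intro B hB h0
    refine hF ?_
    rw [familyWeight, if_pos ⟨h, hcard⟩]
    exact prod_eq_zero hB h0
  obtain ⟨κ, k1, k2⟩ := exists_coeff_eq hω hE h (c := c) (d := d) (ground (.inl e₀))
    (Or.inr (mem_nodes.2 (Or.inl rfl))) (fun hm => by have := hm.card_eq_one; omega)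
    (fun B hB _ => hw B hB) (fun B hB _ => by
      rcases mem_nodes.1 hB with rfl | hB'
      · exact h2
      · rw [← h1 B (h.node_subset hB)]
        exact hβ _ (Or.inl ⟨B, hB', rfl⟩))
  rw [momentSum_eq k1 k2, degSum_ground hsum, map_neg, LinearMap.neg_apply] at h3
  have hκ : κ = 0 := (mul_eq_zero.1 h3).resolve_right (by simpa using hδ)
  exact h4 (fun e he => hκ ▸ k1 e (mem_ground.2 fun h => he (Sum.inl_injective h)))
    (fun i => k2 i (mem_ground.2 (by simp)))

end Moment

end TropicalCount

namespace TropicalCount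

/-! ### Rooted trees -/

namespace LabelledTree

open Finset

section Parent

variable {E : Type*} (T : LabelledTree E) (o : E)

/-- The distance of a vertex from the vertex adjacent to the root end. -/
noncomputable def depth (v : Fin T.numVertices) : ℕ := T.graph.dist (T.foot o) v

theorem eq_of_adj_of_depth {v w w' : Fin T.numVertices} (hw : T.graph.Adj w v)
    (hw' : T.graph.Adj w' v) (h : T.depth o v = T.depth o w + 1)
    (h' : T.depth o v = T.depth o w' + 1) : w = w' := by
  obtain ⟨p, hp⟩ := T.isTree.connected.exists_walk_length_eq_dist (T.foot o) w
  obtain ⟨p', hp'⟩ := T.isTree.connected.exists_walk_length_eq_dist (T.foot o) w'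
  have k : (p.concat hw).IsPath := SimpleGraph.Walk.isPath_of_length_eq_dist _ (by
    rw [SimpleGraph.Walk.length_concat, hp]; exact h.symm)
  have k' : (p'.concat hw').IsPath := SimpleGraph.Walk.isPath_of_length_eq_dist _ (by
    rw [SimpleGraph.Walk.length_concat, hp']; exact h'.symm)
  have := congrArg Subtype.val
    ((T.isTree.isAcyclic.subsingleton_path _ _).elim ⟨_, k⟩ ⟨_, k'⟩)
  have := congrArg SimpleGraph.Walk.penultimate this
  simpa using this

theorem exists_adj_depth {v : Fin T.numVertices} (hv : v ≠ T.foot o) :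
    ∃ w, T.graph.Adj w v ∧ T.depth o v = T.depth o w + 1 := by
  obtain ⟨p, hp⟩ := T.isTree.connected.exists_walk_length_eq_dist (T.foot o) v
  have hnil : ¬ p.Nil := fun h => hv h.eq.symm
  have hadj := p.adj_penultimate hnil
  refine ⟨p.penultimate, hadj, ?_⟩
  have h1 : T.depth o p.penultimate ≤ p.dropLast.length := T.graph.dist_le _
  have h2 : p.dropLast.length + 1 = p.length := by
    rw [← SimpleGraph.Walk.length_concat _ hadj, SimpleGraph.Walk.concat_dropLast]
  rcases T.isTree.dist_eq_dist_add_one_of_adj (T.foot o) hadj with h | h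
  · change T.depth o p.penultimate = T.depth o v + 1 at h
    change p.length = T.depth o v at hp
    omega
  · exact h

open scoped Classical in
/-- The neighbour of `v` in the direction of the root end; by convention, it is `v` itself if `v` is
the vertex adjacent to the root end. -/
noncomputable def par (v : Fin T.numVertices) : Fin T.numVertices :=
  if hv : v ≠ T.foot o then (T.exists_adj_depth o hv).choose else v

@[simp] theorem par_root : T.par o (T.foot o) = T.foot o := by simp [par]

variable {o}

theorem adj_par {v : Fin T.numVertices} (hv : v ≠ T.foot o) : T.graph.Adj (T.par o v) v := by
  rw [par, dif_pos hv]
  exact (T.exists_adj_depth o hv).choose_spec.1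

theorem depth_par {v : Fin T.numVertices} (hv : v ≠ T.foot o) :
    T.depth o v = T.depth o (T.par o v) + 1 := by
  rw [par, dif_pos hv]
  exact (T.exists_adj_depth o hv).choose_spec.2

theorem par_eq_of_adj {v w : Fin T.numVertices} (h : T.graph.Adj v w) :
    (v ≠ T.foot o ∧ T.par o v = w) ∨ (w ≠ T.foot o ∧ T.par o w = v) := by
  have key : ∀ {v w}, T.graph.Adj v w → T.depth o v = T.depth o w + 1 →
      v ≠ T.foot o ∧ T.par o v = w := by
    intro v w h hd
    have hv : v ≠ T.foot o := by
      rintro rfl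
      simp [depth] at hd
    exact ⟨hv, T.eq_of_adj_of_depth o (T.adj_par hv) h.symm (T.depth_par hv) hd⟩
  rcases T.isTree.dist_eq_dist_add_one_of_adj (T.foot o) h with h' | h'
  · exact Or.inl (key h h')
  · exact Or.inr (key h.symm h')

theorem adj_iff {v w : Fin T.numVertices} : T.graph.Adj v w ↔
    (v ≠ T.foot o ∧ T.par o v = w) ∨ (w ≠ T.foot o ∧ T.par o w = v) := by
  refine ⟨T.par_eq_of_adj, ?_⟩
  rintro (⟨hv, rfl⟩ | ⟨hw, rfl⟩)
  · exact (T.adj_par hv).symm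
  · exact T.adj_par hw

/-- The parents are determined by any orientation of all edges in which every vertex other than the
root has one outgoing edge. -/
theorem par_eq_of_forall {f : Fin T.numVertices → Fin T.numVertices}
    (hf : ∀ v w, T.graph.Adj v w → (v ≠ T.foot o ∧ f v = w) ∨ (w ≠ T.foot o ∧ f w = v))
    {v : Fin T.numVertices} (hv : v ≠ T.foot o) : T.par o v = f v := by
  induction hd : T.depth o v using Nat.strong_induction_on generalizing v with
  | _ d ih =>
    rcases hf _ _ (T.adj_par hv) with ⟨hp, h⟩ | ⟨-, h⟩
    · have h1 := T.depth_par hv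
      have h2 := T.depth_par hp
      rw [ih _ (by omega) hp rfl, h] at h2
      omega
    · exact h.symm

/-- The vertex `w` lies on the way from `v` to the root. -/
def IsAbove (v w : Fin T.numVertices) (o : E) : Prop := ∃ k, (T.par o)^[k] v = w

variable {T}

theorem IsAbove.refl (v : Fin T.numVertices) : T.IsAbove v v o := ⟨0, rfl⟩

theorem IsAbove.trans {u v w : Fin T.numVertices} (h : T.IsAbove u v o) (h' : T.IsAbove v w o) :
    T.IsAbove u w o := by
  obtain ⟨k, rfl⟩ := h
  obtain ⟨l, rfl⟩ := h'
  exact ⟨l + k, Function.iterate_add_apply _ _ _ _⟩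

theorem isAbove_par (v : Fin T.numVertices) : T.IsAbove v (T.par o v) o := ⟨1, rfl⟩

theorem IsAbove.eq_or {v w : Fin T.numVertices} (h : T.IsAbove v w o) :
    v = w ∨ v ≠ T.foot o ∧ T.IsAbove (T.par o v) w o := by
  obtain ⟨k, hk⟩ := h
  by_cases hv : v = T.foot o
  · subst hv
    rw [Function.iterate_fixed (T.par_root o)] at hk
    exact Or.inl hk
  cases k with
  | zero => exact Or.inl hk
  | succ k => exact Or.inr ⟨hv, k, hk⟩

theorem IsAbove.total {u v w : Fin T.numVertices} (h : T.IsAbove u v o) (h' : T.IsAbove u w o) :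
    T.IsAbove v w o ∨ T.IsAbove w v o := by
  obtain ⟨k, rfl⟩ := h
  obtain ⟨l, rfl⟩ := h'
  rcases le_total k l with hkl | hkl
  · exact Or.inl ⟨l - k, by rw [← Function.iterate_add_apply, Nat.sub_add_cancel hkl]⟩
  · exact Or.inr ⟨k - l, by rw [← Function.iterate_add_apply, Nat.sub_add_cancel hkl]⟩

theorem depth_par_le (v : Fin T.numVertices) : T.depth o (T.par o v) ≤ T.depth o v := by
  by_cases hv : v = T.foot o
  · rw [hv, par_root]
  · rw [T.depth_par hv]; omega

theorem IsAbove.depth_le {v w : Fin T.numVertices} (h : T.IsAbove v w o) :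
    T.depth o w ≤ T.depth o v := by
  obtain ⟨k, rfl⟩ := h
  induction k with
  | zero => exact le_rfl
  | succ k ih =>
    rw [Function.iterate_succ_apply']
    exact (depth_par_le _).trans ih

theorem IsAbove.antisymm {v w : Fin T.numVertices} (h : T.IsAbove v w o) (h' : T.IsAbove w v o) :
    v = w := by
  rcases h.eq_or with h1 | ⟨hv, h1⟩
  · exact h1
  · have h2 := h1.depth_le
    have h3 := h'.depth_le
    have h4 := T.depth_par hv
    omega

variable (T) in
theorem isAbove_root (v : Fin T.numVertices) : T.IsAbove v (T.foot o) o := by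
  induction hd : T.depth o v using Nat.strong_induction_on generalizing v with
  | _ d ih =>
    by_cases hv : v = T.foot o
    · subst hv; exact IsAbove.refl _
    · exact (isAbove_par v).trans (ih _ (by have := T.depth_par hv; omega) _ rfl)

theorem not_isAbove_of_par_eq {v w : Fin T.numVertices} (hw : w ≠ T.foot o)
    (h : T.par o w = v) : ¬ T.IsAbove v w o := fun k => by
  have h1 := k.depth_le
  have h2 := T.depth_par hw
  rw [h] at h2
  omega

/-- Induction on the vertices of a rooted tree, from the leaves towards the root. -/
theorem leaf_induction {P : Fin T.numVertices → Prop}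
    (h : ∀ v, (∀ w, w ≠ T.foot o → T.par o w = v → P w) → P v) (v : Fin T.numVertices) : P v := by
  have wf : WellFounded fun w v : Fin T.numVertices => T.depth o v < T.depth o w := by
    have : IsTrans (Fin T.numVertices) fun w v => T.depth o v < T.depth o w :=
      ⟨fun _ _ _ h1 h2 => lt_trans h2 h1⟩
    have : Std.Irrefl fun w v : Fin T.numVertices => T.depth o v < T.depth o w :=
      ⟨fun _ => lt_irrefl _⟩
    exact Finite.wellFounded_of_trans_of_irrefl _
  refine wf.induction v fun v ih => h v fun w hw hwv => ih w ?_
  have := T.depth_par hw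
  rw [hwv] at this
  omega

/-- Induction on the vertices of a rooted tree, from the root towards the leaves. -/
theorem root_induction {P : Fin T.numVertices → Prop} (h0 : P (T.foot o))
    (h : ∀ v, v ≠ T.foot o → P (T.par o v) → P v) (v : Fin T.numVertices) : P v := by
  induction hd : T.depth o v using Nat.strong_induction_on generalizing v with
  | _ d ih =>
    by_cases hv : v = T.foot o
    · subst hv; exact h0
    · exact h v hv (ih _ (by have := T.depth_par hv; omega) _ rfl)

variable (T o) in
open scoped Classical in
/-- The branch at `v` in the direction of the root end. -/
noncomputable def upBranch (v : Fin T.numVertices) : T.Branch v :=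
  if h : v = T.foot o then .inr ⟨o, h.symm⟩ else .inl ⟨T.par o v, (T.adj_par h).symm⟩

theorem inl_ne_upBranch {v : Fin T.numVertices} {w : {w // T.graph.Adj v w}} :
    Sum.inl w ≠ T.upBranch o v ↔ w.1 ≠ T.foot o ∧ T.par o w.1 = v := by
  by_cases hv : v = T.foot o
  · rw [upBranch, dif_pos hv]
    refine ⟨fun _ => ?_, fun _ => Sum.inl_ne_inr⟩
    rcases T.par_eq_of_adj (o := o) w.2 with h | h
    · exact absurd hv h.1
    · exact h
  · rw [upBranch, dif_neg hv, Ne, Sum.inl.injEq, Subtype.ext_iff]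
    rcases T.par_eq_of_adj (o := o) w.2 with h | h
    · refine ⟨fun k => absurd h.2.symm k, fun k => ?_⟩
      have h1 := T.depth_par h.1
      have h2 := T.depth_par k.1
      rw [h.2] at h1
      rw [k.2] at h2
      omega
    · refine ⟨fun _ => h, fun _ k => ?_⟩
      have h1 := T.depth_par h.1
      have h2 := T.depth_par hv
      rw [h.2] at h1
      rw [← show w.1 = T.par o v from k] at h2
      omega

theorem inr_ne_upBranch {v : Fin T.numVertices} {e : {e // T.foot e = v}} :
    Sum.inr e ≠ T.upBranch o v ↔ e.1 ≠ o := by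
  by_cases hv : v = T.foot o
  · rw [upBranch, dif_pos hv, Ne, Sum.inr.injEq, Subtype.ext_iff]
  · rw [upBranch, dif_neg hv]
    refine ⟨fun _ h => hv ?_, fun _ => Sum.inr_ne_inl⟩
    rw [← e.2, h]

end Parent

section Below

variable {E : Type*} [Fintype E] [DecidableEq E] (T : LabelledTree E) (o : E)

open scoped Classical in
/-- The ends, other than the root end, which lie beyond the vertex `v` as seen from the root. -/
noncomputable def below (v : Fin T.numVertices) : Finset E :=
  univ.filter fun e => e ≠ o ∧ T.IsAbove (T.foot e) v o

/-- The ends beyond a branch at `v` which does not lead to the root. -/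
noncomputable def side (v : Fin T.numVertices) : T.Branch v → Finset E
  | .inl w => T.below o w.1
  | .inr e => {e.1}

/-- The nested family of a tree: the sets of ends beyond the bounded edges. -/
noncomputable def splits : Finset (Finset E) := (univ.erase (T.foot o)).image (T.below o)

variable {T o}

theorem mem_below {v : Fin T.numVertices} {e : E} :
    e ∈ T.below o v ↔ e ≠ o ∧ T.IsAbove (T.foot e) v o := by simp [below]

theorem below_subset_of_isAbove {v w : Fin T.numVertices} (h : T.IsAbove v w o) :
    T.below o v ⊆ T.below o w := fun _ he =>
  mem_below.2 ⟨(mem_below.1 he).1, (mem_below.1 he).2.trans h⟩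

theorem side_subset {v : Fin T.numVertices} {b : T.Branch v} (hb : b ≠ T.upBranch o v) :
    T.side o v b ⊆ T.below o v := by
  rcases b with w | e
  · rw [inl_ne_upBranch] at hb
    exact below_subset_of_isAbove ⟨1, hb.2⟩
  · rw [inr_ne_upBranch] at hb
    exact singleton_subset_iff.2 (mem_below.2 ⟨hb, 0, e.2⟩)

theorem exists_mem_side {v : Fin T.numVertices} {e : E} (he : e ∈ T.below o v) :
    ∃ b, b ≠ T.upBranch o v ∧ e ∈ T.side o v b := by
  obtain ⟨heo, k, hk⟩ := mem_below.1 he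
  have key : ∀ k v, (T.par o)^[k] (T.foot e) = v →
      T.foot e = v ∨ ∃ w, w ≠ T.foot o ∧ T.par o w = v ∧ T.IsAbove (T.foot e) w o := by
    intro k
    induction k with
    | zero => exact fun v h => Or.inl h
    | succ k ih =>
      intro v h
      rw [Function.iterate_succ_apply'] at h
      by_cases hr : (T.par o)^[k] (T.foot e) = T.foot o
      · rw [hr, par_root] at h
        exact ih v (hr.trans h)
      · exact Or.inr ⟨_, hr, h, k, rfl⟩
  rcases key k v hk with h | ⟨w, hw, hwv, h⟩
  · exact ⟨.inr ⟨e, h⟩, inr_ne_upBranch.2 heo, mem_singleton_self e⟩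
  · exact ⟨.inl ⟨w, (T.adj_iff (o := o)).2 (Or.inr ⟨hw, hwv⟩)⟩, inl_ne_upBranch.2 ⟨hw, hwv⟩,
      mem_below.2 ⟨heo, h⟩⟩

theorem eq_of_mem_side {v : Fin T.numVertices} {e : E} {b b' : T.Branch v}
    (hb : b ≠ T.upBranch o v) (hb' : b' ≠ T.upBranch o v) (he : e ∈ T.side o v b)
    (he' : e ∈ T.side o v b') : b = b' := by
  have aux : ∀ w w' : Fin T.numVertices, w ≠ T.foot o → T.par o w = v → w' ≠ T.foot o →
      T.par o w' = v → T.IsAbove w w' o → w = w' := by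
    intro w w' hw hwv hw' hwv' h
    rcases h.eq_or with h | ⟨-, h⟩
    · exact h
    · rw [hwv] at h
      exact absurd h (not_isAbove_of_par_eq hw' hwv')
  rcases b with w | e₁ <;> rcases b' with w' | e₂
  · rw [inl_ne_upBranch] at hb hb'
    congr 1
    refine Subtype.ext ?_
    rcases (mem_below.1 he).2.total (mem_below.1 he').2 with h | h
    · exact aux _ _ hb.1 hb.2 hb'.1 hb'.2 h
    · exact (aux _ _ hb'.1 hb'.2 hb.1 hb.2 h).symm
  · rw [inl_ne_upBranch] at hb
    obtain rfl := mem_singleton.1 he'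
    have := (mem_below.1 he).2
    rw [e₂.2] at this
    exact absurd this (not_isAbove_of_par_eq hb.1 hb.2)
  · rw [inl_ne_upBranch] at hb'
    obtain rfl := mem_singleton.1 he
    have := (mem_below.1 he').2
    rw [e₁.2] at this
    exact absurd this (not_isAbove_of_par_eq hb'.1 hb'.2)
  · congr 1
    refine Subtype.ext ?_
    rw [← mem_singleton.1 he, mem_singleton.1 he']

variable (T o)

open scoped Classical in
/-- The branches at a vertex which do not lead to the root. -/
noncomputable def downBranches (v : Fin T.numVertices) : Finset (T.Branch v) :=
  univ.erase (T.upBranch o v)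

variable {T o}

theorem mem_downBranches {v : Fin T.numVertices} {b : T.Branch v} :
    b ∈ T.downBranches o v ↔ b ≠ T.upBranch o v := by simp [downBranches]

theorem card_downBranches (v : Fin T.numVertices) :
    #(T.downBranches o v) + 1 = Nat.card (T.Branch v) := by
  classical
  rw [downBranches, card_erase_add_one (mem_univ _), card_univ, Nat.card_eq_fintype_card]

variable (T o)

theorem below_nonempty (v : Fin T.numVertices) : (T.below o v).Nonempty := by
  refine leaf_induction (o := o) (P := fun v => (T.below o v).Nonempty) (fun v ih => ?_) v
  have h1 : 3 ≤ Nat.card (T.Branch v) := T.three_le_valency v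
  have h2 := card_downBranches (T := T) (o := o) v
  have : (T.downBranches o v).Nonempty := card_pos.1 (by omega)
  obtain ⟨b, hb⟩ := this
  rw [mem_downBranches] at hb
  refine Nonempty.mono (side_subset hb) ?_
  rcases b with w | e
  · obtain ⟨h3, h4⟩ := inl_ne_upBranch.1 hb
    exact ih _ h3 h4
  · exact singleton_nonempty _

theorem side_nonempty {v : Fin T.numVertices} (b : T.Branch v) : (T.side o v b).Nonempty := by
  rcases b with w | e
  · exact T.below_nonempty o _
  · exact singleton_nonempty _

variable {T o}

theorem pairwiseDisjoint_side (v : Fin T.numVertices) :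
    Set.PairwiseDisjoint (T.downBranches o v : Set (T.Branch v)) (T.side o v) := by
  intro b hb b' hb' hne
  refine disjoint_left.2 fun e he he' => hne ?_
  exact eq_of_mem_side (mem_downBranches.1 hb) (mem_downBranches.1 hb') he he'

theorem biUnion_side (v : Fin T.numVertices) :
    (T.downBranches o v).biUnion (T.side o v) = T.below o v := by
  ext
  rw [mem_biUnion]
  constructor
  · rintro ⟨b, hb, he⟩
    exact side_subset (mem_downBranches.1 hb) he
  · intro he
    obtain ⟨b, hb, he⟩ := exists_mem_side he
    exact ⟨b, mem_downBranches.2 hb, he⟩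

theorem injOn_side (v : Fin T.numVertices) :
    Set.InjOn (T.side o v) (T.downBranches o v : Set (T.Branch v)) := by
  intro b hb b' hb' h
  obtain ⟨e, he⟩ := T.side_nonempty o b
  exact eq_of_mem_side (mem_downBranches.1 hb) (mem_downBranches.1 hb') he (h ▸ he)

theorem two_le_downBranches (v : Fin T.numVertices) : 2 ≤ #(T.downBranches o v) := by
  have h1 : 3 ≤ Nat.card (T.Branch v) := T.three_le_valency v
  have h2 := card_downBranches (T := T) (o := o) v
  omega

theorem side_ssubset {v : Fin T.numVertices} {b : T.Branch v} (hb : b ≠ T.upBranch o v) :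
    T.side o v b ⊂ T.below o v := by
  refine Finset.ssubset_iff_subset_ne.2 ⟨side_subset hb, fun h => ?_⟩
  obtain ⟨b', hb', hne⟩ := exists_mem_ne (two_le_downBranches (o := o) v) b
  obtain ⟨e, he⟩ := T.side_nonempty o b'
  rw [mem_downBranches] at hb'
  exact hne (eq_of_mem_side hb' hb he (h ▸ side_subset hb' he))

variable (T o)

theorem two_le_card_below (v : Fin T.numVertices) : 2 ≤ #(T.below o v) := by
  rw [← biUnion_side, card_biUnion (pairwiseDisjoint_side v)]
  calc 2 ≤ #(T.downBranches o v) := two_le_downBranches v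
    _ = ∑ b ∈ T.downBranches o v, 1 := card_eq_sum_ones _
    _ ≤ _ := sum_le_sum fun b _ => card_pos.2 (T.side_nonempty o b)

@[simp] theorem below_root : T.below o (T.foot o) = ground o := by
  ext e
  simp [mem_below, mem_ground, T.isAbove_root]

include T in
theorem two_le_card_ground : 2 ≤ #(ground o) := by
  rw [← T.below_root o]
  exact T.two_le_card_below o _

variable {T o}

theorem below_par_ssubset {v : Fin T.numVertices} (hv : v ≠ T.foot o) :
    T.below o v ⊂ T.below o (T.par o v) :=
  side_ssubset (b := .inl ⟨v, T.adj_par hv⟩) (inl_ne_upBranch.2 ⟨hv, rfl⟩)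

theorem IsAbove.below_ssubset {v w : Fin T.numVertices} (h : T.IsAbove v w o) (hne : v ≠ w) :
    T.below o v ⊂ T.below o w := by
  rcases h.eq_or with h | ⟨hv, h⟩
  · exact absurd h hne
  · exact (below_par_ssubset hv).trans_subset (below_subset_of_isAbove h)

theorem total_of_mem_below {v w : Fin T.numVertices} {e : E} (h : e ∈ T.below o v)
    (h' : e ∈ T.below o w) : T.IsAbove v w o ∨ T.IsAbove w v o :=
  (mem_below.1 h).2.total (mem_below.1 h').2

theorem below_subset_iff {v w : Fin T.numVertices} :
    T.below o v ⊆ T.below o w ↔ T.IsAbove v w o := by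
  refine ⟨fun h => ?_, below_subset_of_isAbove⟩
  obtain ⟨e, he⟩ := T.below_nonempty o v
  rcases total_of_mem_below he (h he) with k | k
  · exact k
  · by_cases hne : w = v
    · rw [hne]; exact IsAbove.refl _
    · exact absurd h (k.below_ssubset hne).not_subset

variable (T o) in
theorem below_injective : Function.Injective (T.below o) := fun _ _ h =>
  (below_subset_iff.1 h.subset).antisymm (below_subset_iff.1 h.symm.subset)

theorem below_ssubset_iff {v w : Fin T.numVertices} :
    T.below o v ⊂ T.below o w ↔ v ≠ T.foot o ∧ T.IsAbove (T.par o v) w o := by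
  refine ⟨fun h => ?_, fun h =>
    (below_par_ssubset h.1).trans_subset (below_subset_of_isAbove h.2)⟩
  rcases (below_subset_iff.1 h.subset).eq_or with k | k
  · rw [k] at h
    exact absurd h (ssubset_irrefl _)
  · exact k

theorem mem_splits {A : Finset E} : A ∈ T.splits o ↔ ∃ v, v ≠ T.foot o ∧ T.below o v = A := by
  simp [splits]

variable (T o)

theorem nodes_splits : nodes o (T.splits o) = univ.image (T.below o) := by
  rw [nodes, splits, ← T.below_root o, ← image_insert, insert_erase (mem_univ _)]

theorem below_mem_nodes (v : Fin T.numVertices) : T.below o v ∈ nodes o (T.splits o) := by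
  rw [nodes_splits]
  exact mem_image_of_mem _ (mem_univ _)

theorem isNested_splits : IsNested o (T.splits o) where
  ssubset A hA := by
    obtain ⟨v, hv, rfl⟩ := mem_splits.1 hA
    rw [← T.below_root o]
    exact (T.isAbove_root v).below_ssubset hv
  two_le A hA := by
    obtain ⟨v, hv, rfl⟩ := mem_splits.1 hA
    exact T.two_le_card_below o v
  laminar A hA B hB := by
    obtain ⟨v, hv, rfl⟩ := mem_splits.1 hA
    obtain ⟨w, hw, rfl⟩ := mem_splits.1 hB
    rcases (T.below o v).eq_empty_or_nonempty with h | -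
    · exact Or.inl (h ▸ empty_subset _)
    by_cases h : Disjoint (T.below o v) (T.below o w)
    · exact Or.inr (Or.inr h)
    obtain ⟨e, h1, h2⟩ := not_disjoint_iff.1 h
    rcases total_of_mem_below h1 h2 with k | k
    · exact Or.inl (below_subset_of_isAbove k)
    · exact Or.inr (Or.inl (below_subset_of_isAbove k))

variable {o}

theorem parent_below {v : Fin T.numVertices} (hv : v ≠ T.foot o) :
    parent o (T.splits o) (T.below o v) = T.below o (T.par o v) := by
  refine parent_eq_of (T.below_mem_nodes o _) (below_par_ssubset hv) fun A hA hvA => ?_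
  rw [nodes_splits] at hA
  obtain ⟨w, -, rfl⟩ := mem_image.1 hA
  exact below_subset_of_isAbove (below_ssubset_iff.1 hvA).2

theorem parent_singleton {e : E} (he : e ≠ o) :
    parent o (T.splits o) {e} = T.below o (T.foot e) := by
  refine parent_eq_of (T.below_mem_nodes o _) ?_ fun A hA hvA => ?_
  · refine Finset.ssubset_iff_subset_ne.2
      ⟨singleton_subset_iff.2 (mem_below.2 ⟨he, IsAbove.refl _⟩), fun h => ?_⟩
    have := T.two_le_card_below o (T.foot e)
    rw [← h, card_singleton] at this
    omega
  · rw [nodes_splits] at hA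
    obtain ⟨w, -, rfl⟩ := mem_image.1 hA
    exact below_subset_of_isAbove (mem_below.1 (singleton_subset_iff.1 hvA.subset)).2

/-- The children of a node are the sets of ends beyond the branches at the vertex. -/
theorem children_below (v : Fin T.numVertices) :
    children o (T.splits o) (T.below o v) = (T.downBranches o v).image (T.side o v) := by
  ext A
  rw [mem_children, mem_cells, mem_image]
  constructor
  · rintro ⟨hA | ⟨e, he, rfl⟩, hpar⟩
    · obtain ⟨w, hw, rfl⟩ := mem_splits.1 hA
      rw [T.parent_below hw] at hpar
      have := T.below_injective o hpar
      exact ⟨.inl ⟨w, (T.adj_iff (o := o)).2 (Or.inr ⟨hw, this⟩)⟩,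
        mem_downBranches.2 (inl_ne_upBranch.2 ⟨hw, this⟩), rfl⟩
    · rw [T.parent_singleton he] at hpar
      exact ⟨.inr ⟨e, T.below_injective o hpar⟩, mem_downBranches.2 (inr_ne_upBranch.2 he), rfl⟩
  · rintro ⟨w | e, hb, rfl⟩
    · obtain ⟨h1, h2⟩ := inl_ne_upBranch.1 (mem_downBranches.1 hb)
      refine ⟨Or.inl (mem_splits.2 ⟨w, h1, rfl⟩), ?_⟩
      rw [side, T.parent_below h1, h2]
    · have h1 := inr_ne_upBranch.1 (mem_downBranches.1 hb)
      refine ⟨Or.inr ⟨e, h1, rfl⟩, ?_⟩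
      rw [side, T.parent_singleton h1, e.2]

theorem card_children_below (v : Fin T.numVertices) :
    #(children o (T.splits o) (T.below o v)) + 1 = Nat.card (T.Branch v) := by
  rw [children_below, card_image_of_injOn (injOn_side v), card_downBranches]

variable (o)

/-- A tree is trivalent if and only if its nested family has the maximal number of members. -/
theorem forall_card_branch_eq_three_iff :
    (∀ v, Nat.card (T.Branch v) = 3) ↔ #(T.splits o) + 2 = #(ground o) := by
  rw [← (T.isNested_splits o).card_children_eq_two_iff (T.two_le_card_ground o), nodes_splits,
    forall_mem_image]
  refine forall_congr' fun v => ?_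
  rw [← T.card_children_below (o := o) v]
  simp

end Below

end LabelledTree

end TropicalCount

namespace TropicalCount

/-! ### Trees and nested families -/

section NestedTree

open Finset

variable {E : Type*} [Fintype E] [DecidableEq E] {o : E}

namespace LabelledTree

theorem adj_iff_below (T : LabelledTree E) {v w : Fin T.numVertices} : T.graph.Adj v w ↔
    (T.below o v ≠ ground o ∧ parent o (T.splits o) (T.below o v) = T.below o w) ∨
      (T.below o w ≠ ground o ∧ parent o (T.splits o) (T.below o w) = T.below o v) := by
  have key : ∀ v w : Fin T.numVertices, (v ≠ T.foot o ∧ T.par o v = w) ↔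
      (T.below o v ≠ ground o ∧ parent o (T.splits o) (T.below o v) = T.below o w) := by
    intro v w
    rw [← T.below_root o, (T.below_injective o).ne_iff]
    refine and_congr_right fun hv => ?_
    rw [T.parent_below hv, (T.below_injective o).eq_iff]
  rw [T.adj_iff (o := o), key, key]

/-- Two trees with the same nested family are isomorphic. -/
theorem exists_iso_of_splits_eq {T T' : LabelledTree E} (h : T.splits o = T'.splits o) :
    ∃ σ : T.graph ≃g T'.graph, (∀ v, T'.below o (σ v) = T.below o v) ∧
      ∀ e, σ (T.foot e) = T'.foot e := by
  have hn : univ.image (T.below o) = univ.image (T'.below o) := by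
    rw [← T.nodes_splits, ← T'.nodes_splits, h]
  have h1 : ∀ v, ∃ w, T'.below o w = T.below o v := fun v => by
    simpa using hn.subset (mem_image_of_mem _ (mem_univ v))
  have h2 : ∀ w, ∃ v, T.below o v = T'.below o w := fun w => by
    simpa using hn.symm.subset (mem_image_of_mem _ (mem_univ w))
  choose f hf using h1
  choose g hg using h2
  refine ⟨⟨⟨f, g, fun v => T.below_injective o ?_, fun w => T'.below_injective o ?_⟩, ?_⟩, hf,
    fun e => T'.below_injective o ((hf _).trans ?_)⟩
  · rw [hg, hf]
  · rw [hf, hg]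
  · intro v w
    simp only [Equiv.coe_fn_mk]
    rw [adj_iff_below (o := o), adj_iff_below (o := o), hf, hf, h]
  · by_cases he : e = o
    · rw [he, below_root, below_root]
    · rw [← T.parent_singleton he, ← T'.parent_singleton he, h]

omit [Fintype E] [DecidableEq E] in
theorem par_map {T T' : LabelledTree E} (σ : T.graph ≃g T'.graph)
    (hσ : ∀ e, σ (T.foot e) = T'.foot e) (v : Fin T.numVertices) :
    T'.par o (σ v) = σ (T.par o v) := by
  by_cases hv : v = T.foot o
  · rw [hv, par_root, hσ, par_root]
  have hinv : ∀ w, σ.symm (σ w) = w := σ.symm_apply_apply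
  have key : T.par o v = σ.symm (T'.par o (σ v)) := by
    refine T.par_eq_of_forall (o := o) (f := fun v => σ.symm (T'.par o (σ v))) (fun v w h => ?_) hv
    rcases T'.par_eq_of_adj (o := o) (σ.map_adj_iff.2 h) with ⟨h1, h2⟩ | ⟨h1, h2⟩
    · refine Or.inl ⟨fun h => h1 (by rw [h, hσ]), ?_⟩
      simp only [h2, hinv]
    · refine Or.inr ⟨fun h => h1 (by rw [h, hσ]), ?_⟩
      simp only [h2, hinv]
  rw [key]
  exact (σ.apply_symm_apply _).symm

theorem below_map {T T' : LabelledTree E} (σ : T.graph ≃g T'.graph)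
    (hσ : ∀ e, σ (T.foot e) = T'.foot e) (v : Fin T.numVertices) :
    T'.below o (σ v) = T.below o v := by
  have hit : ∀ k w, (T'.par o)^[k] (σ w) = σ ((T.par o)^[k] w) := fun k w =>
    ((Function.Semiconj.iterate_right (f := σ) (ga := T.par o) (gb := T'.par o)
      (fun w => (par_map σ hσ w).symm) k) w).symm
  ext e
  rw [mem_below, mem_below, IsAbove, IsAbove]
  simp only [← hσ, hit, σ.injective.eq_iff]

theorem splits_eq_of_iso {T T' : LabelledTree E} (σ : T.graph ≃g T'.graph)
    (hσ : ∀ e, σ (T.foot e) = T'.foot e) : T.splits o = T'.splits o := by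
  ext A
  rw [mem_splits, mem_splits]
  constructor
  · rintro ⟨v, hv, rfl⟩
    exact ⟨σ v, fun h => hv (σ.injective (h.trans (hσ o).symm)), below_map σ hσ v⟩
  · rintro ⟨v, hv, rfl⟩
    refine ⟨σ.symm v, fun h => hv ?_, ?_⟩
    · rw [← hσ o, ← h]
      exact (σ.apply_symm_apply v).symm
    · rw [← below_map σ hσ]
      exact congrArg _ (σ.apply_symm_apply v)

end LabelledTree

/-! ### The tree of a nested family -/

/-- The node with the given number. -/
noncomputable def nodeAt (o : E) (F : Finset (Finset E)) (i : Fin #(nodes o F)) : Finset E :=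
  ((nodes o F).equivFin.symm i).1

/-- The number of a node; the junk value for other sets is the number of the root node. -/
noncomputable def nodeIndex (o : E) (F : Finset (Finset E)) (A : Finset E) : Fin #(nodes o F) :=
  (nodes o F).equivFin ⟨if A ∈ nodes o F then A else ground o, by
    split_ifs with h
    · exact h
    · exact mem_insert_self _ _⟩

variable {F : Finset (Finset E)}

theorem nodeAt_mem (i : Fin #(nodes o F)) : nodeAt o F i ∈ nodes o F :=
  ((nodes o F).equivFin.symm i).2

theorem nodeAt_nodeIndex {A : Finset E} (hA : A ∈ nodes o F) :
    nodeAt o F (nodeIndex o F A) = A := by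
  simp [nodeAt, nodeIndex, hA]

theorem nodeAt_injective : Function.Injective (nodeAt o F) := fun _ _ h =>
  (nodes o F).equivFin.symm.injective (Subtype.ext h)

theorem nodeIndex_nodeAt (i : Fin #(nodes o F)) : nodeIndex o F (nodeAt o F i) = i :=
  nodeAt_injective (nodeAt_nodeIndex (nodeAt_mem i))

theorem ground_mem_nodes : ground o ∈ nodes o F := mem_insert_self _ _

/-- The tree of a nested family: every node other than the root node is joined to its parent. -/
def nestedGraph (o : E) (F : Finset (Finset E)) : SimpleGraph (Fin #(nodes o F)) :=
  SimpleGraph.fromRel fun i j =>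
    nodeAt o F i ≠ ground o ∧ parent o F (nodeAt o F i) = nodeAt o F j

namespace IsNested

variable (h : IsNested o F) (hE : 2 ≤ #(ground o))
include h hE

theorem parent_node {A : Finset E} (hA : A ∈ nodes o F) (hAg : A ≠ ground o) :
    parent o F A ∈ nodes o F ∧ A ⊂ parent o F A :=
  ⟨(h.parent_cell hE (mem_cells.2 (Or.inl ((mem_nodes.1 hA).resolve_left hAg)))).1,
    (h.parent_cell hE (mem_cells.2 (Or.inl ((mem_nodes.1 hA).resolve_left hAg)))).2.1⟩

theorem nestedGraph_adj {i j : Fin #(nodes o F)} : (nestedGraph o F).Adj i j ↔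
    (nodeAt o F i ≠ ground o ∧ parent o F (nodeAt o F i) = nodeAt o F j) ∨
      (nodeAt o F j ≠ ground o ∧ parent o F (nodeAt o F j) = nodeAt o F i) := by
  rw [nestedGraph, SimpleGraph.fromRel_adj, and_iff_right_of_imp]
  rintro (⟨h1, h2⟩ | ⟨h1, h2⟩) rfl <;>
  · have := (h.parent_node hE (nodeAt_mem _) h1).2
    rw [h2] at this
    exact ssubset_irrefl _ this

theorem nestedGraph_isTree : (nestedGraph o F).IsTree := by
  have hreach : ∀ i, (nestedGraph o F).Reachable i (nodeIndex o F (ground o)) := by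
    intro i
    induction hd : Fintype.card E - #(nodeAt o F i) using Nat.strong_induction_on
      generalizing i with
    | _ d ih =>
      by_cases hi : nodeAt o F i = ground o
      · rw [← hi, nodeIndex_nodeAt]
      obtain ⟨h1, h2⟩ := h.parent_node hE (nodeAt_mem i) hi
      have h3 := nodeAt_nodeIndex h1
      have hadj : (nestedGraph o F).Adj i (nodeIndex o F (parent o F (nodeAt o F i))) :=
        (h.nestedGraph_adj hE).2 (Or.inl ⟨hi, h3.symm⟩)
      refine hadj.reachable.trans (ih _ ?_ _ rfl)
      have h4 := card_lt_card h2
      have h5 := card_le_univ (parent o F (nodeAt o F i))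
      rw [h3]
      omega
  have hconn : (nestedGraph o F).Connected :=
    { preconnected := fun i j => (hreach i).trans (hreach j).symm
      nonempty := ⟨nodeIndex o F (ground o)⟩ }
  classical
  refine SimpleGraph.isTree_iff_connected_and_card.2
    ⟨hconn, le_antisymm ?_ hconn.card_vert_le_card_edgeSet_add_one⟩
  have hle : (nestedGraph o F).edgeFinset ⊆
      (univ.erase (nodeIndex o F (ground o))).image
        fun i => s(i, nodeIndex o F (parent o F (nodeAt o F i))) := by
    intro γ hγ
    induction γ with
    | _ i j =>
      rw [SimpleGraph.mem_edgeFinset, SimpleGraph.mem_edgeSet, h.nestedGraph_adj hE] at hγ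
      have key : ∀ i j : Fin #(nodes o F), nodeAt o F i ≠ ground o →
          parent o F (nodeAt o F i) = nodeAt o F j →
          s(i, j) ∈ (univ.erase (nodeIndex o F (ground o))).image
            fun i => s(i, nodeIndex o F (parent o F (nodeAt o F i))) := by
        intro i j h1 h2
        refine mem_image.2 ⟨i, mem_erase.2 ⟨fun h3 => h1 ?_, mem_univ _⟩, ?_⟩
        · rw [h3, nodeAt_nodeIndex ground_mem_nodes]
        · rw [h2, nodeIndex_nodeAt]
      rcases hγ with ⟨h1, h2⟩ | ⟨h1, h2⟩
      · exact key i j h1 h2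
      · rw [Sym2.eq_swap]
        exact key j i h1 h2
  have h1 := (card_le_card hle).trans card_image_le
  have h2 := card_erase_add_one (mem_univ (nodeIndex o F (ground o)))
  rw [Nat.card_eq_fintype_card, ← SimpleGraph.edgeFinset_card, Nat.card_eq_fintype_card,
    ← card_univ]
  omega

omit h hE in
/-- The vertex to which the end `e` is attached in the tree of a nested family. -/
noncomputable def footIndex (o : E) (F : Finset (Finset E)) (e : E) : Fin #(nodes o F) :=
  if e = o then nodeIndex o F (ground o) else nodeIndex o F (parent o F {e})

theorem parent_singleton_mem {e : E} (he : e ≠ o) :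
    parent o F {e} ∈ nodes o F ∧ {e} ⊂ parent o F {e} :=
  ⟨(h.parent_cell hE (mem_cells.2 (Or.inr ⟨e, he, rfl⟩))).1,
    (h.parent_cell hE (mem_cells.2 (Or.inr ⟨e, he, rfl⟩))).2.1⟩

theorem three_le_card_branch (i : Fin #(nodes o F)) :
    3 ≤ Nat.card ({j // (nestedGraph o F).Adj i j} ⊕ {e // footIndex o F e = i}) := by
  classical
  let g : {j // (nestedGraph o F).Adj i j} ⊕ {e // footIndex o F e = i} → Finset E :=
    Sum.elim (fun j => nodeAt o F j.1) fun e => {e.1}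
  have hch : children o F (nodeAt o F i) ⊆ univ.image g := by
    intro X hX
    obtain ⟨hc, hp⟩ := mem_children.1 hX
    rcases mem_cells.1 hc with hXF | ⟨e, he, rfl⟩
    · have h1 := nodeAt_nodeIndex (mem_nodes.2 (Or.inr hXF) : X ∈ nodes o F)
      refine mem_image.2 ⟨.inl ⟨nodeIndex o F X, (h.nestedGraph_adj hE).2 (Or.inr ?_)⟩,
        mem_univ _, h1⟩
      rw [h1]
      exact ⟨(h.ssubset X hXF).ne, hp⟩
    · refine mem_image.2 ⟨.inr ⟨e, ?_⟩, mem_univ _, rfl⟩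
      rw [footIndex, if_neg he, hp, nodeIndex_nodeAt]
  have hup : ∃ Z ∈ univ.image g, Z ∉ children o F (nodeAt o F i) := by
    by_cases hi : nodeAt o F i = ground o
    · refine ⟨{o}, mem_image.2 ⟨.inr ⟨o, ?_⟩, mem_univ _, rfl⟩, fun hZ => ?_⟩
      · rw [footIndex, if_pos rfl, ← hi, nodeIndex_nodeAt]
      · have := (h.ssubset_of_mem_children hE hZ).subset (mem_singleton_self o)
        rw [hi] at this
        exact mem_ground.1 this rfl
    · obtain ⟨h1, h2⟩ := h.parent_node hE (nodeAt_mem i) hi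
      have h3 := nodeAt_nodeIndex h1
      refine ⟨parent o F (nodeAt o F i),
        mem_image.2 ⟨.inl ⟨nodeIndex o F (parent o F (nodeAt o F i)),
          (h.nestedGraph_adj hE).2 (Or.inl ⟨hi, h3.symm⟩)⟩, mem_univ _, h3⟩, fun hZ => ?_⟩
      exact h2.not_subset (h.ssubset_of_mem_children hE hZ).subset
  obtain ⟨Z, hZ, hZc⟩ := hup
  have h1 := h.two_le_card_children hE (nodeAt_mem i)
  have h2 := card_le_card (insert_subset hZ hch)
  rw [card_insert_of_notMem hZc] at h2
  have h3 := h2.trans card_image_le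
  rw [card_univ, ← Nat.card_eq_fintype_card] at h3
  omega

omit hE in
/-- The tree of a nested family. -/
noncomputable def tree (hE : 2 ≤ #(ground o)) : LabelledTree E where
  numVertices := #(nodes o F)
  graph := nestedGraph o F
  isTree := h.nestedGraph_isTree hE
  foot := footIndex o F
  three_le_valency := h.three_le_card_branch hE

theorem nodeAt_foot {e : E} (he : e ≠ o) :
    nodeAt o F ((h.tree hE).foot e) = parent o F {e} := by
  change nodeAt o F (footIndex o F e) = _
  rw [footIndex, if_neg he, nodeAt_nodeIndex (h.parent_singleton_mem hE he).1]

theorem nodeAt_foot_root : nodeAt o F ((h.tree hE).foot o) = ground o := by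
  change nodeAt o F (footIndex o F o) = _
  rw [footIndex, if_pos rfl, nodeAt_nodeIndex ground_mem_nodes]

theorem tree_par {i : Fin (h.tree hE).numVertices} (hi : i ≠ (h.tree hE).foot o) :
    nodeAt o F ((h.tree hE).par o i) = parent o F (nodeAt o F i) := by
  have hroot : ∀ j : Fin (h.tree hE).numVertices, nodeAt o F j ≠ ground o ↔
      j ≠ (h.tree hE).foot o := fun j => by
    rw [← h.nodeAt_foot_root hE]
    exact nodeAt_injective.ne_iff
  rw [LabelledTree.par_eq_of_forall (f := fun i => nodeIndex o F (parent o F (nodeAt o F i)))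
    _ _ hi]
  · exact nodeAt_nodeIndex (h.parent_node hE (nodeAt_mem i) ((hroot i).2 hi)).1
  · intro v w hvw
    rcases (h.nestedGraph_adj hE).1 hvw with ⟨h1, h2⟩ | ⟨h1, h2⟩
    · exact Or.inl ⟨(hroot v).1 h1, by simp only [h2]; exact nodeIndex_nodeAt w⟩
    · exact Or.inr ⟨(hroot w).1 h1, by simp only [h2]; exact nodeIndex_nodeAt v⟩

theorem tree_below (i : Fin (h.tree hE).numVertices) :
    (h.tree hE).below o i = nodeAt o F i := by
  have hroot : ∀ j : Fin (h.tree hE).numVertices, nodeAt o F j = ground o ↔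
      j = (h.tree hE).foot o := fun j => by
    rw [← h.nodeAt_foot_root hE]
    exact nodeAt_injective.eq_iff
  ext e
  rw [LabelledTree.mem_below]
  constructor
  · rintro ⟨he, k, rfl⟩
    induction k with
    | zero =>
      change e ∈ nodeAt o F ((h.tree hE).foot e)
      rw [h.nodeAt_foot hE he]
      exact (h.parent_singleton_mem hE he).2.subset (mem_singleton_self e)
    | succ k ih =>
      rw [Function.iterate_succ_apply']
      by_cases hj : ((h.tree hE).par o)^[k] ((h.tree hE).foot e) = (h.tree hE).foot o
      · rw [hj, LabelledTree.par_root, ← hj]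
        exact ih
      · rw [h.tree_par hE hj]
        exact (h.parent_node hE (nodeAt_mem _) (fun h' => hj ((hroot _).1 h'))).2.subset ih
  · intro he
    have heo : e ≠ o := mem_ground.1 (h.node_subset (nodeAt_mem i) he)
    refine ⟨heo, ?_⟩
    induction hd : #(nodeAt o F i) using Nat.strong_induction_on generalizing i with
    | _ d ih =>
      obtain ⟨X, hX, heX⟩ := h.exists_mem_children hE (nodeAt_mem i) he
      obtain ⟨hc, hp⟩ := mem_children.1 hX
      rcases mem_cells.1 hc with hXF | ⟨e', he', rfl⟩
      · have h1 := nodeAt_nodeIndex (mem_nodes.2 (Or.inr hXF) : X ∈ nodes o F)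
        have h2 : nodeIndex o F X ≠ (h.tree hE).foot o := fun h3 => by
          have h4 := (hroot _).2 h3
          rw [h1] at h4
          exact (h.ssubset X hXF).ne h4
        have h3 : (h.tree hE).par o (nodeIndex o F X) = i := nodeAt_injective (by
          rw [h.tree_par hE h2, h1, hp])
        have h4 := ih _ (by
          rw [← hd]
          exact card_lt_card (h1.symm ▸ h.ssubset_of_mem_children hE hX)) (nodeIndex o F X)
          (by rw [h1]; exact heX) rfl
        rw [← h3]
        exact h4.trans (LabelledTree.isAbove_par _)
      · obtain rfl := mem_singleton.1 heX
        have : (h.tree hE).foot e = i := nodeAt_injective (by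
          rw [h.nodeAt_foot hE heo, hp])
        rw [this]
        exact LabelledTree.IsAbove.refl _

/-- Every nested family is the family of the bounded edges of a tree. -/
theorem tree_splits : (h.tree hE).splits o = F := by
  ext A
  rw [LabelledTree.mem_splits]
  constructor
  · rintro ⟨v, hv, rfl⟩
    rw [h.tree_below hE]
    refine (mem_nodes.1 (nodeAt_mem v)).resolve_left fun h' => hv ?_
    rw [← h.nodeAt_foot_root hE] at h'
    exact nodeAt_injective h'
  · intro hA
    have h1 := nodeAt_nodeIndex (mem_nodes.2 (Or.inr hA) : A ∈ nodes o F)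
    refine ⟨nodeIndex o F A, fun h2 => ?_, ?_⟩
    · rw [h2, h.nodeAt_foot_root hE] at h1
      exact (h.ssubset A hA).ne h1.symm
    · exact (h.tree_below hE _).trans h1

end IsNested

end NestedTree

end TropicalCount

namespace TropicalCount

/-! ### Slopes, lengths and positions -/

section Slopes

open Finset

variable {E N : Type*} [Fintype E] [DecidableEq E] [AddCommGroup N] {n : E → N} {o : E}

omit [Fintype E] [DecidableEq E] in
theorem LabelledTree.not_par_par (T : LabelledTree E) {v w : Fin T.numVertices}
    (hv : v ≠ T.foot o) (h : T.par o v = w) (hw : w ≠ T.foot o) : T.par o w ≠ v := fun h' => by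
  have h1 := T.depth_par hv
  have h2 := T.depth_par hw
  rw [h] at h1
  rw [h'] at h2
  omega

theorem LabelledTree.sum_degSum_side (T : LabelledTree E) (n : E → N) (v : Fin T.numVertices) :
    ∑ b ∈ T.downBranches o v, degSum n (T.side o v b) = degSum n (T.below o v) := by
  rw [← T.biUnion_side, degSum, sum_biUnion (T.pairwiseDisjoint_side v)]
  rfl

theorem LabelledTree.sum_branch (T : LabelledTree E) (v : Fin T.numVertices) (f : T.Branch v → N) :
    ∑ᶠ b, f b = f (T.upBranch o v) + ∑ b ∈ T.downBranches o v, f b := by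
  classical
  rw [finsum_eq_sum_of_fintype, LabelledTree.downBranches]
  exact (add_sum_erase _ _ (mem_univ _)).symm

namespace CombType

theorem slope_eq_degSum (C : CombType n) {v w : Fin C.numVertices} (h : C.graph.Adj v w)
    (hw : w ≠ C.foot o) (hwv : C.par o w = v) :
    C.slope ⟨(v, w), h⟩ = degSum n (C.below o w) := by
  refine LabelledTree.leaf_induction (o := o) (P := fun w => w ≠ C.foot o → ∀ v
    (h : C.graph.Adj v w), C.par o w = v → C.slope ⟨(v, w), h⟩ = degSum n (C.below o w))
    (fun w ih hw v h hwv => ?_) w hw v h hwv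
  have hbal : ∑ᶠ b, C.out w b = 0 := C.balanced w
  rw [C.toLabelledTree.sum_branch (o := o)] at hbal
  have hdown : ∑ b ∈ C.downBranches o w, C.out w b = degSum n (C.below o w) := by
    rw [← C.toLabelledTree.sum_degSum_side]
    refine sum_congr rfl fun b hb => ?_
    rw [LabelledTree.mem_downBranches] at hb
    rcases b with u | e
    · obtain ⟨h1, h2⟩ := LabelledTree.inl_ne_upBranch.1 hb
      exact ih _ h1 h2 h1 _ u.2 h2
    · exact (degSum_singleton n e.1).symm
  have hup : C.out w (C.upBranch o w) = C.slope ⟨(w, v), h.symm⟩ := by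
    subst hwv
    rw [LabelledTree.upBranch, dif_neg hw]
    rfl
  have hs := C.slope_symm ⟨(v, w), h⟩
  rw [hup, hdown] at hbal
  rw [show (⟨(v, w), h⟩ : C.graph.Dart).symm = ⟨(w, v), h.symm⟩ from rfl] at hs
  rw [hs] at hbal
  exact (neg_add_eq_zero.1 hbal)

theorem slope_eq_neg_degSum (C : CombType n) {v w : Fin C.numVertices} (h : C.graph.Adj v w)
    (hv : v ≠ C.foot o) (hvw : C.par o v = w) :
    C.slope ⟨(v, w), h⟩ = -degSum n (C.below o v) := by
  rw [← C.slope_eq_degSum h.symm hv hvw]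
  exact C.slope_symm ⟨(w, v), h.symm⟩

/-- The slope of a branch is determined by the ends beyond it. -/
theorem out_eq_degSum_side (C : CombType n) {v : Fin C.numVertices} {b : C.Branch v}
    (hb : b ≠ C.upBranch o v) : C.out v b = degSum n (C.side o v b) := by
  rcases b with u | e
  · obtain ⟨h1, h2⟩ := LabelledTree.inl_ne_upBranch.1 hb
    exact C.slope_eq_degSum u.2 h1 h2
  · exact (degSum_singleton n e.1).symm

theorem out_upBranch (C : CombType n) (v : Fin C.numVertices) :
    C.out v (C.upBranch o v) = -degSum n (C.below o v) := by
  have hbal : ∑ᶠ b, C.out v b = 0 := C.balanced v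
  rw [C.toLabelledTree.sum_branch (o := o), sum_congr rfl fun b hb =>
    C.out_eq_degSum_side (LabelledTree.mem_downBranches.1 hb), LabelledTree.sum_degSum_side] at hbal
  exact eq_neg_of_add_eq_zero_left hbal

end CombType

open scoped Classical in
/-- The slope of the edge from `v` to `w`. -/
noncomputable def LabelledTree.edgeSlope (T : LabelledTree E) (o : E) (n : E → N)
    (v w : Fin T.numVertices) : N :=
  if w ≠ T.foot o ∧ T.par o w = v then degSum n (T.below o w) else -degSum n (T.below o v)

theorem LabelledTree.edgeSlope_eq {T : LabelledTree E} {v w : Fin T.numVertices}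
    (hw : w ≠ T.foot o) (hwv : T.par o w = v) : T.edgeSlope o n v w = degSum n (T.below o w) :=
  if_pos ⟨hw, hwv⟩

theorem LabelledTree.edgeSlope_eq_neg {T : LabelledTree E} {v w : Fin T.numVertices}
    (hv : v ≠ T.foot o) (hvw : T.par o v = w) : T.edgeSlope o n v w = -degSum n (T.below o v) :=
  if_neg fun k => T.not_par_par hv hvw k.1 k.2

/-- The combinatorial type with the given tree. -/
noncomputable def LabelledTree.toCombType (T : LabelledTree E) (o : E) (n : E → N)
    (hsum : ∑ e, n e = 0) : CombType n where
  toLabelledTree := T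
  slope d := T.edgeSlope o n d.fst d.snd
  slope_symm := by
    rintro ⟨⟨v, w⟩, h⟩
    change T.edgeSlope o n w v = -T.edgeSlope o n v w
    rcases T.par_eq_of_adj (o := o) h with ⟨h1, h2⟩ | ⟨h1, h2⟩
    · rw [edgeSlope_eq h1 h2, edgeSlope_eq_neg h1 h2, neg_neg]
    · rw [edgeSlope_eq h1 h2, edgeSlope_eq_neg h1 h2]
  balanced v := by
    have hdown : ∀ b ∈ T.downBranches o v,
        T.outSlope n (fun d => T.edgeSlope o n d.fst d.snd) v b = degSum n (T.side o v b) := by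
      intro b hb
      rw [mem_downBranches] at hb
      rcases b with u | e
      · obtain ⟨h1, h2⟩ := inl_ne_upBranch.1 hb
        exact edgeSlope_eq h1 h2
      · exact (degSum_singleton n e.1).symm
    rw [T.sum_branch (o := o), sum_congr rfl hdown, T.sum_degSum_side, upBranch]
    split_ifs with hv
    · subst hv
      rw [T.below_root]
      exact (add_sum_erase _ n (mem_univ o)).trans hsum
    · exact (congrArg (· + _) (edgeSlope_eq_neg hv rfl)).trans (neg_add_cancel _)

theorem CombType.exists_isIso_of_splits_eq {C D : CombType n} (h : C.splits o = D.splits o) :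
    ∃ σ : C.graph ≃g D.graph, CombType.IsIso σ ∧ ∀ v, D.below o (σ v) = C.below o v := by
  obtain ⟨σ, h1, h2⟩ := LabelledTree.exists_iso_of_splits_eq h
  refine ⟨σ, ⟨h2, ?_⟩, h1⟩
  rintro ⟨⟨v, w⟩, hvw⟩
  have hne : ∀ v, v ≠ C.foot o → σ v ≠ D.foot o := fun v hv k =>
    hv (σ.injective (k.trans (h2 o).symm))
  change D.slope ⟨(σ v, σ w), _⟩ = _
  rcases C.par_eq_of_adj (o := o) hvw with ⟨k1, k2⟩ | ⟨k1, k2⟩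
  · rw [C.slope_eq_neg_degSum hvw k1 k2, D.slope_eq_neg_degSum (o := o) _ (hne v k1), h1]
    rw [LabelledTree.par_map σ h2, k2]
  · rw [C.slope_eq_degSum hvw k1 k2, D.slope_eq_degSum (o := o) _ (hne w k1), h1]
    rw [LabelledTree.par_map σ h2, k2]

end Slopes

section Realization

open Finset

variable {E : Type*} [Fintype E] [DecidableEq E] {o : E}

namespace LabelledTree

variable (T : LabelledTree E) (o)

/-- The set of ends beyond a bounded edge. -/
noncomputable def edgeCell (γ : T.graph.edgeSet) : Finset E :=
  Sym2.lift ⟨fun v w => T.below o v ∩ T.below o w, fun _ _ => inter_comm _ _⟩ γ.1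

variable {o}

theorem edgeCell_eq {v w : Fin T.numVertices} (h : T.graph.Adj v w) (hw : w ≠ T.foot o)
    (hwv : T.par o w = v) : T.edgeCell o ⟨s(v, w), h⟩ = T.below o w := by
  subst hwv
  exact inter_eq_right.2 (T.below_par_ssubset hw).subset

theorem edgeCell_eq' {v w : Fin T.numVertices} (h : T.graph.Adj v w) (hv : v ≠ T.foot o)
    (hvw : T.par o v = w) : T.edgeCell o ⟨s(v, w), h⟩ = T.below o v := by
  subst hvw
  exact inter_eq_left.2 (T.below_par_ssubset hv).subset

omit [Fintype E] [DecidableEq E] in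
theorem exists_edge_eq (γ : T.graph.edgeSet) : ∃ v, ∃ hv : v ≠ T.foot o,
    γ = ⟨s(T.par o v, v), T.adj_par hv⟩ := by
  obtain ⟨γ, hγ⟩ := γ
  induction γ with
  | _ v w =>
    rcases T.par_eq_of_adj (o := o) hγ with ⟨h1, h2⟩ | ⟨h1, h2⟩
    · refine ⟨v, h1, Subtype.ext ?_⟩
      change s(v, w) = s(T.par o v, v)
      rw [show T.par o v = w from h2, Sym2.eq_swap]
    · refine ⟨w, h1, Subtype.ext ?_⟩
      change s(v, w) = s(T.par o w, w)
      rw [show T.par o w = v from h2]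

variable (o) in
theorem edgeCell_injective : Function.Injective (T.edgeCell o) := by
  intro γ γ' h
  obtain ⟨v, hv, rfl⟩ := T.exists_edge_eq (o := o) γ
  obtain ⟨w, hw, rfl⟩ := T.exists_edge_eq (o := o) γ'
  rw [T.edgeCell_eq _ hv rfl, T.edgeCell_eq _ hw rfl] at h
  obtain rfl := T.below_injective o h
  rfl

theorem range_edgeCell : Set.range (T.edgeCell o) = T.splits o := by
  ext A
  rw [mem_coe, mem_splits]
  constructor
  · rintro ⟨γ, rfl⟩
    obtain ⟨v, hv, rfl⟩ := T.exists_edge_eq (o := o) γ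
    exact ⟨v, hv, (T.edgeCell_eq _ hv rfl).symm⟩
  · rintro ⟨v, hv, rfl⟩
    exact ⟨⟨s(T.par o v, v), T.adj_par hv⟩, T.edgeCell_eq _ hv rfl⟩

theorem edgeCell_mem (γ : T.graph.edgeSet) : T.edgeCell o γ ∈ T.splits o := by
  rw [← mem_coe, ← T.range_edgeCell]
  exact ⟨γ, rfl⟩

variable (o) in
theorem card_edgeSet : Nat.card T.graph.edgeSet = #(T.splits o) := by
  rw [← Nat.card_range_of_injective (T.edgeCell_injective o), T.range_edgeCell]
  simp

theorem filter_below_root : (T.splits o).filter (T.below o (T.foot o) ⊆ ·) = ∅ := by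
  refine filter_eq_empty_iff.2 fun A hA h => ?_
  rw [T.below_root] at h
  exact ((T.isNested_splits o).ssubset A hA).not_subset h

theorem filter_below_par {v : Fin T.numVertices} (hv : v ≠ T.foot o) :
    (T.splits o).filter (T.below o v ⊆ ·) =
      insert (T.below o v) ((T.splits o).filter (T.below o (T.par o v) ⊆ ·)) := by
  ext A
  rw [mem_insert, mem_filter, mem_filter]
  constructor
  · rintro ⟨hA, h⟩
    refine or_iff_not_imp_left.2 fun hne => ⟨hA, ?_⟩
    obtain ⟨w, hw, rfl⟩ := mem_splits.1 hA
    exact below_subset_of_isAbove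
      (below_ssubset_iff.1 (Finset.ssubset_iff_subset_ne.2 ⟨h, Ne.symm hne⟩)).2
  · rintro (rfl | ⟨hA, h⟩)
    · exact ⟨mem_splits.2 ⟨v, hv, rfl⟩, Subset.rfl⟩
    · exact ⟨hA, (T.below_par_ssubset hv).subset.trans h⟩

theorem below_foot_subset_iff {A : Finset E} (hA : A ∈ T.splits o) {e : E} :
    T.below o (T.foot e) ⊆ A ↔ e ∈ A := by
  obtain ⟨w, hw, rfl⟩ := mem_splits.1 hA
  by_cases he : e = o
  · subst he
    rw [T.below_root, mem_below]
    exact ⟨fun h => absurd h ((T.isNested_splits e).ssubset _ hA).not_subset,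
      fun h => absurd rfl h.1⟩
  · rw [below_subset_iff, mem_below]
    exact ⟨fun h => ⟨he, h⟩, fun h => h.2⟩

end LabelledTree

variable {N : Type*} [AddCommGroup N] {n : E → N} {R M : Type*} [CommRing R] [AddCommGroup M]
  [Module R M] (ψ : N →+ M)

/-- Lengths of the edges and positions of the vertices, with values in a module over any ring, which
are compatible with the slopes. -/
def CombType.IsRealization (C : CombType n) (len : C.graph.edgeSet → R)
    (pos : Fin C.numVertices → M) : Prop :=
  ∀ d : C.graph.Dart, pos d.snd - pos d.fst = len ⟨d.edge, d.edge_mem⟩ • ψ (C.slope d)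

variable {ψ} {C : CombType n}

theorem CombType.isRealization_iff {f : Finset E → R} {pos : Fin C.numVertices → M} :
    C.IsRealization ψ (f ∘ C.edgeCell o) pos ↔ ∀ v, pos v = pos (C.foot o) +
      ∑ A ∈ (C.splits o).filter (C.below o v ⊆ ·), f A • ψ (degSum n A) := by
  have hstep : ∀ v, v ≠ C.foot o →
      ∑ A ∈ (C.splits o).filter (C.below o v ⊆ ·), f A • ψ (degSum n A) =
        f (C.below o v) • ψ (degSum n (C.below o v)) +
          ∑ A ∈ (C.splits o).filter (C.below o (C.par o v) ⊆ ·), f A • ψ (degSum n A) := by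
    intro v hv
    rw [C.filter_below_par hv, sum_insert fun h =>
      (C.below_par_ssubset hv).not_subset (mem_filter.1 h).2]
  constructor
  · intro h v
    refine LabelledTree.root_induction (o := o) (P := fun v => pos v = pos (C.foot o) +
      ∑ A ∈ (C.splits o).filter (C.below o v ⊆ ·), f A • ψ (degSum n A)) ?_ (fun v hv ih => ?_) v
    · rw [C.filter_below_root, sum_empty, add_zero]
    · have h1 : pos v - pos (C.par o v) = f (C.edgeCell o ⟨s(C.par o v, v), C.adj_par hv⟩) •
          ψ (C.slope ⟨(C.par o v, v), C.adj_par hv⟩) := h ⟨(C.par o v, v), C.adj_par hv⟩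
      rw [C.edgeCell_eq _ hv rfl, C.slope_eq_degSum _ hv rfl] at h1
      rw [hstep v hv, add_left_comm, ← ih, ← h1, sub_add_cancel]
  · rintro h ⟨⟨v, w⟩, hvw⟩
    change pos w - pos v = f (C.edgeCell o ⟨s(v, w), hvw⟩) • ψ (C.slope ⟨(v, w), hvw⟩)
    rcases C.par_eq_of_adj (o := o) hvw with ⟨h1, h2⟩ | ⟨h1, h2⟩
    · rw [C.edgeCell_eq' _ h1 h2, C.slope_eq_neg_degSum _ h1 h2, h v, h w, hstep v h1, h2, map_neg,
        smul_neg]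
      abel
    · rw [C.edgeCell_eq _ h1 h2, C.slope_eq_degSum _ h1 h2, h v, h w, hstep w h1, h2]
      abel

/-- The positions of the ends. -/
theorem CombType.IsRealization.pos_foot {f : Finset E → R} {pos : Fin C.numVertices → M}
    (h : C.IsRealization ψ (f ∘ C.edgeCell o) pos) (e : E) : pos (C.foot e) = pos (C.foot o) +
      ∑ A ∈ C.splits o, f A • ψ (rayVector n A e) := by
  rw [CombType.isRealization_iff.1 h, sum_filter]
  congr 1
  refine sum_congr rfl fun A hA => ?_
  simp only [C.below_foot_subset_iff hA, rayVector]
  split_ifs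
  · rfl
  · rw [map_zero, smul_zero]

theorem CombType.exists_isRealization (C : CombType n) (ψ : N →+ M) (o : E) (f : Finset E → R)
    (x : M) : ∃ pos, C.IsRealization ψ (f ∘ C.edgeCell o) pos ∧ pos (C.foot o) = x := by
  refine ⟨fun v => x + ∑ A ∈ (C.splits o).filter (C.below o v ⊆ ·), f A • ψ (degSum n A),
    CombType.isRealization_iff.2 fun v => ?_, ?_⟩ <;>
  · simp only [C.filter_below_root, sum_empty, add_zero]

variable (o) in
/-- Every function on the edges is a function of the sets of ends beyond the edges. -/
theorem LabelledTree.exists_comp_edgeCell {R : Type*} [Zero R] (T : LabelledTree E)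
    (len : T.graph.edgeSet → R) : ∃ f : Finset E → R, f ∘ T.edgeCell o = len :=
  ⟨Function.extend (T.edgeCell o) len 0, Function.extend_comp (T.edgeCell_injective o) _ _⟩

end Realization

end TropicalCount

namespace TropicalCount

/-! ### Lattices and determinants -/

section Determinant

/-- The determinant of a map between lattices of the same rank is non-zero if and only if the image
spans the real vector space of the target. -/
theorem absDet_ne_zero_iff {A B : Type*} [AddCommGroup A] [AddCommGroup B] [Module.Free ℤ A]
    [Module.Finite ℤ A] [Module.Free ℤ B] [Module.Finite ℤ B]
    (h : Module.finrank ℤ A = Module.finrank ℤ B) (f : A →ₗ[ℤ] B) :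
    absDet f ≠ 0 ↔ Submodule.span ℝ (Set.range fun x => (1 : ℝ) ⊗ₜ[ℤ] f x) = ⊤ := by
  let a : Module.Basis (Fin (Module.finrank ℤ B)) ℤ A :=
    (Module.finBasis ℤ A).reindex (finCongr h)
  let b := Module.finBasis ℤ B
  let a' := Algebra.TensorProduct.basis ℝ a
  let b' := Algebra.TensorProduct.basis ℝ b
  have hrange : LinearMap.range (f.baseChange ℝ) =
      Submodule.span ℝ (Set.range fun x => (1 : ℝ) ⊗ₜ[ℤ] f x) := by
    refine le_antisymm ?_ (Submodule.span_le.2 ?_)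
    · rintro _ ⟨y, rfl⟩
      induction y with
      | zero => rw [map_zero]; exact zero_mem _
      | add y z hy hz => rw [map_add]; exact add_mem hy hz
      | tmul c x =>
        have : (c : ℝ) ⊗ₜ[ℤ] f x = c • ((1 : ℝ) ⊗ₜ[ℤ] f x) := by
          rw [TensorProduct.smul_tmul', smul_eq_mul, mul_one]
        rw [LinearMap.baseChange_tmul, this]
        exact Submodule.smul_mem _ _ (Submodule.subset_span ⟨x, rfl⟩)
    · rintro _ ⟨x, rfl⟩
      exact ⟨1 ⊗ₜ x, LinearMap.baseChange_tmul _ _ _⟩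
  have hdet : (LinearMap.toMatrix a' b' (f.baseChange ℝ)).det =
      ((LinearMap.toMatrix a b f).det : ℝ) := by
    rw [LinearMap.toMatrix_baseChange]
    exact ((algebraMap ℤ ℝ).map_det _).symm
  have hiff : absDet f ≠ 0 ↔ IsUnit (LinearMap.toMatrix a' b' (f.baseChange ℝ)).det := by
    rw [absDet_eq a b, hdet, isUnit_iff_ne_zero, Ne, Ne, Int.natAbs_eq_zero, Int.cast_eq_zero]
  rw [hiff, ← hrange, LinearMap.range_eq_top]
  have hfin : Module.finrank ℝ (ℝ ⊗[ℤ] A) = Module.finrank ℝ (ℝ ⊗[ℤ] B) := by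
    rw [Module.finrank_baseChange, Module.finrank_baseChange, h]
  constructor
  · intro hu
    exact (LinearEquiv.ofIsUnitDet hu).surjective
  · intro hs
    have hi := (LinearMap.injective_iff_surjective_of_finrank_eq_finrank hfin).2 hs
    exact LinearEquiv.isUnit_det (LinearEquiv.ofBijective (f.baseChange ℝ) ⟨hi, hs⟩) a' b'

end Determinant

section Lattice

open Finset

variable {E N : Type*} [AddCommGroup N] {n : E → N}

theorem ray_mem_coneSpan [DecidableEq E] {B : Type*} [AddCommGroup B] (n : E → N)
    (Φ : (E → N) →ₗ[ℤ] B) {F : Finset (Finset E)} {A : Finset E} (hA : A ∈ F) :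
    (1 : ℝ) ⊗ₜ[ℤ] Φ (rayVector n A) ∈ coneSpan n Φ F :=
  Submodule.subset_span (Or.inl ⟨A, hA, rfl⟩)

theorem const_mem_coneSpan [DecidableEq E] {B : Type*} [AddCommGroup B] (n : E → N)
    (Φ : (E → N) →ₗ[ℤ] B) (F : Finset (Finset E)) (x : N) :
    (1 : ℝ) ⊗ₜ[ℤ] Φ (fun _ => x) ∈ coneSpan n Φ F :=
  Submodule.subset_span (Or.inr ⟨x, rfl⟩)

namespace CombType

/-- The positions of the ends, as a linear map on the lattice of the type. -/
def endPos (C : CombType n) : C.lattice →ₗ[ℤ] E → N :=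
  LinearMap.pi fun e => C.posAt (C.foot e)

variable [Fintype E] [DecidableEq E] (o : E)

omit [Fintype E] [DecidableEq E] in
theorem lattice_isRealization {C : CombType n} (x : C.lattice) :
    C.IsRealization (AddMonoidHom.id N) x.1.1 x.1.2 := x.2

/-- The lattice of a type is `ℤ^(bounded edges) × N`. -/
noncomputable def latticeEquiv (C : CombType n) :
    C.lattice ≃ₗ[ℤ] (C.graph.edgeSet → ℤ) × N :=
  LinearEquiv.ofBijective
    ((LinearMap.fst ℤ _ _ ∘ₗ C.lattice.subtype).prod (C.posAt (C.foot o))) (by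
      constructor
      · intro x y hxy
        obtain ⟨h1, h2⟩ := Prod.ext_iff.1 hxy
        change x.1.1 = y.1.1 at h1
        change x.1.2 (C.foot o) = y.1.2 (C.foot o) at h2
        obtain ⟨f, hf⟩ := C.toLabelledTree.exists_comp_edgeCell o x.1.1
        have hx := lattice_isRealization x
        have hy := lattice_isRealization y
        rw [← hf, isRealization_iff] at hx
        rw [← h1, ← hf, isRealization_iff] at hy
        refine Subtype.ext (Prod.ext h1 (funext fun v => ?_))
        rw [hx v, hy v, h2]
      · rintro ⟨len, x⟩
        obtain ⟨f, rfl⟩ := C.toLabelledTree.exists_comp_edgeCell o len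
        obtain ⟨pos, h1, h2⟩ := C.exists_isRealization (AddMonoidHom.id N) o f x
        exact ⟨⟨(f ∘ C.edgeCell o, pos), h1⟩, Prod.ext rfl h2⟩)

theorem finrank_lattice [Module.Free ℤ N] [Module.Finite ℤ N] (C : CombType n) :
    Module.finrank ℤ C.lattice = #(C.splits o) + Module.finrank ℤ N := by
  classical
  rw [(C.latticeEquiv o).finrank_eq, Module.finrank_prod, Module.finrank_fintype_fun_eq_card,
    ← Nat.card_eq_fintype_card, C.card_edgeSet o]

include o in
theorem free_lattice [Module.Free ℤ N] (C : CombType n) : Module.Free ℤ C.lattice :=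
  Module.Free.of_equiv (C.latticeEquiv o).symm

include o in
theorem finite_lattice [Module.Finite ℤ N] (C : CombType n) : Module.Finite ℤ C.lattice :=
  Module.Finite.equiv (C.latticeEquiv o).symm

variable {o}

/-- The image of the cone of a type under an evaluation map spans the cone span of the nested
family. -/
theorem span_endPos (C : CombType n) {B : Type*} [AddCommGroup B] (Φ : (E → N) →ₗ[ℤ] B) :
    Submodule.span ℝ (Set.range fun x => (1 : ℝ) ⊗ₜ[ℤ] (Φ ∘ₗ C.endPos) x) =
      coneSpan n Φ (C.splits o) := by
  have hpos : ∀ (f : Finset E → ℤ) (x : C.lattice), f ∘ C.edgeCell o = x.1.1 → C.endPos x =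
      (fun _ => x.1.2 (C.foot o)) + ∑ A ∈ C.splits o, f A • rayVector n A := by
    intro f x hf
    have hx := lattice_isRealization x
    rw [← hf] at hx
    funext e
    rw [Pi.add_apply, Finset.sum_apply]
    exact hx.pos_foot e
  apply le_antisymm
  · refine Submodule.span_le.2 ?_
    rintro _ ⟨x, rfl⟩
    obtain ⟨f, hf⟩ := C.toLabelledTree.exists_comp_edgeCell o x.1.1
    simp only [LinearMap.comp_apply, hpos f x hf, map_add, map_sum, map_zsmul,
      TensorProduct.tmul_add, TensorProduct.tmul_sum, TensorProduct.tmul_smul]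
    refine add_mem (const_mem_coneSpan n Φ _ _) (sum_mem fun A hA => ?_)
    exact (coneSpan n Φ (C.splits o)).toAddSubgroup.zsmul_mem (ray_mem_coneSpan n Φ hA) _
  · refine Submodule.span_le.2 ?_
    rintro _ (⟨A, hA, rfl⟩ | ⟨x, rfl⟩)
    · obtain ⟨pos, h1, h2⟩ := C.exists_isRealization (AddMonoidHom.id N) o (Pi.single A (1 : ℤ)) 0
      refine Submodule.subset_span ⟨⟨(Pi.single A (1 : ℤ) ∘ C.edgeCell o, pos), h1⟩, ?_⟩
      simp only [LinearMap.comp_apply]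
      rw [hpos (Pi.single A 1) _ rfl]
      congr 2
      simp only [h2]
      rw [sum_eq_single A (fun B _ hB => by rw [Pi.single_eq_of_ne hB, zero_smul])
        (fun h => absurd hA h), Pi.single_eq_same, one_smul]
      exact zero_add _
    · obtain ⟨pos, h1, h2⟩ := C.exists_isRealization (AddMonoidHom.id N) o (0 : Finset E → ℤ) x
      refine Submodule.subset_span ⟨⟨((0 : Finset E → ℤ) ∘ C.edgeCell o, pos), h1⟩, ?_⟩
      simp only [LinearMap.comp_apply]
      rw [hpos 0 _ rfl]
      congr 2
      simp only [h2, Pi.zero_apply, zero_smul, sum_const_zero, add_zero]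

/-- The determinant of an evaluation map on a cone does not vanish if and only if the image of the
cone spans the target. -/
theorem absDet_endPos_ne_zero_iff [Module.Free ℤ N] [Module.Finite ℤ N] (C : CombType n)
    {B : Type*} [AddCommGroup B] [Module.Free ℤ B] [Module.Finite ℤ B] (Φ : (E → N) →ₗ[ℤ] B)
    (h : #(C.splits o) + Module.finrank ℤ N = Module.finrank ℤ B) :
    absDet (Φ ∘ₗ C.endPos) ≠ 0 ↔ coneSpan n Φ (C.splits o) = ⊤ := by
  have := C.free_lattice o
  have := C.finite_lattice o
  rw [absDet_ne_zero_iff (by rw [C.finrank_lattice o, h]), span_endPos]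

end CombType

/-- The evaluation map of the constraints as a function of the positions of the ends. -/
def constraintMap (L : ∀ e, Submodule ℤ (N ⧸ Submodule.span ℤ {n e})) :
    (E → N) →ₗ[ℤ] ∀ e, ConstraintQuot L e :=
  LinearMap.pi fun e => toQuot L e ∘ₗ LinearMap.proj e

theorem CombType.ev_eq (L : ∀ e, Submodule ℤ (N ⧸ Submodule.span ℤ {n e})) (C : CombType n) :
    C.ev L = constraintMap L ∘ₗ C.endPos := rfl

theorem CombType.momentEv_eq {ι : Type*} {n : ι → N} {p : ℕ} (ω : LinearMap.BilinForm ℤ N)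
    (φ : Fin p → N →ₗ[ℤ] ℤ) (e₀ : ι) (δ : N) (C : CombType (markedDegree n p)) :
    C.momentEv ω φ e₀ δ = momentMap ω φ n e₀ δ ∘ₗ C.endPos := rfl

theorem finrank_momentTarget [Module.Free ℤ N] [Module.Finite ℤ N] {ι : Type*} [Fintype ι]
    [DecidableEq ι] {n : ι → N} {p : ℕ} {e₀ : ι} {δ : N} {ω : LinearMap.BilinForm ℤ N}
    (hω : ω.IsAlt) (hδ : ω (n e₀) δ ≠ 0) :
    Module.finrank ℤ (MomentTarget n p e₀ δ) + 3 =
      Module.finrank ℤ N + Fintype.card ι + p := by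
  have hli : LinearIndependent ℤ ![n e₀, δ] := by
    rw [LinearIndependent.pair_iff]
    intro s t hst
    have h1 := congrArg (ω (n e₀)) hst
    have h2 := congrArg (ω δ) hst
    simp only [map_add, map_zsmul, map_zero, smul_eq_mul] at h1 h2
    rw [hω.self_eq_zero, mul_zero, zero_add, mul_eq_zero] at h1
    rw [hω.self_eq_zero, mul_zero, add_zero, mul_eq_zero, ← hω.neg_eq, neg_eq_zero] at h2
    exact ⟨h2.resolve_right hδ, h1.resolve_right hδ⟩
  have h2 : Module.finrank ℤ (Submodule.span ℤ {n e₀, δ}) = 2 := by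
    have := finrank_span_eq_card hli
    rwa [Matrix.range_cons, Matrix.range_cons, Matrix.range_empty, Set.union_empty,
      Set.singleton_union, Fintype.card_fin] at this
  have h3 := Submodule.finrank_quotient_add_finrank (Submodule.span ℤ {n e₀, δ})
  have h4 : Module.finrank ℤ ((N ⧸ Submodule.span ℤ {n e₀, δ}) ⧸
      Submodule.torsion ℤ (N ⧸ Submodule.span ℤ {n e₀, δ})) =
      Module.finrank ℤ (N ⧸ Submodule.span ℤ {n e₀, δ}) :=
    finrank_quotient_eq_of_le_torsion le_rfl
  have h5 : Fintype.card {e // e ≠ e₀} + 1 = Fintype.card ι := by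
    rw [Fintype.card_subtype_compl, Fintype.card_subtype_eq]
    have : 0 < Fintype.card ι := Fintype.card_pos_iff.2 ⟨e₀⟩
    omega
  rw [Module.finrank_prod, Module.finrank_prod, Module.finrank_fintype_fun_eq_card,
    Module.finrank_fintype_fun_eq_card, h4, Fintype.card_fin]
  omega

end Lattice

end TropicalCount

namespace TropicalCount

/-! ### The refined multiplicity in terms of the nested family -/

section Weight

open Finset

variable {N : Type*} [AddCommGroup N] {ω : LinearMap.BilinForm ℤ N} {K : Submodule ℤ (⋀[ℤ]^2 N)}

/-- The pairs of outgoing slopes at a trivalent vertex agree up to sign, in the sense that both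
`ω(a, b)` and `a ∧ b` do. -/
theorem sign_smul_qDiff_eq {a b x y : N}
    (h : ω a b = ω x y ∧ wedge a b = wedge x y ∨ ω a b = -ω x y ∧ wedge a b = -wedge x y) :
    (SignType.sign (ω a b) : ℤ) • qDiff K a b = (SignType.sign (ω x y) : ℤ) • qDiff K x y := by
  rcases h with ⟨h1, h2⟩ | ⟨h1, h2⟩
  · rw [h1, qDiff_eq, qDiff_eq, h2]
  · rw [h1, qDiff_eq K a, qDiff_eq, h2, neg_neg, Left.sign_neg, SignType.coe_neg, neg_smul,
      ← smul_neg, neg_sub]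

theorem pair_rel_trans {a b c d x y : N}
    (h : ω a b = ω c d ∧ wedge a b = wedge c d ∨ ω a b = -ω c d ∧ wedge a b = -wedge c d)
    (k : ω c d = ω x y ∧ wedge c d = wedge x y ∨ ω c d = -ω x y ∧ wedge c d = -wedge x y) :
    ω a b = ω x y ∧ wedge a b = wedge x y ∨ ω a b = -ω x y ∧ wedge a b = -wedge x y := by
  rcases h with ⟨h1, h2⟩ | ⟨h1, h2⟩ <;> rcases k with ⟨k1, k2⟩ | ⟨k1, k2⟩ <;>
    simp [h1, h2, k1, k2]

theorem pair_rel_swap (hω : ω.IsAlt) (a b : N) :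
    ω b a = ω a b ∧ wedge b a = wedge a b ∨ ω b a = -ω a b ∧ wedge b a = -wedge a b :=
  Or.inr ⟨(hω.neg_eq a b).symm, wedge_swap a b⟩

theorem pair_rel_neg_add (hω : ω.IsAlt) (a b : N) :
    ω a (-(a + b)) = ω a b ∧ wedge a (-(a + b)) = wedge a b ∨
      ω a (-(a + b)) = -ω a b ∧ wedge a (-(a + b)) = -wedge a b := by
  refine Or.inr ⟨?_, ?_⟩
  · rw [map_neg, map_add, hω.self_eq_zero, zero_add]
  · rw [wedge_swap, wedge_neg_left, wedge_add_left, wedge_self, zero_add, wedge_swap a b,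
      neg_neg]

variable {ι : Type*} [Fintype ι] [DecidableEq ι] {p : ℕ} {n : ι → N} {φ : Fin p → N →ₗ[ℤ] ℤ}
  {o : ι ⊕ Fin p} {C : CombType (markedDegree n p)}

theorem degSum_below_eq_add {v : Fin C.numVertices} {x y : C.Branch v} (hxy : x ≠ y)
    (h : C.downBranches o v = {x, y}) : degSum (markedDegree n p) (C.below o v) =
      degSum (markedDegree n p) (C.side o v x) + degSum (markedDegree n p) (C.side o v y) := by
  rw [← C.toLabelledTree.sum_degSum_side, h, sum_pair hxy]

/-- The outgoing slopes of two distinct branches at a trivalent vertex. -/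
theorem pair_rel_out (hω : ω.IsAlt) {v : Fin C.numVertices} {x y : C.Branch v} (hxy : x ≠ y)
    (h : C.downBranches o v = {x, y}) {a b : N} (hab : C.IsOutPair v a b) :
    ω a b = ω (C.out v x) (C.out v y) ∧ wedge a b = wedge (C.out v x) (C.out v y) ∨
      ω a b = -ω (C.out v x) (C.out v y) ∧ wedge a b = -wedge (C.out v x) (C.out v y) := by
  have hall : ∀ z : C.Branch v, z = C.upBranch o v ∨ z = x ∨ z = y := by
    intro z
    by_cases hz : z = C.upBranch o v
    · exact Or.inl hz
    · have := LabelledTree.mem_downBranches.2 hz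
      rw [h, mem_insert, mem_singleton] at this
      exact Or.inr this
  have hx : x ≠ C.upBranch o v := LabelledTree.mem_downBranches.1 (by rw [h]; simp)
  have hy : y ≠ C.upBranch o v := LabelledTree.mem_downBranches.1 (by rw [h]; simp)
  have hup : C.out v (C.upBranch o v) = -(C.out v x + C.out v y) := by
    rw [C.out_upBranch, degSum_below_eq_add hxy h, C.out_eq_degSum_side hx, C.out_eq_degSum_side hy]
  obtain ⟨z, w, hzw, rfl, rfl⟩ := hab
  have hswap := pair_rel_swap (ω := ω) hω (C.out v x) (C.out v y)
  have h1 := pair_rel_neg_add (ω := ω) hω (C.out v x) (C.out v y)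
  have h2 := pair_rel_neg_add (ω := ω) hω (C.out v y) (C.out v x)
  rw [add_comm] at h2
  rcases hall z with rfl | rfl | rfl <;> rcases hall w with rfl | rfl | rfl
  · exact absurd rfl hzw
  · rw [hup]
    exact pair_rel_trans (pair_rel_swap hω _ _) h1
  · rw [hup]
    exact pair_rel_trans (pair_rel_swap hω _ _) (pair_rel_trans h2 hswap)
  · rw [hup]
    exact h1
  · exact absurd rfl hzw
  · exact Or.inl ⟨rfl, rfl⟩
  · rw [hup]
    exact pair_rel_trans h2 hswap
  · exact hswap
  · exact absurd rfl hzw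

/-- The factor of an unmarked vertex. -/
theorem vertexFactor_eq_joinFactor (hω : ω.IsAlt) {v : Fin C.numVertices} {x y : C.Branch v}
    (hxy : x ≠ y) (h : C.downBranches o v = {x, y}) (hx : ¬ IsMark (C.side o v x))
    (hy : ¬ IsMark (C.side o v y)) :
    C.vertexFactor ω K v = joinFactor ω K φ n (C.side o v x) (C.side o v y) := by
  have hx' : x ≠ C.upBranch o v := LabelledTree.mem_downBranches.1 (by rw [h]; simp)
  have hy' : y ≠ C.upBranch o v := LabelledTree.mem_downBranches.1 (by rw [h]; simp)
  rw [joinFactor_of_not_isMark hx hy, ← C.out_eq_degSum_side hx', ← C.out_eq_degSum_side hy',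
    CombType.vertexFactor]
  split_ifs with hs
  · obtain ⟨h1, h2⟩ := hs.choose_spec
    rw [← sign_smul_qDiff_eq (pair_rel_out hω hxy h h1), sign_pos h2]
    exact (one_smul ℤ _).symm
  · have : ω (C.out v x) (C.out v y) = 0 := by
      by_contra hne
      rcases lt_or_gt_of_ne hne with hlt | hlt
      · refine hs ⟨(C.out v y, C.out v x), ⟨y, x, hxy.symm, rfl, rfl⟩, ?_⟩
        change 0 < ω _ _
        rw [← hω.neg_eq]
        exact neg_pos.2 hlt
      · exact hs ⟨(C.out v x, C.out v y), ⟨x, y, hxy, rfl, rfl⟩, hlt⟩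
    rw [this, sign_zero, SignType.coe_zero, zero_smul]

theorem exists_inr_of_isMark {v : Fin C.numVertices} {x : C.Branch v}
    (h : IsMark (C.side o v x)) : ∃ i, ∃ hi : C.foot (.inr i) = v, x = .inr ⟨.inr i, hi⟩ := by
  obtain ⟨i, hi⟩ := h
  rcases x with w | e
  · have := C.two_le_card_below o w.1
    rw [show C.below o w.1 = {.inr i} from hi, card_singleton] at this
    omega
  · have : e.1 = .inr i := singleton_injective hi
    refine ⟨i, this ▸ e.2, ?_⟩
    congr 1
    exact Subtype.ext this

/-- The slope at a marked point on a trivalent vertex is that of the other branch which does not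
lead to the root, up to sign. -/
theorem natAbs_markedSlope (e₀ : ι) {i : Fin p} {y : C.Branch (C.foot (.inr i))}
    (hy : y ≠ .inr ⟨.inr i, rfl⟩)
    (h : C.downBranches (.inl e₀) (C.foot (.inr i)) = {.inr ⟨.inr i, rfl⟩, y}) :
    (φ i (C.markedSlope i)).natAbs =
      (φ i (degSum (markedDegree n p) (C.side (.inl e₀) _ y))).natAbs := by
  have hy' : y ≠ C.upBranch (.inl e₀) _ := LabelledTree.mem_downBranches.1 (by rw [h]; simp)
  have hspec : C.IsSlopeAt i (C.markedSlope i) :=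
    Classical.epsilon_spec (p := C.IsSlopeAt i) ⟨_, y, hy, rfl⟩
  obtain ⟨z, hz, hzs⟩ := hspec
  rw [← hzs]
  by_cases hzu : z = C.upBranch (.inl e₀) _
  · rw [hzu, C.out_upBranch, degSum_below_eq_add hy.symm h, map_neg, Int.natAbs_neg]
    change (φ i (degSum (markedDegree n p) {.inr i} + _)).natAbs = _
    rw [degSum_mark, zero_add]
  · have := LabelledTree.mem_downBranches.2 hzu
    rw [h, mem_insert, mem_singleton] at this
    rw [this.resolve_left hz, C.out_eq_degSum_side hy']

open scoped Classical in
theorem vertexWeight_children_below (hω : ω.IsAlt) (hC : C.IsTrivalent) (e₀ : ι)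
    (v : Fin C.numVertices) :
    vertexWeight ω K φ n (children (.inl e₀) (C.splits (.inl e₀)) (C.below (.inl e₀) v)) =
      ((∏ i with C.foot (.inr i) = v, (φ i (C.markedSlope i)).natAbs : ℕ) :
        AddMonoidAlgebra ℤ ((⋀[ℤ]^2 N) ⧸ K)) *
      if C.IsMarked v then 1 else C.vertexFactor ω K v := by
  have hcard := LabelledTree.card_downBranches (o := (.inl e₀ : ι ⊕ Fin p)) v
  rw [hC v] at hcard
  obtain ⟨x, y, hxy, h⟩ := card_eq_two.1 (Nat.add_right_cancel hcard : _ = 2)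
  have hside : C.side (.inl e₀) v x ≠ C.side (.inl e₀) v y := fun k =>
    hxy (LabelledTree.injOn_side v (by rw [h]; simp) (by rw [h]; simp) k)
  rw [C.children_below, h, image_insert, image_singleton, vertexWeight_pair hω hside]
  have hmark : ∀ (i : Fin p) (hi : C.foot (.inr i) = v),
      (.inr ⟨.inr i, hi⟩ : C.Branch v) = x ∨ (.inr ⟨.inr i, hi⟩ : C.Branch v) = y := fun i hi => by
    have := LabelledTree.mem_downBranches.2
      (LabelledTree.inr_ne_upBranch (o := (.inl e₀ : ι ⊕ Fin p)).2
        (Sum.inr_ne_inl : (.inr i : ι ⊕ Fin p) ≠ .inl e₀) :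
        (.inr ⟨.inr i, hi⟩ : C.Branch v) ≠ C.upBranch (.inl e₀) v)
    rwa [h, mem_insert, mem_singleton] at this
  have key : ∀ x y : C.Branch v, x ≠ y → C.downBranches (.inl e₀) v = {x, y} →
      IsMark (C.side (.inl e₀) v x) → joinFactor ω K φ n (C.side (.inl e₀) v x)
        (C.side (.inl e₀) v y) =
      ((∏ i with C.foot (.inr i) = v, (φ i (C.markedSlope i)).natAbs : ℕ) :
        AddMonoidAlgebra ℤ ((⋀[ℤ]^2 N) ⧸ K)) *
      if C.IsMarked v then 1 else C.vertexFactor ω K v := by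
    intro x y hxy h hx
    obtain ⟨i, rfl, rfl⟩ := exists_inr_of_isMark hx
    rw [if_pos ⟨i, rfl⟩, mul_one]
    change joinFactor ω K φ n {.inr i} _ = _
    rw [joinFactor_mark_left, ← natAbs_markedSlope e₀ hxy.symm h]
    congr 1
    have hmem : i ∈ univ.filter fun j => C.foot (.inr j) = C.foot (.inr i) :=
      mem_filter.2 ⟨mem_univ i, rfl⟩
    by_cases hy : IsMark (C.side (.inl e₀) _ y)
    · -- Two marked points at the vertex: both sides vanish, since the slope there is zero.
      obtain ⟨j, hj, rfl⟩ := exists_inr_of_isMark hy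
      have h0 : (φ i (C.markedSlope i)).natAbs = 0 := by
        rw [natAbs_markedSlope e₀ hxy.symm h]
        change (φ i (degSum (markedDegree n p) {.inr j})).natAbs = 0
        rw [degSum_mark, map_zero, Int.natAbs_zero]
      rw [h0]
      exact (prod_eq_zero (f := fun j => (φ j (C.markedSlope j)).natAbs) hmem h0).symm
    · refine (prod_eq_single_of_mem (f := fun j => (φ j (C.markedSlope j)).natAbs) i hmem
        fun j hj hji => ?_).symm
      exfalso
      have hj' := (mem_filter.1 hj).2
      have := LabelledTree.mem_downBranches.2
        (LabelledTree.inr_ne_upBranch (o := (.inl e₀ : ι ⊕ Fin p)).2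
          (Sum.inr_ne_inl : (.inr j : ι ⊕ Fin p) ≠ .inl e₀) :
          (.inr ⟨.inr j, hj'⟩ : C.Branch (C.foot (.inr i))) ≠ C.upBranch (.inl e₀) _)
      rw [h, mem_insert, mem_singleton] at this
      rcases this with k | k
      · rw [Sum.inr.injEq, Subtype.mk.injEq, Sum.inr.injEq] at k
        exact hji k
      · rw [← k] at hy
        exact hy ⟨j, rfl⟩
  by_cases hx : IsMark (C.side (.inl e₀) v x)
  · exact key x y hxy h hx
  by_cases hy : IsMark (C.side (.inl e₀) v y)
  · rw [joinFactor_comm hω]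
    exact key y x hxy.symm (by rw [h, pair_comm]) hy
  have hv : ∀ i, C.foot (.inr i) ≠ v := fun i hi => by
    rcases hmark i hi with k | k
    · exact hx ⟨i, by rw [← k]; rfl⟩
    · exact hy ⟨i, by rw [← k]; rfl⟩
  rw [if_neg (fun ⟨i, hi⟩ => hv i hi), filter_false_of_mem fun i _ => hv i, prod_empty,
    Nat.cast_one, one_mul, vertexFactor_eq_joinFactor hω hxy h hx hy]

/-- The product of the refined multiplicity and the factors of the marked points, in terms of the
nested family. -/
theorem weight_eq_familyWeight (hω : ω.IsAlt) (hC : C.IsTrivalent) (e₀ : ι) :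
    C.weight ω φ = familyWeight ω (kernelSpan n ω) φ n (.inl e₀) (C.splits (.inl e₀)) := by
  classical
  rw [familyWeight, if_pos ⟨C.isNested_splits _,
    (C.forall_card_branch_eq_three_iff (.inl e₀)).1 hC⟩, C.nodes_splits,
    prod_image fun _ _ _ _ h => C.below_injective _ h,
    prod_congr rfl fun v _ => vertexWeight_children_below hω hC e₀ v, prod_mul_distrib,
    ← Nat.cast_prod, prod_fiberwise, CombType.weight, nsmul_eq_mul, CombType.refinedMult,
    prod_filter]
  congr 1
  refine prod_congr rfl fun v _ => ?_
  by_cases hv : C.IsMarked v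
  · rw [if_pos hv, if_neg (not_not.2 hv)]
  · rw [if_neg hv, if_pos hv]

omit [Fintype ι] [DecidableEq ι] in
theorem degSum_markedDegree (A : Finset (ι ⊕ Fin p)) :
    degSum (markedDegree n p) A = ∑ e ∈ A.toLeft, n e := by
  rw [degSum, ← A.toLeft_disjSum_toRight, sum_disjSum]
  simp [markedDegree]

/-- The bivectors which vanish under `ω` at the vertices of curves with marked points are
those of the vertices of curves without marked points. -/
theorem wedge_mem_kernelSpan (e₀ : ι) {A B : Finset (ι ⊕ Fin p)} (hA : A ⊆ ground (.inl e₀))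
    (hB : B ⊆ ground (.inl e₀)) (hAB : Disjoint A B)
    (h : ω (degSum (markedDegree n p) A) (degSum (markedDegree n p) B) = 0) :
    wedge (degSum (markedDegree n p) A) (degSum (markedDegree n p) B) ∈ kernelSpan n ω := by
  rw [degSum_markedDegree, degSum_markedDegree] at h ⊢
  rcases A.toLeft.eq_empty_or_nonempty with hA0 | hA0
  · rw [hA0, sum_empty, wedge_zero_left]
    exact zero_mem _
  rcases B.toLeft.eq_empty_or_nonempty with hB0 | hB0
  · rw [hB0, sum_empty, wedge_zero_right]
    exact zero_mem _
  refine Submodule.subset_span ⟨A.toLeft, B.toLeft, ?_, hA0, hB0, ⟨e₀, ?_⟩, h, rfl⟩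
  · refine disjoint_left.2 fun e h1 h2 => disjoint_left.1 hAB (mem_toLeft.1 h1) (mem_toLeft.1 h2)
  · rw [mem_compl, mem_union, mem_toLeft, mem_toLeft]
    rintro (h1 | h1)
    · exact mem_ground.1 (hA h1) rfl
    · exact mem_ground.1 (hB h1) rfl

end Weight

end TropicalCount

namespace TropicalCount

/-! ### The case where the moment of the root end vanishes -/

section Degenerate

open Finset

variable {N : Type*} [AddCommGroup N] {ω ω' : LinearMap.BilinForm ℤ N}
  {K : Submodule ℤ (⋀[ℤ]^2 N)} {ι : Type*} [Fintype ι] [DecidableEq ι] {p : ℕ} {n : ι → N}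
  {φ : Fin p → N →ₗ[ℤ] ℤ} {o : ι ⊕ Fin p} {F : Finset (Finset (ι ⊕ Fin p))}

theorem exists_children_of_familyWeight_ne_zero (hω : ω.IsAlt) (hE : 2 ≤ #(ground o))
    (hF : familyWeight ω K φ n o F ≠ 0) {A : Finset (ι ⊕ Fin p)} (hA : A ∈ nodes o F) :
    ∃ X Y, X ≠ Y ∧ children o F A = {X, Y} ∧ joinFactor ω K φ n X Y ≠ 0 := by
  obtain ⟨h1, h2⟩ := familyWeight_ne_zero hF
  obtain ⟨X, Y, hXY, h⟩ := card_eq_two.1 ((h1.card_children_eq_two_iff hE).2 h2 A hA)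
  refine ⟨X, Y, hXY, h, fun h0 => hF ?_⟩
  rw [familyWeight, if_pos ⟨h1, h2⟩]
  refine prod_eq_zero hA ?_
  rw [h, vertexWeight_pair hω hXY, h0]

/-- If the moment of the root end vanishes identically, then every trivalent type of a degree with
at least three ends has multiplicity zero: its first unmarked vertex, as seen from the root, has
factor zero. -/
theorem familyWeight_eq_zero_of_degenerate (hω : ω.IsAlt) {e₀ : ι} (hsum : ∑ e, n e = 0)
    (h0 : ω (n e₀) = 0) (hι : 3 ≤ Fintype.card ι) (hE : 2 ≤ #(ground (.inl e₀ : ι ⊕ Fin p))) :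
    familyWeight ω K φ n (.inl e₀) F = 0 := by
  by_contra hF
  have hnest := (familyWeight_ne_zero hF).1
  have hne : ((nodes (.inl e₀) F).filter fun A => ∀ e, e ≠ e₀ → .inl e ∈ A).Nonempty :=
    ⟨ground (.inl e₀), mem_filter.2 ⟨ground_mem_nodes, fun e he =>
      mem_ground.2 fun h => he (Sum.inl_injective h)⟩⟩
  obtain ⟨A, hA, hmin⟩ := exists_min_image _ card hne
  rw [mem_filter] at hA
  obtain ⟨X, Y, hXY, hch, hj⟩ := exists_children_of_familyWeight_ne_zero hω hE hF hA.1
  have hAo := hnest.node_subset hA.1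
  have hX : X ∈ children (.inl e₀) F A := by rw [hch]; simp
  have hY : Y ∈ children (.inl e₀) F A := by rw [hch]; simp
  have hdisj := hnest.disjoint_children hE hX hY hXY
  have hun : X ∪ Y = A := by
    rw [← hnest.biUnion_children hE hA.1, hch]
    ext; simp
  have key : ∀ X Y : Finset (ι ⊕ Fin p), Y ∈ children (.inl e₀) F A → X ∪ Y = A →
      ¬ IsMark X := by
    rintro X Y hY hun ⟨i, rfl⟩
    have hYl : ∀ e, e ≠ e₀ → .inl e ∈ Y := fun e he => by
      have := hA.2 e he
      rw [← hun, mem_union, mem_singleton] at this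
      exact this.resolve_left Sum.inl_ne_inr
    have hcard : 2 ≤ #Y := by
      have h1 : (univ.erase e₀).image Sum.inl ⊆ Y := fun z hz => by
        obtain ⟨e, he, rfl⟩ := mem_image.1 hz
        exact hYl e (ne_of_mem_erase he)
      have h2 := card_le_card h1
      rw [card_image_of_injective _ Sum.inl_injective, card_erase_of_mem (mem_univ _), card_univ]
        at h2
      omega
    have hYF := IsNested.mem_of_cell_of_two_le (mem_children.1 hY).1 hcard
    have h1 := hmin Y (mem_filter.2 ⟨mem_nodes.2 (Or.inr hYF), hYl⟩)
    exact absurd (card_lt_card (hnest.ssubset_of_mem_children hE hY)) (not_lt.2 h1)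
  have hXm := key X Y hY hun
  have hYm := key Y X hX (by rw [union_comm, hun])
  have hdeg : degSum (markedDegree n p) A = -n e₀ := by
    rw [← degSum_ground hsum, degSum_markedDegree, degSum_markedDegree]
    congr 1
    ext e
    rw [mem_toLeft, mem_toLeft]
    refine ⟨fun h => hAo h, fun h => hA.2 e fun he => mem_ground.1 h (by rw [he])⟩
  have hz : ω (degSum (markedDegree n p) X) (degSum (markedDegree n p) Y) = 0 := by
    have h1 : ω (degSum (markedDegree n p) A) (degSum (markedDegree n p) Y) = 0 := by
      rw [hdeg, map_neg, h0]; simp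
    rw [← hun, degSum_union _ hdisj, map_add, LinearMap.add_apply, hω.self_eq_zero, add_zero] at h1
    exact h1
  rw [joinFactor_of_not_isMark hXm hYm, hz, sign_zero, SignType.coe_zero, zero_smul] at hj
  exact hj rfl

section TwoEnds

variable {e₀ e₁ : ι} (hι : ∀ e, e = e₀ ∨ e = e₁)

include hι in
theorem degSum_of_two_ends {A : Finset (ι ⊕ Fin p)} (hA : A ⊆ ground (.inl e₀)) :
    degSum (markedDegree n p) A = if .inl e₁ ∈ A then n e₁ else 0 := by
  have h : A.toLeft = if .inl e₁ ∈ A then {e₁} else ∅ := by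
    ext e
    rw [mem_toLeft]
    rcases hι e with rfl | rfl
    · have h1 : (.inl e : ι ⊕ Fin p) ∉ A := fun h => mem_ground.1 (hA h) rfl
      split_ifs with h2
      · rw [mem_singleton]
        exact ⟨fun h => absurd h h1, fun h => absurd h2 (h ▸ h1)⟩
      · simp [h1]
    · split_ifs with h2 <;> simp [h2]
  rw [degSum_markedDegree, h]
  split_ifs
  · rw [sum_singleton]
  · rw [sum_empty]

include hι in
theorem wedge_of_two_ends {A B : Finset (ι ⊕ Fin p)} (hA : A ⊆ ground (.inl e₀))
    (hB : B ⊆ ground (.inl e₀)) :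
    wedge (degSum (markedDegree n p) A) (degSum (markedDegree n p) B) = 0 := by
  rw [degSum_of_two_ends hι hA, degSum_of_two_ends hι hB]
  split_ifs <;> simp only [wedge_self, wedge_zero_left, wedge_zero_right]

include hι in
theorem joinFactor_of_two_ends {X Y : Finset (ι ⊕ Fin p)} (hX : X ⊆ ground (.inl e₀))
    (hY : Y ⊆ ground (.inl e₀)) (hXm : ¬ IsMark X) (hYm : ¬ IsMark Y) :
    joinFactor ω K φ n X Y = 0 := by
  rw [joinFactor_of_not_isMark hXm hYm, qDiff_eq_zero K, smul_zero]
  rw [wedge_of_two_ends hι hX hY]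
  exact zero_mem K

include hι in
/-- For a degree with two ends, all bivectors vanish, so that the multiplicity does not depend on
the form `ω`. -/
theorem familyWeight_congr_of_two_ends (hω : ω.IsAlt) (hω' : ω'.IsAlt)
    (hE : 2 ≤ #(ground (.inl e₀ : ι ⊕ Fin p))) :
    familyWeight ω K φ n (.inl e₀) F = familyWeight ω' K φ n (.inl e₀) F := by
  by_cases h : IsNested (.inl e₀) F ∧ #F + 2 = #(ground (.inl e₀ : ι ⊕ Fin p))
  swap
  · rw [familyWeight, familyWeight, if_neg h, if_neg h]
  rw [familyWeight, familyWeight, if_pos h, if_pos h]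
  refine prod_congr rfl fun A hA => ?_
  obtain ⟨X, Y, hXY, hch⟩ := card_eq_two.1 ((h.1.card_children_eq_two_iff hE).2 h.2 A hA)
  have hsub : ∀ Z ∈ children (.inl e₀) F A, Z ⊆ ground (.inl e₀) := fun Z hZ =>
    (h.1.ssubset_of_mem_children hE hZ).subset.trans (h.1.node_subset hA)
  have hX := hsub X (by rw [hch]; simp)
  have hY := hsub Y (by rw [hch]; simp)
  rw [hch, vertexWeight_pair hω hXY, vertexWeight_pair hω' hXY]
  by_cases hXm : IsMark X
  · obtain ⟨i, rfl⟩ := hXm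
    rw [joinFactor_mark_left, joinFactor_mark_left]
  by_cases hYm : IsMark Y
  · obtain ⟨i, rfl⟩ := hYm
    rw [joinFactor_mark_right, joinFactor_mark_right]
  rw [joinFactor_of_two_ends hι hX hY hXm hYm, joinFactor_of_two_ends hι hX hY hXm hYm]

include hι in
/-- A type of non-zero multiplicity is a line with marked points. -/
theorem mem_of_familyWeight_ne_zero (hω : ω.IsAlt) (hE : 2 ≤ #(ground (.inl e₀ : ι ⊕ Fin p)))
    (hF : familyWeight ω K φ n (.inl e₀) F ≠ 0) {A : Finset (ι ⊕ Fin p)}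
    (hA : A ∈ cells (.inl e₀) F) (hAm : ¬ IsMark A) : .inl e₁ ∈ A := by
  have hnest := (familyWeight_ne_zero hF).1
  induction hd : #A using Nat.strong_induction_on generalizing A with
  | _ d ih =>
    rcases mem_cells.1 hA with hAF | ⟨e, he, rfl⟩
    · have hAn : A ∈ nodes (.inl e₀) F := mem_nodes.2 (Or.inr hAF)
      obtain ⟨X, Y, hXY, hch, hj⟩ := exists_children_of_familyWeight_ne_zero hω hE hF hAn
      have hX : X ∈ children (.inl e₀) F A := by rw [hch]; simp
      have hY : Y ∈ children (.inl e₀) F A := by rw [hch]; simp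
      have hsub := fun Z hZ => hnest.ssubset_of_mem_children hE (A := A) (B := Z) hZ
      have key : ∀ Z ∈ children (.inl e₀) F A, ¬ IsMark Z → .inl e₁ ∈ A := fun Z hZ hZm =>
        (hsub Z hZ).subset (ih _ (hd ▸ card_lt_card (hsub Z hZ)) (mem_children.1 hZ).1 hZm rfl)
      by_cases hXm : IsMark X
      · refine key Y hY ?_
        rintro ⟨j, rfl⟩
        obtain ⟨i, rfl⟩ := hXm
        rw [joinFactor_mark_left, degSum_mark, map_zero, Int.natAbs_zero, Nat.cast_zero] at hj
        exact hj rfl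
      · exact key X hX hXm
    · rcases e with e | i
      · rcases hι e with rfl | rfl
        · exact absurd rfl he
        · exact mem_singleton_self _
      · exact absurd ⟨i, rfl⟩ hAm

/-- The span of the image of the cone of a line with marked points does not depend on the order of
the marked points, provided that the evaluation map forgets the direction of the line on its two
ends. -/
theorem coneSpan_le_of_two_ends {B : Type*} [AddCommGroup B] (Φ : (ι ⊕ Fin p → N) →ₗ[ℤ] B)
    (hι : ∀ e, e = e₀ ∨ e = e₁) (hne : e₁ ≠ e₀)
    (hΦ : ∀ e, Φ (Pi.single (.inl e) (n e₁)) = 0) (hω : ω.IsAlt)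
    (hE : 2 ≤ #(ground (.inl e₀ : ι ⊕ Fin p))) {F' : Finset (Finset (ι ⊕ Fin p))}
    (hF : familyWeight ω K φ n (.inl e₀) F ≠ 0) (hF' : familyWeight ω K φ n (.inl e₀) F' ≠ 0) :
    coneSpan (markedDegree n p) Φ F ≤ coneSpan (markedDegree n p) Φ F' := by
  have hnest := (familyWeight_ne_zero hF).1
  have hnest' := (familyWeight_ne_zero hF').1
  set S := coneSpan (markedDegree n p) Φ F' with hS
  have hdeg : ∀ {A : Finset (ι ⊕ Fin p)}, A ⊆ ground (.inl e₀) → .inl e₁ ∈ A →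
      degSum (markedDegree n p) A = n e₁ := fun hA h => by
    rw [degSum_of_two_ends hι hA, if_pos h]
  -- Edges of the line, including its two unbounded ends.
  have hcell : ∀ A : Finset (ι ⊕ Fin p), (A ∈ cells (.inl e₀) F' ∨ A ∈ nodes (.inl e₀) F') →
      ¬ IsMark A → (1 : ℝ) ⊗ₜ[ℤ] Φ (rayVector (markedDegree n p) A) ∈ S := by
    intro A hA hAm
    have hA' : A ∈ F' ∨ A = ground (.inl e₀) ∨ A = {.inl e₁} := by
      rcases hA with hA | hA
      · rcases mem_cells.1 hA with hA | ⟨e, he, rfl⟩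
        · exact Or.inl hA
        · rcases e with e | i
          · rcases hι e with rfl | rfl
            · exact absurd rfl he
            · exact Or.inr (Or.inr rfl)
          · exact absurd ⟨i, rfl⟩ hAm
      · rcases mem_nodes.1 hA with hA | hA
        · exact Or.inr (Or.inl hA)
        · exact Or.inl hA
    rcases hA' with hA | rfl | rfl
    · exact ray_mem_coneSpan _ Φ hA
    · have h1 : rayVector (markedDegree n p) (ground (.inl e₀)) =
          (fun _ => n e₁) - Pi.single (.inl e₀) (n e₁) := by
        funext z
        rw [rayVector, hdeg Subset.rfl (mem_ground.2 fun h => hne (Sum.inl_injective h)),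
          Pi.sub_apply]
        by_cases hz : z = .inl e₀
        · rw [hz, Pi.single_eq_same, sub_self, if_neg fun h => mem_ground.1 h rfl]
        · rw [Pi.single_eq_of_ne hz, sub_zero, if_pos (mem_ground.2 hz)]
      rw [h1, map_sub, hΦ, sub_zero]
      exact const_mem_coneSpan _ Φ _ _
    · have h1 : rayVector (markedDegree n p) ({.inl e₁} : Finset (ι ⊕ Fin p)) =
          Pi.single (.inl e₁) (n e₁) := by
        funext z
        rw [rayVector, degSum_singleton]
        by_cases hz : z = .inl e₁
        · rw [hz, Pi.single_eq_same, if_pos (mem_singleton_self _)]; rfl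
        · rw [Pi.single_eq_of_ne hz, if_neg fun h => hz (mem_singleton.1 h)]
      rw [h1, hΦ, TensorProduct.tmul_zero]
      exact zero_mem _
  -- Each marked point is the difference of two consecutive edges.
  have hmark : ∀ i : Fin p, (1 : ℝ) ⊗ₜ[ℤ] Φ (Pi.single (.inr i) (n e₁)) ∈ S := by
    intro i
    have hc : ({.inr i} : Finset (ι ⊕ Fin p)) ∈ cells (.inl e₀) F' :=
      mem_cells.2 (Or.inr ⟨_, Sum.inr_ne_inl, rfl⟩)
    have hA := (hnest'.parent_cell hE hc).1
    set A := parent (.inl e₀) F' {.inr i} with hAdef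
    obtain ⟨X, Y, hXY, hch, hj⟩ := exists_children_of_familyWeight_ne_zero hω hE hF' hA
    have hi : ({.inr i} : Finset (ι ⊕ Fin p)) ∈ children (.inl e₀) F' A :=
      mem_children.2 ⟨hc, rfl⟩
    have key : ∀ Y : Finset (ι ⊕ Fin p), {.inr i} ≠ Y →
        children (.inl e₀) F' A = {{.inr i}, Y} → joinFactor ω K φ n {.inr i} Y ≠ 0 →
        (1 : ℝ) ⊗ₜ[ℤ] Φ (Pi.single (.inr i) (n e₁)) ∈ S := by
      intro Y hne' hch hj
      have hY : Y ∈ children (.inl e₀) F' A := by rw [hch]; simp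
      have hYm : ¬ IsMark Y := by
        rintro ⟨j, rfl⟩
        rw [joinFactor_mark_left, degSum_mark, map_zero, Int.natAbs_zero, Nat.cast_zero] at hj
        exact hj rfl
      have hYA := (hnest'.ssubset_of_mem_children hE hY).subset
      have he₁ := mem_of_familyWeight_ne_zero hι hω hE hF' (mem_children.1 hY).1 hYm
      have hAm : ¬ IsMark A := by
        rintro ⟨j, hj⟩
        have := hYA he₁
        rw [hj, mem_singleton] at this
        exact Sum.inl_ne_inr this
      have hun : {.inr i} ∪ Y = A := by
        rw [← hnest'.biUnion_children hE hA, hch]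
        ext; simp
      have hdisj := hnest'.disjoint_children hE hi hY hne'
      have h1 : (Pi.single (.inr i) (n e₁) : ι ⊕ Fin p → N) =
          rayVector (markedDegree n p) A - rayVector (markedDegree n p) Y := by
        have hAo := hnest'.node_subset hA
        funext z
        rw [Pi.sub_apply, rayVector, rayVector, hdeg hAo (hYA he₁), hdeg (hYA.trans hAo) he₁]
        by_cases hz : z = .inr i
        · rw [hz, Pi.single_eq_same, if_pos (by rw [← hun]; simp),
            if_neg (disjoint_singleton_left.1 hdisj), sub_zero]
        · have : z ∈ A ↔ z ∈ Y := by
            rw [← hun, mem_union, mem_singleton]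
            exact or_iff_right hz
          rw [Pi.single_eq_of_ne hz]
          simp only [this, sub_self]
      rw [h1, map_sub, TensorProduct.tmul_sub]
      exact sub_mem (hcell A (Or.inr hA) hAm) (hcell Y (Or.inl (mem_children.1 hY).1) hYm)
    rw [hch, mem_insert, mem_singleton] at hi
    rcases hi with rfl | rfl
    · exact key Y hXY hch hj
    · exact key X hXY.symm (by rw [hch, pair_comm]) (by rwa [joinFactor_comm hω])
  refine Submodule.span_le.2 ?_
  rintro _ (⟨A, hA, rfl⟩ | ⟨x, rfl⟩)
  · have hAm : ¬ IsMark A := fun h => by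
      have := hnest.two_le A hA
      rw [h.card_eq_one] at this
      omega
    have he₁ := mem_of_familyWeight_ne_zero hι hω hE hF (mem_cells.2 (Or.inl hA)) hAm
    have hAo := (hnest.ssubset A hA).subset
    have h1 : rayVector (markedDegree n p) A = ∑ z ∈ A, Pi.single z (n e₁) := by
      funext z
      rw [rayVector, hdeg hAo he₁, Finset.sum_apply]
      simp only [Pi.single_apply, Finset.sum_ite_eq]
    change (1 : ℝ) ⊗ₜ[ℤ] Φ (rayVector (markedDegree n p) A) ∈ S
    rw [h1, map_sum, TensorProduct.tmul_sum]
    refine sum_mem fun z _ => ?_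
    rcases z with e | i
    · rw [hΦ, TensorProduct.tmul_zero]
      exact zero_mem _
    · exact hmark i
  · exact const_mem_coneSpan _ Φ _ _

end TwoEnds

/-- On a lattice of rank at least two, every non-zero vector lies outside the kernel of some
alternating form. -/
theorem exists_isAlt_ne_zero [Module.Free ℤ N] [Module.Finite ℤ N] (hr : 2 ≤ Module.finrank ℤ N)
    {v : N} (hv : v ≠ 0) : ∃ (ω : LinearMap.BilinForm ℤ N) (δ : N), ω.IsAlt ∧ ω v δ ≠ 0 := by
  let b := Module.finBasis ℤ N
  obtain ⟨i, hi⟩ : ∃ i, b.coord i v ≠ 0 := by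
    by_contra! h
    exact hv (b.forall_coord_eq_zero_iff.1 h)
  obtain ⟨j, hj⟩ : ∃ j, j ≠ i := by
    have : Nontrivial (Fin (Module.finrank ℤ N)) := Fin.nontrivial_iff_two_le.2 hr
    exact exists_ne i
  refine ⟨(b.coord i).smulRight (b.coord j) - (b.coord j).smulRight (b.coord i), b j,
    fun x => ?_, ?_⟩
  · simp [mul_comm]
  · simpa [hj, Finsupp.single_apply] using hi

end Degenerate

end TropicalCount

namespace TropicalCount

/-! ### Coordinates on the moduli space -/

section Moduli

open Finset

variable {E N : Type*} [Fintype E] [DecidableEq E] [AddCommGroup N] {n : E → N} {o : E}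

variable (o) in
/-- The nested family of a combinatorial type. -/
noncomputable def CombClass.splits : CombClass n → Finset (Finset E) :=
  Quotient.lift (fun C => C.splits o) fun _ _ ⟨σ, h⟩ => LabelledTree.splits_eq_of_iso σ h.foot

/-- The point `Γ` of the moduli space has the nested family `F`, edge lengths `f` and root vertex at
`x`. The values of `f` outside `F` are irrelevant. -/
def Moduli.HasCoord (Γ : Moduli n) (o : E) (F : Finset (Finset E)) (f : Finset E → ℝ)
    (x : ℝ ⊗[ℤ] N) : Prop :=
  ∃ Γ' : TropicalCurve n, ⟦Γ'⟧ = Γ ∧ Γ'.splits o = F ∧ f ∘ Γ'.edgeCell o = Γ'.length ∧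
    Γ'.pos (Γ'.foot o) = x

theorem TropicalCurve.isRealization (Γ : TropicalCurve n) {f : Finset E → ℝ}
    (h : f ∘ Γ.edgeCell o = Γ.length) : Γ.toCombType.IsRealization
      (TensorProduct.mk ℤ ℝ N 1).toAddMonoidHom (f ∘ Γ.edgeCell o) Γ.pos := by
  rw [h]
  exact Γ.affine

theorem Moduli.exists_hasCoord (Γ : Moduli n) (o : E) :
    ∃ f x, Γ.HasCoord o (Γ.type.splits o) f x := by
  induction Γ using Quotient.inductionOn with
  | h Γ =>
    obtain ⟨f, hf⟩ := Γ.toLabelledTree.exists_comp_edgeCell o Γ.length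
    exact ⟨f, _, Γ, rfl, rfl, hf, rfl⟩

namespace Moduli.HasCoord

variable {Γ Γ' : Moduli n} {F : Finset (Finset E)} {f f' : Finset E → ℝ} {x : ℝ ⊗[ℤ] N}

theorem splits_eq (h : Γ.HasCoord o F f x) : Γ.type.splits o = F := by
  obtain ⟨Γ, rfl, rfl, -, -⟩ := h
  rfl

theorem pos (h : Γ.HasCoord o F f x) {A : Finset E} (hA : A ∈ F) : 0 < f A := by
  obtain ⟨Γ, rfl, rfl, hf, -⟩ := h
  rw [← mem_coe, ← Γ.range_edgeCell] at hA
  obtain ⟨γ, rfl⟩ := hA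
  rw [show f (Γ.edgeCell o γ) = Γ.length γ from congrFun hf γ]
  exact Γ.length_pos γ

/-- A curve is determined by its nested family, its edge lengths and the position of one vertex. -/
theorem unique (h : Γ.HasCoord o F f x) (h' : Γ'.HasCoord o F f' x) (hf : ∀ A ∈ F, f A = f' A) :
    Γ = Γ' := by
  obtain ⟨Γ, rfl, rfl, h2, h3⟩ := h
  obtain ⟨Γ', rfl, k1, k2, k3⟩ := h'
  obtain ⟨σ, hσ, hb⟩ := CombType.exists_isIso_of_splits_eq (C := Γ.toCombType) (D := Γ'.toCombType)
    k1.symm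
  refine Quotient.sound ⟨σ, hσ, fun γ => ?_, fun v => ?_⟩
  · have hcell : Γ'.edgeCell o (σ.mapEdgeSet γ) = Γ.edgeCell o γ := by
      obtain ⟨γ, hγ⟩ := γ
      induction γ with
      | _ v w =>
        change Γ'.below o (σ v) ∩ Γ'.below o (σ w) = Γ.below o v ∩ Γ.below o w
        rw [hb, hb]
    rw [← h2, ← k2, Function.comp_apply, Function.comp_apply, hcell]
    exact (hf _ (Γ.edgeCell_mem γ)).symm
  · rw [CombType.isRealization_iff.1 (Γ.isRealization h2) v,
      CombType.isRealization_iff.1 (Γ'.isRealization k2) (σ v), h3, k3, hb, k1]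
    congr 1
    refine sum_congr rfl fun A hA => ?_
    rw [hf A (mem_filter.1 hA).1]

end Moduli.HasCoord

theorem IsNested.exists_moduli {F : Finset (Finset E)} (h : IsNested o F)
    (hE : 2 ≤ #(ground o)) (hsum : ∑ e, n e = 0) {f : Finset E → ℝ} (hf : ∀ A ∈ F, 0 < f A)
    (x : ℝ ⊗[ℤ] N) : ∃ Γ : Moduli n, Γ.HasCoord o F f x := by
  let C := (h.tree hE).toCombType o n hsum
  have hC : C.splits o = F := h.tree_splits hE
  obtain ⟨pos, h1, h2⟩ := C.exists_isRealization (TensorProduct.mk ℤ ℝ N 1).toAddMonoidHom o f x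
  let Γ : TropicalCurve n :=
    { toCombType := C
      length := f ∘ C.edgeCell o
      length_pos := fun γ => hf _ (hC ▸ C.edgeCell_mem γ)
      pos := pos
      affine := h1 }
  exact ⟨⟦Γ⟧, Γ, rfl, hC, rfl, h2⟩

variable (L : ∀ e, Submodule ℤ (N ⧸ Submodule.span ℤ {n e}))

/-- The space of constraints as the realification of a lattice. -/
noncomputable def constraintEquiv : ℝ ⊗[ℤ] (∀ e, ConstraintQuot L e) ≃ₗ[ℝ] ConstraintSpace L :=
  TensorProduct.piRight ℤ ℝ ℝ _

/-- The image under the evaluation map of the ray of the moduli space given by `A`. -/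
noncomputable def evRay (A : Finset E) : ConstraintSpace L :=
  constraintEquiv L (1 ⊗ₜ[ℤ] constraintMap L (rayVector n A))

/-- The evaluation map on the lineality space of the moduli space. -/
noncomputable def evLin : ℝ ⊗[ℤ] N →ₗ[ℝ] ConstraintSpace L :=
  LinearMap.pi fun e => (toQuot L e).baseChange ℝ

theorem constraintEquiv_tmul (x : ∀ e, ConstraintQuot L e) (e : E) :
    constraintEquiv L (1 ⊗ₜ[ℤ] x) e = 1 ⊗ₜ[ℤ] x e := by
  simp [constraintEquiv]

theorem evLin_tmul (x : N) :
    evLin L (1 ⊗ₜ[ℤ] x) = constraintEquiv L (1 ⊗ₜ[ℤ] constraintMap L fun _ => x) := by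
  funext e
  rw [constraintEquiv_tmul]
  exact LinearMap.baseChange_tmul _ _ _

variable {L}

theorem Moduli.HasCoord.ev_eq {Γ : Moduli n} {F : Finset (Finset E)} {f : Finset E → ℝ}
    {x : ℝ ⊗[ℤ] N} (h : Γ.HasCoord o F f x) : Γ.ev L = evLin L x + ∑ A ∈ F, f A • evRay L A := by
  obtain ⟨Γ, rfl, rfl, h1, rfl⟩ := h
  funext e
  change (toQuot L e).baseChange ℝ (Γ.pos (Γ.foot e)) = _
  rw [(Γ.isRealization h1).pos_foot e, map_add, map_sum, Pi.add_apply, Finset.sum_apply]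
  congr 1

/-- The images of the points of a cone lie in the linear span of the image, considered as a subspace
of the space of constraints. -/
theorem mem_map_coneSpan (F : Finset (Finset E)) (f : Finset E → ℝ) (x : ℝ ⊗[ℤ] N) :
    evLin L x + ∑ A ∈ F, f A • evRay L A ∈
      (coneSpan n (constraintMap L) F).map (constraintEquiv L).toLinearMap := by
  refine add_mem ?_ (sum_mem fun A hA => Submodule.smul_mem _ _
    (Submodule.mem_map_of_mem (ray_mem_coneSpan n _ hA)))
  induction x with
  | zero => rw [map_zero]; exact zero_mem _
  | add x y hx hy => rw [map_add]; exact add_mem hx hy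
  | tmul c x =>
    have : (c : ℝ) ⊗ₜ[ℤ] x = c • ((1 : ℝ) ⊗ₜ[ℤ] x) := by
      rw [TensorProduct.smul_tmul', smul_eq_mul, mul_one]
    rw [this, map_smul, evLin_tmul]
    exact Submodule.smul_mem _ _ (Submodule.mem_map_of_mem (const_mem_coneSpan n _ F x))

end Moduli

/-! ### Frames -/

section Frames

open Finset

theorem IsFrame.card_eq {S W : Type*} [DecidableEq S] [AddCommGroup W] [Module ℝ W] {m r : ℕ}
    {p : S → W} {y : Fin r → W} {F : Finset S} {B : Module.Basis (Fin m ⊕ Fin r) ℝ W}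
    {l : Fin m → S} (h : IsFrame p y F B l) : #F = m := by
  rw [← h.image, card_image_of_injective _ h.injective, card_univ, Fintype.card_fin]

variable {E N B W : Type*} [DecidableEq E] [AddCommGroup N] [AddCommGroup B] [AddCommGroup W]
  [Module ℝ W] {m r : ℕ}

/-- If the image of a cone spans the target, then its rays, together with a basis of the lineality
space, are mapped to a basis. -/
theorem exists_isFrame (n : E → N) (Φ : (E → N) →ₗ[ℤ] B) (e : ℝ ⊗[ℤ] B ≃ₗ[ℝ] W)
    (b : Module.Basis (Fin r) ℤ N) {F : Finset (Finset E)} (hF : coneSpan n Φ F = ⊤)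
    (hcard : #F ≤ m) (hW : Module.finrank ℝ W = m + r) :
    ∃ B l, IsFrame (m := m) (fun A => e (1 ⊗ₜ[ℤ] Φ (rayVector n A)))
      (fun j => e (1 ⊗ₜ[ℤ] Φ fun _ => b j)) F B l := by
  classical
  set p : Finset E → W := fun A => e (1 ⊗ₜ[ℤ] Φ (rayVector n A)) with hp
  set y : Fin r → W := fun j => e (1 ⊗ₜ[ℤ] Φ fun _ => b j) with hy
  let g : N →+ W := AddMonoidHom.mk' (fun x => e (1 ⊗ₜ[ℤ] Φ fun _ => x)) fun x x' => by
    rw [← map_add, ← TensorProduct.tmul_add, ← map_add]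
    rfl
  have hspan : Submodule.span ℝ (p '' F ∪ Set.range y) = ⊤ := by
    rw [eq_top_iff, ← (LinearEquiv.range e), LinearMap.range_eq_map, ← hF, coneSpan,
      Submodule.map_span_le]
    rintro _ (⟨A, hA, rfl⟩ | ⟨x, rfl⟩)
    · exact Submodule.subset_span (Or.inl ⟨A, hA, rfl⟩)
    · change g x ∈ _
      rw [← b.sum_repr x, map_sum]
      refine sum_mem fun j _ => ?_
      rw [map_zsmul]
      exact (Submodule.span ℝ (p '' F ∪ Set.range y)).toAddSubgroup.zsmul_mem
        (Submodule.subset_span (Or.inr ⟨j, rfl⟩)) _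
  have hFm : #F = m := by
    refine le_antisymm hcard ?_
    have h1 := finrank_span_finset_le_card (R := ℝ) (F.image p ∪ univ.image y)
    have h2 := (card_union_le (F.image p) (univ.image y)).trans
      (add_le_add card_image_le card_image_le)
    rw [card_univ, Fintype.card_fin] at h2
    rw [coe_union, coe_image, coe_image, coe_univ, Set.image_univ, Set.finrank, hspan, finrank_top,
      hW] at h1
    omega
  let q := F.equivFinOfCardEq hFm
  have hrange : Set.range (fun i => (q.symm i).1) = F := by
    ext A
    refine ⟨?_, fun hA => ⟨q ⟨A, hA⟩, congrArg Subtype.val (q.symm_apply_apply _)⟩⟩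
    rintro ⟨i, rfl⟩
    exact (q.symm i).2
  have hspan' : ⊤ ≤ Submodule.span ℝ (Set.range (Sum.elim (p ∘ fun i => (q.symm i).1) y)) := by
    rw [Set.Sum.elim_range, Set.range_comp, hrange, hspan]
  refine ⟨basisOfTopLeSpanOfCardEqFinrank _ hspan' (by simp [hW]), fun i => (q.symm i).1,
    fun i j h => q.symm.injective (Subtype.ext h), ?_, coe_basisOfTopLeSpanOfCardEqFinrank _ _ _⟩
  rw [← coe_inj, coe_image, coe_univ, Set.image_univ, hrange]

end Frames

/-! ### Solutions and nested families -/

section Solutions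

open Finset

variable {E N : Type*} [Fintype E] [DecidableEq E] [AddCommGroup N] {n : E → N} {o : E}
  {L : ∀ e, Submodule ℤ (N ⧸ Submodule.span ℤ {n e})}

open scoped Classical in
variable (L o) in
/-- The nested families of the types on whose cones the evaluation map is invertible. -/
noncomputable def topFamilies : Finset (Finset (Finset E)) :=
  univ.filter fun F => IsNested o F ∧ coneSpan n (constraintMap L) F = ⊤

theorem mem_topFamilies {F : Finset (Finset E)} :
    F ∈ topFamilies o L ↔ IsNested o F ∧ coneSpan n (constraintMap L) F = ⊤ := by
  simp [topFamilies]

theorem range_evLin {r : ℕ} (b : Module.Basis (Fin r) ℤ N) : LinearMap.range (evLin L) =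
    Submodule.span ℝ
      (Set.range fun j => constraintEquiv L (1 ⊗ₜ[ℤ] constraintMap L fun _ => b j)) := by
  rw [LinearMap.range_eq_map, ← (Algebra.TensorProduct.basis ℝ b).span_eq, Submodule.map_span,
    ← Set.range_comp]
  congr 2
  funext j
  rw [Function.comp_apply, Algebra.TensorProduct.basis_apply, evLin_tmul]

theorem evLin_injective {r m : ℕ} (b : Module.Basis (Fin r) ℤ N) {F : Finset (Finset E)}
    {B : Module.Basis (Fin m ⊕ Fin r) ℝ (ConstraintSpace L)} {l : Fin m → Finset E}
    (h : IsFrame (evRay L)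
      (fun j => constraintEquiv L (1 ⊗ₜ[ℤ] constraintMap L fun _ => b j)) F B l) :
    Function.Injective (evLin L) := by
  have hy : LinearIndependent ℝ (evLin L ∘ Algebra.TensorProduct.basis ℝ b) := by
    have h1 := B.linearIndependent.comp Sum.inr Sum.inr_injective
    rw [h.eq] at h1
    convert h1 using 1
    funext j
    rw [Function.comp_apply, Algebra.TensorProduct.basis_apply, evLin_tmul]
    rfl
  rw [← LinearMap.ker_eq_bot]
  exact LinearMap.ker_eq_bot'.2 fun x hx => by
    let b' := Algebra.TensorProduct.basis ℝ b
    rw [← b'.sum_repr x, map_sum] at hx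
    simp only [map_smul] at hx
    have := Fintype.linearIndependent_iff.1 hy _ hx
    rw [← b'.sum_repr x]
    exact sum_eq_zero fun j _ => by rw [this j, zero_smul]

variable {P : FanMap (Finset E) (ConstraintSpace L)} (hray : P.ray = evRay L)
  (hlin : P.lin = LinearMap.range (evLin L))

include hray hlin in
theorem coord_ev {F : Finset (Finset E)} (hF : F ∈ P.top) (f : Finset E → ℝ) (x : ℝ ⊗[ℤ] N)
    {A : Finset E} (hA : A ∈ F) : P.coord F (evLin L x + ∑ A ∈ F, f A • evRay L A) A = f A := by
  rw [map_add, P.coord_lin F hF _ (by rw [hlin]; exact ⟨x, rfl⟩), zero_add, map_sum,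
    Finset.sum_apply, sum_eq_single A]
  · rw [map_smul, ← hray, P.coord_ray F hF A hA, Pi.smul_apply, Pi.single_eq_same, smul_eq_mul,
      mul_one]
  · intro A' hA' hne
    rw [map_smul, ← hray, P.coord_ray F hF A' hA', Pi.smul_apply, Pi.single_eq_of_ne hne.symm,
      smul_zero]
  · exact fun h => absurd hA h

include hray hlin in
theorem exists_evLin_eq {F : Finset (Finset E)} (hF : F ∈ P.top) (lam : ConstraintSpace L) :
    ∃ x, lam = evLin L x + ∑ A ∈ F, P.coord F lam A • evRay L A := by
  have h := P.sub_sum_mem F hF lam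
  rw [hlin, hray] at h
  obtain ⟨x, hx⟩ := h
  refine ⟨x, ?_⟩
  rw [hx, sub_add_eq_add_sub, eq_sub_iff_add_eq]
  congr 1
  exact (sum_subset (subset_univ F) fun A _ hA => by
    rw [P.coord_of_notMem F hF A hA, zero_smul]).symm

variable [∀ e, Module.Free ℤ (ConstraintQuot L e)]

theorem finrank_constraintSpace : Module.finrank ℝ (ConstraintSpace L) =
    Module.finrank ℤ (∀ e, ConstraintQuot L e) := by
  rw [← (constraintEquiv L).finrank_eq, Module.finrank_baseChange]

variable [Module.Finite ℤ N] [Module.Free ℤ N] (hE : 2 ≤ #(ground o))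
  {m : ℕ} (hm : m + 2 = #(ground o))
  (hrank : Module.finrank ℤ (∀ e, ConstraintQuot L e) = m + Module.finrank ℤ N)

include hE hm hrank in
theorem exists_isFrame_of_mem_topFamilies {F : Finset (Finset E)} (hF : F ∈ topFamilies o L) :
    ∃ B l, IsFrame (m := m) (evRay L) (fun j => constraintEquiv L
      (1 ⊗ₜ[ℤ] constraintMap L fun _ => Module.finBasis ℤ N j)) F B l := by
  obtain ⟨h1, h2⟩ := mem_topFamilies.1 hF
  refine exists_isFrame n (constraintMap L) (constraintEquiv L) _ h2 ?_ ?_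
  · have := h1.card_add_two_le hE
    omega
  · rw [finrank_constraintSpace, hrank]

include hE hm hrank in
theorem card_of_mem_topFamilies {F : Finset (Finset E)} (hF : F ∈ topFamilies o L) : #F = m := by
  obtain ⟨B, l, h⟩ := exists_isFrame_of_mem_topFamilies hE hm hrank hF
  exact h.card_eq

include hE hm hrank in
/-- The cones of the nested families in `topFamilies` are the top-dimensional cones with non-zero
determinant. -/
theorem splits_mem_topFamilies_iff (C : CombType n) :
    C.splits o ∈ topFamilies o L ↔ C.IsTrivalent ∧ C.complexMult L ≠ 0 := by
  have key : #(C.splits o) = m → (C.complexMult L ≠ 0 ↔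
      coneSpan n (constraintMap L) (C.splits o) = ⊤) := fun h => by
    rw [CombType.complexMult, C.ev_eq]
    exact C.absDet_endPos_ne_zero_iff _ (by rw [h, hrank])
  have htri : C.IsTrivalent ↔ #(C.splits o) = m := by
    rw [CombType.IsTrivalent, C.forall_card_branch_eq_three_iff o]
    omega
  rw [htri]
  constructor
  · intro h
    have hc := card_of_mem_topFamilies hE hm hrank h
    exact ⟨hc, (key hc).2 (mem_topFamilies.1 h).2⟩
  · rintro ⟨hc, h⟩
    exact mem_topFamilies.2 ⟨C.isNested_splits o, (key hc).1 h⟩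

include hE hm hrank in
/-- The constraints are generic if and only if every solution lies in the interior of a
top-dimensional cone on which the evaluation map is invertible. -/
theorem isGeneric_iff (lam : ConstraintSpace L) : IsGeneric L lam ↔
    ∀ Γ ∈ solutions L lam, Γ.type.splits o ∈ topFamilies o L := by
  refine forall₂_congr fun Γ _ => ?_
  constructor
  · intro h
    obtain ⟨C, hC⟩ := Quotient.exists_rep Γ.type
    rw [← hC]
    exact (splits_mem_topFamilies_iff hE hm hrank C).2 (h C hC.symm)
  · intro h C hC
    rw [hC] at h
    exact (splits_mem_topFamilies_iff hE hm hrank C).1 h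

include hE hm hrank in
/-- The constraints outside finitely many proper subspaces are generic. -/
theorem exists_finite_forall_isGeneric :
    ∃ 𝒰 : Set (Submodule ℝ (ConstraintSpace L)), 𝒰.Finite ∧ (∀ U ∈ 𝒰, U ≠ ⊤) ∧
      ∀ lam, (∀ U ∈ 𝒰, lam ∉ U) → IsGeneric L lam := by
  refine ⟨(fun F => (coneSpan n (constraintMap L) F).map (constraintEquiv L).toLinearMap) ''
    {F | coneSpan n (constraintMap L) F ≠ ⊤}, (Set.toFinite _).image _, ?_, fun lam hlam => ?_⟩
  · rintro _ ⟨F, hF, rfl⟩ h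
    refine hF (Submodule.map_injective_of_injective (constraintEquiv L).injective (h.trans ?_))
    rw [Submodule.map_top, LinearEquiv.range]
  · rw [isGeneric_iff (o := o) hE hm hrank]
    intro Γ hΓ
    obtain ⟨f, x, h⟩ := Γ.exists_hasCoord o
    have hnest : IsNested o (Γ.type.splits o) := by
      obtain ⟨Γ', -, h', -⟩ := h
      rw [← h']
      exact Γ'.isNested_splits o
    refine mem_topFamilies.2 ⟨hnest, ?_⟩
    by_contra hne
    refine hlam _ ⟨_, hne, rfl⟩ ?_
    rw [← show Γ.ev L = lam from hΓ, h.ev_eq]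
    exact mem_map_coneSpan _ f x

variable (htop : P.top = topFamilies o L)

include hE hm hrank htop hray hlin

/-- Generic constraints do not lie on the boundary of the image of a cone. -/
theorem isRegular_of_isGeneric (hsum : ∑ e, n e = 0) {lam : ConstraintSpace L}
    (hlam : IsGeneric L lam) : P.IsRegular lam := by
  intro F hF hnn
  rw [isGeneric_iff (o := o) hE hm hrank] at hlam
  obtain ⟨x, hx⟩ := exists_evLin_eq hray hlin hF lam
  have hFt := hF
  rw [htop] at hFt
  have hnest := (mem_topFamilies.1 hFt).1
  -- Contracting the edges with coordinate zero gives a solution, which has to be of full dimension.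
  set G := F.filter fun A => 0 < P.coord F lam A with hG
  have hGF : G ⊆ F := filter_subset _ _
  obtain ⟨Γ, hΓ⟩ := (hnest.mono hGF).exists_moduli hE hsum (f := P.coord F lam)
    (fun A hA => (mem_filter.1 hA).2) x
  have hsol : Γ ∈ solutions L lam := by
    change Γ.ev L = lam
    rw [hΓ.ev_eq]
    conv_rhs => rw [hx]
    congr 1
    refine sum_subset hGF fun A hA hAG => ?_
    have h0 : P.coord F lam A = 0 :=
      le_antisymm (not_lt.1 fun h => hAG (mem_filter.2 ⟨hA, h⟩)) (hnn A hA)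
    rw [h0, zero_smul]
  have hGt := hlam Γ hsol
  rw [hΓ.splits_eq] at hGt
  have hGF' : G = F := eq_of_subset_of_card_le hGF (by
    rw [card_of_mem_topFamilies hE hm hrank hGt, card_of_mem_topFamilies hE hm hrank hFt])
  intro A hA
  rw [← hGF'] at hA
  exact (mem_filter.1 hA).2

/-- The solutions of a generic problem correspond to the cones whose image contains the constraints
in its interior. -/
theorem bijOn_solutions (hsum : ∑ e, n e = 0) {lam : ConstraintSpace L} (hlam : IsGeneric L lam) :
    Set.BijOn (fun Γ : Moduli n => Γ.type.splits o) (solutions L lam)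
      {F | F ∈ P.top ∧ ∀ A ∈ F, 0 < P.coord F lam A} := by
  have hgen := (isGeneric_iff (o := o) hE hm hrank lam).1 hlam
  refine ⟨fun Γ hΓ => ?_, fun Γ hΓ Γ' hΓ' h => ?_, ?_⟩
  · have hF := hgen Γ hΓ
    rw [← htop] at hF
    obtain ⟨f, x, h⟩ := Γ.exists_hasCoord o
    refine ⟨hF, fun A hA => ?_⟩
    rw [← show Γ.ev L = lam from hΓ, h.ev_eq, coord_ev hray hlin hF f x hA]
    exact h.pos hA
  · change Γ.type.splits o = Γ'.type.splits o at h
    have hF := hgen Γ hΓ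
    obtain ⟨B, l, hB⟩ := exists_isFrame_of_mem_topFamilies hE hm hrank hF
    rw [← htop] at hF
    obtain ⟨f, x, h1⟩ := Γ.exists_hasCoord o
    obtain ⟨f', x', h2⟩ := Γ'.exists_hasCoord o
    rw [← h] at h2
    have k1 : lam = _ := (show Γ.ev L = lam from hΓ).symm.trans h1.ev_eq
    have k2 : lam = _ := (show Γ'.ev L = lam from hΓ').symm.trans h2.ev_eq
    have hf : ∀ A ∈ Γ.type.splits o, f A = f' A := fun A hA => by
      rw [← coord_ev hray hlin hF f x hA, ← k1, k2, coord_ev hray hlin hF f' x' hA]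
    have hx : x = x' := evLin_injective _ hB (by
      have := k1.symm.trans k2
      rw [sum_congr rfl fun A hA => by rw [hf A hA]] at this
      exact add_right_cancel this)
    rw [← hx] at h2
    exact h1.unique h2 hf
  · rintro F ⟨hF, hpos⟩
    obtain ⟨x, hx⟩ := exists_evLin_eq hray hlin hF lam
    rw [htop] at hF
    obtain ⟨Γ, hΓ⟩ := (mem_topFamilies.1 hF).1.exists_moduli hE hsum hpos x
    exact ⟨Γ, hΓ.ev_eq.trans hx.symm, hΓ.splits_eq⟩

theorem finite_solutions (hsum : ∑ e, n e = 0) {lam : ConstraintSpace L} (hlam : IsGeneric L lam) :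
    (solutions L lam).Finite :=
  Set.Finite.of_finite_image (Set.toFinite _)
    (bijOn_solutions hray hlin hE hm hrank htop hsum hlam).injOn

open scoped Classical in
/-- A weighted number of curves is a weighted number of cones. -/
theorem finsum_solutions (hsum : ∑ e, n e = 0) {lam : ConstraintSpace L} (hlam : IsGeneric L lam)
    {R : Type*} [AddCommGroup R] {w : Moduli n → R} {c : Finset (Finset E) → R}
    (hw : ∀ Γ ∈ solutions L lam, w Γ = c (Γ.type.splits o)) :
    ∑ᶠ Γ ∈ solutions L lam, w Γ = P.count c lam := by
  rw [finsum_mem_eq_of_bijOn _ (bijOn_solutions hray hlin hE hm hrank htop hsum hlam) hw,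
    FanMap.count, ← sum_filter, ← finsum_mem_coe_finset]
  simp

end Solutions

end TropicalCount

namespace TropicalCount

/-! ### Invariance of the count -/

section Invariance

open Finset

variable {N : Type*} [AddCommGroup N] [Module.Free ℤ N] [Module.Finite ℤ N]
  {ι : Type*} [Fintype ι] [DecidableEq ι] {n : ι → N} {p : ℕ}
  {L : ∀ z, Submodule ℤ (N ⧸ Submodule.span ℤ {markedDegree n p z})}
  [∀ z, Module.Free ℤ (ConstraintQuot L z)] {ω : LinearMap.BilinForm ℤ N}
  {K : Submodule ℤ (⋀[ℤ]^2 N)} {φ : Fin p → N →ₗ[ℤ] ℤ} {e₀ : ι} {δ : N} {m : ℕ}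

/-- The evaluation map of the constraint problem as a map of fans. -/
theorem exists_fanMap {E : Type*} [Fintype E] [DecidableEq E] {n : E → N} {o : E}
    {L : ∀ e, Submodule ℤ (N ⧸ Submodule.span ℤ {n e})}
    [∀ e, Module.Free ℤ (ConstraintQuot L e)]
    (hE : 2 ≤ #(ground o)) (hm : m + 2 = #(ground o))
    (hrank : Module.finrank ℤ (∀ e, ConstraintQuot L e) = m + Module.finrank ℤ N) :
    ∃ P : FanMap (Finset E) (ConstraintSpace L), P.top = topFamilies o L ∧ P.ray = evRay L ∧
      P.lin = LinearMap.range (evLin L) := by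
  have h : ∀ F, ∃ B l, F ∈ topFamilies o L → IsFrame (m := m) (evRay L)
      (fun j => constraintEquiv L (1 ⊗ₜ[ℤ] constraintMap L fun _ => Module.finBasis ℤ N j))
      F B l := by
    intro F
    by_cases hF : F ∈ topFamilies o L
    · obtain ⟨B, l, h⟩ := exists_isFrame_of_mem_topFamilies hE hm hrank hF
      exact ⟨B, l, fun _ => h⟩
    -- The coordinates given by a family outside `topFamilies` are irrelevant.
    · have b := Module.finBasisOfFinrankEq ℝ (ConstraintSpace L)
        (finrank_constraintSpace.trans hrank)
      exact ⟨b.reindex finSumFinEquiv.symm, fun _ => ∅, fun h => absurd h hF⟩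
  choose B l h using h
  exact ⟨FanMap.ofFrames _ _ (topFamilies o L) B l h, rfl, rfl, (range_evLin _).symm⟩

/-- The image under the evaluation map of the moment problem of the ray given by `A`. -/
noncomputable def momentRay (ω : LinearMap.BilinForm ℤ N) (φ : Fin p → N →ₗ[ℤ] ℤ) (n : ι → N)
    (e₀ : ι) (δ : N) (A : Finset (ι ⊕ Fin p)) : ℝ ⊗[ℤ] MomentTarget n p e₀ δ :=
  1 ⊗ₜ[ℤ] momentMap ω φ n e₀ δ (rayVector (markedDegree n p) A)

/-- The images under the evaluation map of the moment problem of a basis of the lineality space. -/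
noncomputable def momentLin (ω : LinearMap.BilinForm ℤ N) (φ : Fin p → N →ₗ[ℤ] ℤ) (n : ι → N)
    (e₀ : ι) (δ : N) (j : Fin (Module.finrank ℤ N)) : ℝ ⊗[ℤ] MomentTarget n p e₀ δ :=
  1 ⊗ₜ[ℤ] momentMap ω φ n e₀ δ fun _ => Module.finBasis ℤ N j

theorem finrank_moment (hω : ω.IsAlt) (hδ : ω (n e₀) δ ≠ 0)
    (hm : m + 2 = #(ground (.inl e₀ : ι ⊕ Fin p))) :
    Module.finrank ℝ (ℝ ⊗[ℤ] MomentTarget n p e₀ δ) = m + Module.finrank ℤ N := by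
  rw [Module.finrank_baseChange]
  have h1 := finrank_momentTarget (p := p) hω hδ
  rw [ground, card_erase_of_mem (mem_univ _), card_univ, Fintype.card_sum, Fintype.card_fin] at hm
  have h2 : 0 < Fintype.card ι := Fintype.card_pos_iff.2 ⟨e₀⟩
  omega

/-- On a cone of non-zero refined multiplicity the moment problem is given by a basis. -/
theorem exists_isFrame_moment (hω : ω.IsAlt) (hsum : ∑ e, n e = 0)
    (hE : 2 ≤ #(ground (.inl e₀ : ι ⊕ Fin p))) (hm : m + 2 = #(ground (.inl e₀ : ι ⊕ Fin p)))
    (hδ : ω (n e₀) δ ≠ 0) {F : Finset (Finset (ι ⊕ Fin p))}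
    (hF : familyWeight ω K φ n (.inl e₀) F ≠ 0) :
    ∃ B l, IsFrame (m := m) (momentRay ω φ n e₀ δ) (momentLin ω φ n e₀ δ) F B l :=
  exists_isFrame _ _ (LinearEquiv.refl ℝ _) (Module.finBasis ℤ N)
    (coneSpan_moment_eq_top hω hsum hE hδ hF) (by have := (familyWeight_ne_zero hF).2; omega)
    (finrank_moment hω hδ hm)

/-- The refined multiplicities are balanced with respect to the moment problem. -/
theorem sum_sign_momentRay_smul_familyWeight (hω : ω.IsAlt) (hsum : ∑ e, n e = 0)
    (hE : 2 ≤ #(ground (.inl e₀ : ι ⊕ Fin p)))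
    (hK : ∀ A B, A ⊆ ground (.inl e₀) → B ⊆ ground (.inl e₀) → Disjoint A B →
      ω (degSum (markedDegree n p) A) (degSum (markedDegree n p) B) = 0 →
      wedge (degSum (markedDegree n p) A) (degSum (markedDegree n p) B) ∈ K)
    (G : Finset (Finset (ι ⊕ Fin p))) (β : ℝ ⊗[ℤ] MomentTarget n p e₀ δ →ₗ[ℝ] ℝ)
    (hβ : ∀ A ∈ G, β (momentRay ω φ n e₀ δ A) = 0) (hβl : ∀ j, β (momentLin ω φ n e₀ δ j) = 0) :
    ∑ s with s ∉ G, (SignType.sign (β (momentRay ω φ n e₀ δ s)) : ℤ) •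
      familyWeight ω K φ n (.inl e₀) (insert s G) = 0 := by
  let β' : MomentTarget n p e₀ δ →ₗ[ℤ] ℝ :=
    (β.restrictScalars ℤ) ∘ₗ (TensorProduct.mk ℤ ℝ (MomentTarget n p e₀ δ) 1)
  refine sum_sign_moment_smul_familyWeight hω hsum hE hK G β' hβ fun x => ?_
  let g : N →ₗ[ℤ] ℝ := β' ∘ₗ momentMap ω φ n e₀ δ ∘ₗ LinearMap.pi fun _ => LinearMap.id
  have hg : g = 0 := (Module.finBasis ℤ N).ext hβl
  exact LinearMap.congr_fun hg x

/-- If the cones of non-zero multiplicity are top-dimensional for the given constraints, the signs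
which compare the orientations given by the constraints and by the moment problem make the refined
multiplicities balanced. -/
theorem exists_isBalanced (hω : ω.IsAlt) (hsum : ∑ e, n e = 0)
    (hE : 2 ≤ #(ground (.inl e₀ : ι ⊕ Fin p))) (hm : m + 2 = #(ground (.inl e₀ : ι ⊕ Fin p)))
    (hrank : Module.finrank ℤ (∀ z, ConstraintQuot L z) = m + Module.finrank ℤ N)
    (hδ : ω (n e₀) δ ≠ 0)
    (hK : ∀ A B, A ⊆ ground (.inl e₀) → B ⊆ ground (.inl e₀) → Disjoint A B →
      ω (degSum (markedDegree n p) A) (degSum (markedDegree n p) B) = 0 →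
      wedge (degSum (markedDegree n p) A) (degSum (markedDegree n p) B) ∈ K)
    (hw : ∀ F, familyWeight ω K φ n (.inl e₀) F ≠ 0 → F ∈ topFamilies (.inl e₀) L)
    {P : FanMap (Finset (ι ⊕ Fin p)) (ConstraintSpace L)}
    (htop : P.top = topFamilies (.inl e₀) L) (hray : P.ray = evRay L)
    (hlin : P.lin = LinearMap.range (evLin L)) :
    ∃ s : Finset (Finset (ι ⊕ Fin p)) → ℤˣ,
      P.IsBalanced fun F => (s F : ℤ) • familyWeight ω K φ n (.inl e₀) F := by
  have bW := (Module.finBasisOfFinrankEq ℝ (ConstraintSpace L)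
    (finrank_constraintSpace.trans hrank)).reindex finSumFinEquiv.symm
  have bW' := (Module.finBasisOfFinrankEq ℝ (ℝ ⊗[ℤ] MomentTarget n p e₀ δ)
    (finrank_moment hω hδ hm)).reindex finSumFinEquiv.symm
  refine ⟨coneSign bW bW' (evRay L) (fun j => constraintEquiv L
    (1 ⊗ₜ[ℤ] constraintMap L fun _ => Module.finBasis ℤ N j)) (momentRay ω φ n e₀ δ)
    (momentLin ω φ n e₀ δ), fun G α hα hαl => ?_⟩
  rw [hray] at hα
  rw [hlin] at hαl
  rw [htop, hray]
  refine Eq.trans ?_ (sum_coneSign_smul_eq_zero bW bW' (evRay L) (fun j => constraintEquiv L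
    (1 ⊗ₜ[ℤ] constraintMap L fun _ => Module.finBasis ℤ N j)) (momentRay ω φ n e₀ δ)
    (momentLin ω φ n e₀ δ) (topFamilies (.inl e₀) L)
    (fun F hF => exists_isFrame_of_mem_topFamilies hE hm hrank hF)
    (familyWeight ω K φ n (.inl e₀))
    (fun F hF => ⟨hw F hF, exists_isFrame_moment hω hsum hE hm hδ hF⟩)
    (fun G β hβ hβl => sum_sign_momentRay_smul_familyWeight hω hsum hE hK G β hβ hβl) G α hα
    (fun j => hαl _ (by rw [← evLin_tmul]; exact ⟨_, rfl⟩)))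
  refine sum_congr ?_ fun s _ => rfl
  ext s
  simp only [mem_filter]

end Invariance

end TropicalCount

namespace TropicalCount

section Count

open Finset

variable {N : Type*} [AddCommGroup N] [Module.Free ℤ N] [Module.Finite ℤ N]
  {ι : Type*} [Fintype ι] [DecidableEq ι] {n : ι → N} {p : ℕ}
  {L : ∀ z, Submodule ℤ (N ⧸ Submodule.span ℤ {markedDegree n p z})}
  [∀ z, Module.Free ℤ (ConstraintQuot L z)] {ω ω' : LinearMap.BilinForm ℤ N}
  {K : Submodule ℤ (⋀[ℤ]^2 N)} {φ : Fin p → N →ₗ[ℤ] ℤ} {e₀ e₁ : ι} {δ : N} {m : ℕ}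

/-- With suitable signs, the refined count does not depend on the generic constraints, if
`ω (n e₀) δ ≠ 0` and the cones of non-zero refined multiplicity are top-dimensional for the given
constraints. -/
theorem exists_sign_finsum_eq (hω : ω.IsAlt) (hsum : ∑ e, n e = 0)
    (hE : 2 ≤ #(ground (.inl e₀ : ι ⊕ Fin p))) (hm : m + 2 = #(ground (.inl e₀ : ι ⊕ Fin p)))
    (hrank : Module.finrank ℤ (∀ z, ConstraintQuot L z) = m + Module.finrank ℤ N)
    (hδ : ω (n e₀) δ ≠ 0)
    (hK : ∀ A B, A ⊆ ground (.inl e₀) → B ⊆ ground (.inl e₀) → Disjoint A B →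
      ω (degSum (markedDegree n p) A) (degSum (markedDegree n p) B) = 0 →
      wedge (degSum (markedDegree n p) A) (degSum (markedDegree n p) B) ∈ K)
    (hw : ∀ F, familyWeight ω K φ n (.inl e₀) F ≠ 0 → F ∈ topFamilies (.inl e₀) L) :
    ∃ (s : Finset (Finset (ι ⊕ Fin p)) → ℤˣ) (B : AddMonoidAlgebra ℤ ((⋀[ℤ]^2 N) ⧸ K)),
      ∀ lam, IsGeneric L lam → ∑ᶠ Γ ∈ solutions L lam, (s (Γ.type.splits (.inl e₀)) : ℤ) •
        familyWeight ω K φ n (.inl e₀) (Γ.type.splits (.inl e₀)) = B := by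
  obtain ⟨P, htop, hray, hlin⟩ := exists_fanMap hE hm hrank
  obtain ⟨s, hs⟩ := exists_isBalanced hω hsum hE hm hrank hδ hK hw htop hray hlin
  by_cases hgen : ∃ lam, IsGeneric L lam
  · obtain ⟨lam₀, hlam₀⟩ := hgen
    refine ⟨s, P.count (fun F => (s F : ℤ) • familyWeight ω K φ n (.inl e₀) F) lam₀,
      fun lam hlam => ?_⟩
    rw [finsum_solutions hray hlin hE hm hrank htop (sum_markedDegree hsum) hlam
      (c := fun F => (s F : ℤ) • familyWeight ω K φ n (.inl e₀) F) fun Γ _ => rfl]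
    exact FanMap.count_eq_count hs
      (isRegular_of_isGeneric hray hlin hE hm hrank htop (sum_markedDegree hsum) hlam)
      (isRegular_of_isGeneric hray hlin hE hm hrank htop (sum_markedDegree hsum) hlam₀)
  · exact ⟨s, 0, fun lam hlam => absurd ⟨lam, hlam⟩ hgen⟩

/-- The hypothesis that the multiplicity of the moment problem vanishes wherever that of the
constraints does, in terms of nested families. -/
theorem mem_topFamilies_of_familyWeight_ne_zero
    (hω : ω.IsAlt) (hsum : ∑ e, n e = 0)
    (hE : 2 ≤ #(ground (.inl e₀ : ι ⊕ Fin p))) (hm : m + 2 = #(ground (.inl e₀ : ι ⊕ Fin p)))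
    (hrank : Module.finrank ℤ (∀ z, ConstraintQuot L z) = m + Module.finrank ℤ N)
    (hδ : ω (n e₀) δ ≠ 0)
    (hzero : ∀ C : CombType (markedDegree n p), C.IsTrivalent →
      C.complexMult L = 0 → C.momentMult ω φ e₀ δ = 0) {F : Finset (Finset (ι ⊕ Fin p))}
    (hF : familyWeight ω K φ n (.inl e₀) F ≠ 0) : F ∈ topFamilies (.inl e₀) L := by
  obtain ⟨hnest, hcard⟩ := familyWeight_ne_zero hF
  let C := (hnest.tree hE).toCombType (.inl e₀) (markedDegree n p) (sum_markedDegree hsum)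
  have hC : C.splits (.inl e₀) = F := hnest.tree_splits hE
  have hCt : C.IsTrivalent := by
    rw [CombType.IsTrivalent, C.forall_card_branch_eq_three_iff (.inl e₀), hC, hcard]
  have hmult : C.momentMult ω φ e₀ δ ≠ 0 := by
    have hfr := finrank_moment (p := p) hω hδ hm
    rw [Module.finrank_baseChange] at hfr
    rw [CombType.momentMult, CombType.momentEv_eq,
      C.absDet_endPos_ne_zero_iff (o := .inl e₀) _ (by rw [hfr, hC]; omega), hC]
    exact coneSpan_moment_eq_top hω hsum hE hδ hF
  rw [← hC, splits_mem_topFamilies_iff hE hm hrank]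
  exact ⟨hCt, fun h => hmult (hzero C hCt h)⟩

omit [Module.Free ℤ N] [Module.Finite ℤ N] [Fintype ι]
  [∀ z, Module.Free ℤ (ConstraintQuot L z)] in
/-- For a degree with two ends, the constraints are not affected by moving an end in the direction
of the line. -/
theorem constraintMap_single_of_two_ends (hι : ∀ e, e = e₀ ∨ e = e₁) (h : n e₁ = -n e₀) (e : ι) :
    constraintMap L (Pi.single (.inl e) (n e₁)) = 0 := by
  funext z
  change toQuot L z (Pi.single (M := fun _ => N) (.inl e) (n e₁) z) = 0
  by_cases hz : z = .inl e
  · subst hz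
    rw [Pi.single_eq_same]
    have h1 : n e₁ ∈ Submodule.span ℤ {markedDegree n p (.inl e)} := by
      rcases hι e with rfl | rfl
      · rw [h]
        exact neg_mem (Submodule.mem_span_singleton_self _)
      · exact Submodule.mem_span_singleton_self _
    have h2 : (Submodule.span ℤ {markedDegree n p (.inl e)}).mkQ (n e₁) = 0 :=
      (Submodule.Quotient.mk_eq_zero _).2 h1
    rw [toQuot, LinearMap.comp_apply, h2, map_zero]
  · rw [Pi.single_eq_of_ne hz, map_zero]

/-- In the degenerate case `ω (n e₀) = 0` all multiplicities vanish, unless there are only two ends.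
In that case `ω` may be replaced by a form for which the moment of `e₀` does not vanish. -/
theorem exists_sign_finsum_eq_of_degenerate (hr : 2 ≤ Module.finrank ℤ N) (hn : ∀ e, n e ≠ 0)
    (hω : ω.IsAlt) (h0 : ω (n e₀) = 0) (hsum : ∑ e, n e = 0)
    (hE : 2 ≤ #(ground (.inl e₀ : ι ⊕ Fin p))) (hm : m + 2 = #(ground (.inl e₀ : ι ⊕ Fin p)))
    (hrank : Module.finrank ℤ (∀ z, ConstraintQuot L z) = m + Module.finrank ℤ N) :
    ∃ (s : Finset (Finset (ι ⊕ Fin p)) → ℤˣ) (B : AddMonoidAlgebra ℤ ((⋀[ℤ]^2 N) ⧸ K)),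
      ∀ lam, IsGeneric L lam → ∑ᶠ Γ ∈ solutions L lam, (s (Γ.type.splits (.inl e₀)) : ℤ) •
        familyWeight ω K φ n (.inl e₀) (Γ.type.splits (.inl e₀)) = B := by
  by_cases hall : ∀ F ∈ topFamilies (.inl e₀) L, familyWeight ω K φ n (.inl e₀) F = 0
  · refine ⟨1, 0, fun lam hlam => ?_⟩
    have hgen := (isGeneric_iff (o := .inl e₀) hE hm hrank lam).1 hlam
    rw [finsum_mem_congr rfl fun Γ hΓ => by rw [hall _ (hgen Γ hΓ), smul_zero], finsum_mem_zero]
  push Not at hall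
  obtain ⟨F, hFt, hF⟩ := hall
  have hcard : Fintype.card ι ≤ 2 := by
    by_contra! h
    exact hF (familyWeight_eq_zero_of_degenerate hω hsum h0 h hE)
  obtain ⟨e₁, hne⟩ : ∃ e₁, e₁ ≠ e₀ := by
    by_contra! h
    refine hn e₀ ?_
    rw [← hsum, ← sum_singleton n e₀]
    exact sum_congr (by ext e; simp [h e]) fun _ _ => rfl
  have huniv : ({e₀, e₁} : Finset ι) = univ :=
    eq_univ_of_card _ (le_antisymm (card_le_univ _) (by rwa [card_pair hne.symm]))
  have hι : ∀ e, e = e₀ ∨ e = e₁ := fun e => by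
    have h := mem_univ e
    rwa [← huniv, mem_insert, mem_singleton] at h
  have hneg : n e₁ = -n e₀ := by
    rw [← huniv, sum_pair hne.symm] at hsum
    exact (neg_eq_of_add_eq_zero_right hsum).symm
  obtain ⟨ω', δ, hω', hδ⟩ := exists_isAlt_ne_zero hr (hn e₀)
  have hcongr : ∀ F, familyWeight ω K φ n (.inl e₀) F = familyWeight ω' K φ n (.inl e₀) F :=
    fun F => familyWeight_congr_of_two_ends hι hω hω' hE
  simp only [hcongr] at hF ⊢
  refine exists_sign_finsum_eq hω' hsum hE hm hrank hδ (fun A B hA hB _ _ => ?_) fun F' hF' => ?_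
  · rw [wedge_of_two_ends hι hA hB]
    exact zero_mem K
  · refine mem_topFamilies.2 ⟨(familyWeight_ne_zero hF').1, top_le_iff.1 ?_⟩
    rw [← (mem_topFamilies.1 hFt).2]
    exact coneSpan_le_of_two_ends _ hι hne (constraintMap_single_of_two_ends hι hneg) hω' hE hF hF'

end Count

end TropicalCount

open TropicalCount

theorem mainTheorem8 {N : Type*} [AddCommGroup N] [Module.Free ℤ N] [Module.Finite ℤ N]
    (hr : 2 ≤ Module.finrank ℤ N)
    {ι : Type*} [Fintype ι] [DecidableEq ι]
    (n : ι → N) (hn : ∀ e, n e ≠ 0) (hsum : ∑ e, n e = 0) (p : ℕ)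
    (L : ∀ z, Submodule ℤ (N ⧸ Submodule.span ℤ {TropicalCount.markedDegree n p z}))
    (hfull : ∀ z, Module.IsTorsionFree ℤ (TropicalCount.ConstraintQuot L z))
    (hcork : ∑ z, Module.finrank ℤ (TropicalCount.ConstraintQuot L z) + 3 =
      Fintype.card ι + Module.finrank ℤ N + p)
    (ω : LinearMap.BilinForm ℤ N) (hω : ω.IsAlt) (φ : Fin p → N →ₗ[ℤ] ℤ)
    (e₀ : ι) (δ : N) (hδ : ω (n e₀) ≠ 0 → ω (n e₀) δ ≠ 0)
    (hzero : ∀ C : TropicalCount.CombType (TropicalCount.markedDegree n p), C.IsTrivalent →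
      C.complexMult L = 0 → C.momentMult ω φ e₀ δ = 0) :
    (∃ 𝒰 : Set (Submodule ℝ (TropicalCount.ConstraintSpace L)), 𝒰.Finite ∧ (∀ U ∈ 𝒰, U ≠ ⊤) ∧
      ∀ lam, (∀ U ∈ 𝒰, lam ∉ U) → TropicalCount.IsGeneric L lam) ∧
    ∃ ε : TropicalCount.CombClass (TropicalCount.markedDegree n p) → ℤˣ,
      ∃ B : AddMonoidAlgebra ℤ ((⋀[ℤ]^2 N) ⧸ TropicalCount.kernelSpan n ω),
        ∀ lam, TropicalCount.IsGeneric L lam →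
          (TropicalCount.solutions L lam).Finite ∧
          ∑ᶠ Γ ∈ TropicalCount.solutions L lam,
            (ε Γ.type : ℤ) • TropicalCount.CombClass.weight ω φ Γ.type = B := by
  have hfree : ∀ z, Module.Free ℤ (ConstraintQuot L z) := fun z =>
    have := hfull z
    inferInstance
  by_cases hE : 2 ≤ (ground (.inl e₀ : ι ⊕ Fin p)).card
  swap
  -- With fewer than three ends and marked points there is no curve at all.
  · have hempty : ∀ Γ : Moduli (markedDegree n p), False := fun Γ =>
      hE ((Quotient.exists_rep Γ).choose.two_le_card_ground _)
    have hsol : ∀ lam, solutions L lam = ∅ := fun lam =>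
      Set.eq_empty_of_forall_notMem fun Γ _ => hempty Γ
    refine ⟨⟨∅, Set.finite_empty, by simp, fun lam _ Γ => (hempty Γ).elim⟩, 1, 0, fun lam _ => ?_⟩
    rw [hsol, finsum_mem_empty]
    exact ⟨Set.finite_empty, rfl⟩
  obtain ⟨m, hm⟩ := Nat.exists_eq_add_of_le' hE
  replace hm := hm.symm
  have hrank : Module.finrank ℤ (∀ z, ConstraintQuot L z) = m + Module.finrank ℤ N := by
    have hground := hm
    rw [ground, Finset.card_erase_of_mem (Finset.mem_univ _), Finset.card_univ, Fintype.card_sum,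
      Fintype.card_fin] at hground
    rw [Module.finrank_pi_fintype]
    have h0 : 0 < Fintype.card ι := Fintype.card_pos_iff.2 ⟨e₀⟩
    omega
  refine ⟨exists_finite_forall_isGeneric hE hm hrank, ?_⟩
  obtain ⟨s, B, hB⟩ : ∃ (s : Finset (Finset (ι ⊕ Fin p)) → ℤˣ)
      (B : AddMonoidAlgebra ℤ ((⋀[ℤ]^2 N) ⧸ kernelSpan n ω)),
      ∀ lam, IsGeneric L lam → ∑ᶠ Γ ∈ solutions L lam, (s (Γ.type.splits (.inl e₀)) : ℤ) •
        familyWeight ω (kernelSpan n ω) φ n (.inl e₀) (Γ.type.splits (.inl e₀)) = B := by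
    by_cases h0 : ω (n e₀) = 0
    · exact exists_sign_finsum_eq_of_degenerate hr hn hω h0 hsum hE hm hrank
    · exact exists_sign_finsum_eq hω hsum hE hm hrank (hδ h0)
        (fun A B hA hB hAB h => wedge_mem_kernelSpan e₀ hA hB hAB h)
        fun F hF => mem_topFamilies_of_familyWeight_ne_zero hω hsum hE hm hrank (hδ h0) hzero hF
  refine ⟨fun C => s (C.splits (.inl e₀)), B, fun lam hlam => ?_⟩
  obtain ⟨P, htop, hray, hlin⟩ := exists_fanMap hE hm hrank
  refine ⟨finite_solutions hray hlin hE hm hrank htop (sum_markedDegree hsum) hlam, ?_⟩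
  rw [← hB lam hlam]
  refine finsum_mem_congr rfl fun Γ hΓ => ?_
  obtain ⟨C, hC⟩ := Quotient.exists_rep Γ.type
  have hCt := (hlam Γ hΓ C hC.symm).1
  rw [← hC]
  exact congrArg _ (weight_eq_familyWeight hω hCt e₀)
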